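/- **Theorem 1.1.** Let $1\le r\le n$, let $\Sigma^n$ be a connected smooth $n$-dimensional manifold (without boundary), and let $X:\Sigma^n\to\mathbb R^{n+1}$ be a smooth proper immersion (so that $\Sigma$ is complete in the induced metric) with a continuous globally defined unit normal field $N$. Let $A=-dN$ be the shape operator, $k_1,\dots,k_n$ its eigenvalues (the principal curvatures), $\sigma_j$ the $j$-th elementary symmetric function of $k_1,\dots,k_n$ ($\sigma_0=1$), and $$P_{k}=\sum_{j=0}^{k}(-1)^j\sigma_{k-j}A^j$$ the Newton transformations. Assume that $\Sigma$ is a self-shrinker of the $r$-mean curvature flow, i.e. $\sigma_r=-\langle X,N\rangle$ on $\Sigma$, that $P_{r-1}$ is positive semidefinite at every point and bounded on $\Sigma$, and that $$\|\sqrt{P_{r-1}}A\|^2=\operatorname{tr}(P_{r-1}A^2)\le r\quad\text{on }\Sigma .$$ (i) If $\|\sqrt{P_{r-1}}A\|^2<r$ at every point of $\Sigma$, then $X$ is injective and $X(\Sigma)$ is a hyperplane through the origin. (ii) If $P_{r-1}$ is positive definite at every point of $\Sigma$, then one of the following holds, where $\delta_m(r)=\binom{m}{r}^{1/(r+1)}$: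 * $X(\Sigma)$ is the round sphere $\mathbb S^n(\delta_n(r))$ of radius $\delta_n(r)$ centered at the origin (put $m=n$); * for some $m$ with $r\le m\le n-1$, $X(\Sigma)$ is, up to a rotation about the origin, the cylinder $\mathbb S^m(\delta_m(r))\times\mathbb R^{n-m}$; * $r=1$, $X$ is injective and $X(\Sigma)$ is a hyperplane through the origin. In the first two cases $X$ is moreover injective if $m\neq1$. -/

import Mathlib

open scoped Manifold ContDiff

noncomputable section

namespace RMeanCurvature

/-- Euclidean space `ℝᵏ`, with the standard inner product. -/
abbrev Euc (k : ℕ) : Type := EuclideanSpace ℝ (Fin k)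

section Hypersurface

variable {n : ℕ} {M : Type*} [TopologicalSpace M] [ChartedSpace (Euc n) M]

/-- The differential at `p` of a map `F : M → ℝⁿ⁺¹`; here `Tₚ M` is identified with `ℝⁿ` through
the preferred chart at `p`, as in Mathlib. The inner product of the model `ℝⁿ` has no geometric
meaning: the metric of `M` is `firstForm`. -/
def differential (F : M → Euc (n + 1)) (p : M) : Euc n →L[ℝ] Euc (n + 1) :=
  mfderiv (𝓡 n) 𝓘(ℝ, Euc (n + 1)) F p

/-- A smooth immersion: a `C^∞` map all of whose differentials are injective. -/
structure IsSmoothImmersion (X : M → Euc (n + 1)) : Prop where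
  smooth : ContMDiff (𝓡 n) 𝓘(ℝ, Euc (n + 1)) ∞ X
  injective : ∀ p, Function.Injective (differential X p)

/-- `N` is a continuous, globally defined unit normal vector field along `X`. -/
structure IsUnitNormal (X N : M → Euc (n + 1)) : Prop where
  continuous : Continuous N
  norm_eq_one : ∀ p, ‖N p‖ = 1
  orthogonal : ∀ p v, inner ℝ (differential X p v) (N p) = 0

/-- The metric induced by the immersion `X`. -/
def firstForm (X : M → Euc (n + 1)) (p : M) (v w : Euc n) : ℝ :=
  inner ℝ (differential X p v) (differential X p w)

/-- The shape operator `A = -(dX)⁻¹ ∘ dN`, where the inverse of `dX` on its range is given by the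
formula `(dX* dX)⁻¹ dX*`. -/
def shapeOperator (X N : M → Euc (n + 1)) (p : M) : Euc n →ₗ[ℝ] Euc n :=
  -(((differential X p).adjoint ∘L differential X p).inverse ∘L
      ((differential X p).adjoint ∘L differential N p)).toLinearMap

/-- The Weingarten formula `dX (A v) = -dN v` pins down the shape operator. -/
theorem shapeOperator_eq {X N : M → Euc (n + 1)} {p : M}
    (hX : Function.Injective (differential X p)) {v w : Euc n}
    (h : differential X p w = -differential N p v) : shapeOperator X N p v = w := by
  have hinj : Function.Injective ((differential X p).adjoint ∘L differential X p) := by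
    rw [injective_iff_map_eq_zero]
    intro u hu
    have h1 : inner ℝ (((differential X p).adjoint ∘L differential X p) u) u = 0 := by
      rw [hu, inner_zero_left]
    rw [ContinuousLinearMap.comp_apply, ContinuousLinearMap.adjoint_inner_left,
      inner_self_eq_zero] at h1
    exact hX (by rw [h1, map_zero])
  let e := (LinearEquiv.ofInjectiveEndo
    ((differential X p).adjoint ∘L differential X p).toLinearMap hinj).toContinuousLinearEquiv
  have he : (e : Euc n →L[ℝ] Euc n) = (differential X p).adjoint ∘L differential X p := by
    ext1 u; rfl
  have h2 : differential N p v = -differential X p w := by rw [h, neg_neg]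
  have h3 : (differential X p).adjoint (differential X p w) = e w := by rfl
  simp only [shapeOperator, ← he, ContinuousLinearMap.inverse_equiv, LinearMap.neg_apply,
    ContinuousLinearMap.coe_coe, ContinuousLinearMap.comp_apply, h2, map_neg, neg_neg, h3]
  exact e.symm_apply_apply w

/-- The principal curvatures `k₁, …, kₙ` at `p`: the eigenvalues of the shape operator, listed with
multiplicity. -/
def principalCurvatures (X N : M → Euc (n + 1)) (p : M) : Multiset ℝ :=
  (shapeOperator X N p).charpoly.roots

/-- `σⱼ`, the `j`-th elementary symmetric function of the principal curvatures. -/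
def sigma (X N : M → Euc (n + 1)) (j : ℕ) (p : M) : ℝ :=
  (principalCurvatures X N p).esymm j

/-- The Newton transformation `P_k = ∑_{j=0}^k (-1)^j σ_{k-j} A^j`. -/
def newton (X N : M → Euc (n + 1)) (k : ℕ) (p : M) : Euc n →ₗ[ℝ] Euc n :=
  ∑ j ∈ Finset.range (k + 1), ((-1 : ℝ) ^ j * sigma X N (k - j) p) • shapeOperator X N p ^ j

/-- `P_k` is positive semidefinite (for the induced metric) at every point. -/
def NewtonPosSemidef (X N : M → Euc (n + 1)) (k : ℕ) : Prop :=
  ∀ p v, 0 ≤ firstForm X p (newton X N k p v) v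

/-- `P_k` is positive definite (for the induced metric) at every point. -/
def NewtonPosDef (X N : M → Euc (n + 1)) (k : ℕ) : Prop :=
  ∀ p v, v ≠ 0 → 0 < firstForm X p (newton X N k p v) v

/-- `P_k` is bounded: its operator norms for the induced metric, at the points `p` of `M`, are
bounded by one constant. -/
def NewtonBounded (X N : M → Euc (n + 1)) (k : ℕ) : Prop :=
  ∃ C : ℝ, ∀ p v, √(firstForm X p (newton X N k p v) (newton X N k p v)) ≤
    C * √(firstForm X p v v)

/-- `‖√P_k A‖² = tr (P_k A²)`, the squared trace norm of the modified second fundamental form. -/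
def modifiedNormSq (X N : M → Euc (n + 1)) (k : ℕ) (p : M) : ℝ :=
  LinearMap.trace ℝ (Euc n) (newton X N k p * shapeOperator X N p ^ 2)

/-- The self-shrinker equation `σ_r = -⟨X, N⟩` of the `r`-mean curvature flow. -/
def IsSelfShrinker (X N : M → Euc (n + 1)) (r : ℕ) : Prop :=
  ∀ p, sigma X N r p = -inner ℝ (X p) (N p)

end Hypersurface

/-- `S` is a hyperplane through the origin of `ℝᵏ`. -/
def IsHyperplane {k : ℕ} (S : Set (Euc k)) : Prop :=
  ∃ ν : Euc k, ν ≠ 0 ∧ S = {y | inner ℝ ν y = 0}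

/-- `S` is, up to a rotation about the origin, `𝕊ᵐ(R) × ℝᵏ⁻ᵐ⁻¹` in `ℝᵏ = ℝᵐ⁺¹ × ℝᵏ⁻ᵐ⁻¹`: the set
of points whose orthogonal projection to some `(m+1)`-dimensional subspace has norm `R`. -/
def IsRoundCylinder {k : ℕ} (m : ℕ) (R : ℝ) (S : Set (Euc k)) : Prop :=
  ∃ W : Submodule ℝ (Euc k), Module.finrank ℝ W = m + 1 ∧ S = {y | ‖W.starProjection y‖ = R}

/-- The radius `δ_m(r) = binom(m, r) ^ (1 / (r + 1))`. -/
def delta (m r : ℕ) : ℝ := (m.choose r : ℝ) ^ (1 / ((r : ℝ) + 1))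

end RMeanCurvature

end

/-! Write `u = ⟨X, N⟩` for the support function, `P = P_{r-1}` and `L f = tr (P Hess f) - ⟨X, ∇f⟩`.
The Codazzi equation and the shrinker equation give `L u = (r - tr (P A²)) u` (`sum_hess_support`)
and `L ‖X‖² = 2 tr P - 2 (r - 1) u² - 2 ‖X‖²` (`sum_hess_normSq`). From these identities on, the
index `r` of most lemmas is the `r - 1` of the theorem.

Since `|u| ≤ ‖X‖` and `X` is proper, `±u - ε ‖X‖²` attains its maximum. If `±u` is positive
somewhere then, for small `ε`, the second identity and the bound on `P` confine the maximum points
to a compact set independent of `ε`. Letting `ε → 0`, `±u` itself attains its maximum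
(`exists_isMax_support`). When `tr (P A²) < r`, a positive maximum contradicts the first identity,
so `u = 0`. When `P` is positive definite, `L` is locally uniformly elliptic and Hopf's strong
maximum principle makes `u` constant (`exists_support_eq`).

Let now `u = -c`. The tangential part `X + cN` of the position vector is annihilated by `A`, so its
integral curves are rays `-cN + s (X + cN)` along which `N` is constant. Properness extends them to
all `s ≥ 0` (`exists_ray_point`). Along a principal direction of curvature `k`, the differential of
the map to the parameter `s` is multiplication by `ck + s (1 - ck)`. It cannot vanish unless `k =
0`: otherwise `N` would vary to first order while `X` does not, although `N` is locally Lipschitz in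
`X` (`principalCurvature_eq_zero_of_focus`). Hence `0 ≤ ck ≤ 1`, and `k = 0` if `c = 0`. If `c ≠ 0`,
the first identity gives `tr (P A²) = r`, while `tr (P A) = r σ_r = rc`. So `tr (P cA (1 - cA)) = 0`
with nonnegative terms, and `ck ∈ {0, 1}` (`curvature_eq_or`).

Thus `cA² = A`. Total symmetry of the derivative of `A` then makes the orthogonal projection to the
span of `N` and of the directions with `ck = 1` constant (`fderiv_sphericalProj`). Its range `W`
contains every `N`, and the projection of `X` is `-cN`. So `X` maps into a round cylinder, or into a
hyperplane if `c = 0`; the value of `σ_r` fixes the radius. The map to this model is a proper local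
homeomorphism, hence a covering onto it, and it is injective when the model is a hyperplane or its
spherical factor has dimension at least two. -/

noncomputable section

namespace RMeanCurvature

/-! ### Elementary symmetric functions of the principal curvatures. -/

section ElementarySymmetric

open Polynomial

variable {ι : Type*}

/-- The polynomial `∏_{i ∈ s} (1 + kᵢ X)`, whose coefficients are the elementary symmetric functions
of `(kᵢ)_{i ∈ s}`. -/
def esPoly (k : ι → ℝ) (s : Finset ι) : ℝ[X] := ∏ i ∈ s, (1 + C (k i) * X)

/-- The `j`-th elementary symmetric function of `(kᵢ)_{i ∈ s}`. -/
def es (k : ι → ℝ) (s : Finset ι) (j : ℕ) : ℝ := (esPoly k s).coeff j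

theorem eval_esPoly (k : ι → ℝ) (s : Finset ι) (t : ℝ) :
    (esPoly k s).eval t = ∏ i ∈ s, (1 + t * k i) := by
  simp only [esPoly, eval_prod, eval_add, eval_one, eval_mul, eval_C, eval_X, mul_comm]

theorem natDegree_esPoly_le (k : ι → ℝ) (s : Finset ι) : (esPoly k s).natDegree ≤ s.card := by
  refine (natDegree_prod_le _ _).trans ?_
  refine (Finset.sum_le_card_nsmul s _ 1 fun i _ => ?_).trans (by simp)
  compute_degree

theorem es_zero (k : ι → ℝ) (s : Finset ι) : es k s 0 = 1 := by
  simp [es, coeff_zero_eq_eval_zero, eval_esPoly]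

theorem esymm_eq_es (k : ι → ℝ) (s : Finset ι) (j : ℕ) : (s.val.map k).esymm j = es k s j := by
  rw [Finset.esymm_map_val, es, esPoly, Finset.prod_one_add]
  simp_rw [Finset.prod_mul_distrib, Finset.prod_const, ← map_prod]
  rw [finsetSum_coeff]
  simp_rw [coeff_C_mul_X_pow]
  rw [Finset.sum_ite, Finset.sum_const_zero, add_zero, Finset.powersetCard_eq_filter]
  simp_rw [eq_comm]

/-- Factors with `k i = 0` are `1`, so the generating polynomial is `(1 + κ X) ^ m` with `m` the
number of nonzero `k i`. This computes `σ_j` on a cylinder and, with `κ = 0`, at a flat point. -/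
theorem es_eq_choose (k : ι → ℝ) (s : Finset ι) (κ : ℝ) (h : ∀ i ∈ s, k i = 0 ∨ k i = κ)
    (j : ℕ) : es k s j = ((s.filter fun i => k i ≠ 0).card.choose j : ℝ) * κ ^ j := by
  have h1 : esPoly k s = ((1 + X : ℝ[X]) ^ (s.filter fun i => k i ≠ 0).card).comp (C κ * X) := by
    rw [esPoly, ← Finset.prod_filter_of_ne (p := fun i => k i ≠ 0)]
    · rw [Finset.prod_congr rfl (g := fun _ => 1 + C κ * X), Finset.prod_const]
      · simp
      · intro i hi
        rw [Finset.mem_filter] at hi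
        rw [(h i hi.1).resolve_left hi.2]
    · intro i _ h1 h2
      simp [h2] at h1
  rw [es, h1, comp_C_mul_X_coeff, coeff_one_add_X_pow]

variable [DecidableEq ι]

theorem es_succ (k : ι → ℝ) {s : Finset ι} {i : ι} (hi : i ∈ s) (j : ℕ) :
    es k s (j + 1) = es k (s.erase i) (j + 1) + k i * es k (s.erase i) j := by
  rw [es, esPoly, ← Finset.mul_prod_erase s _ hi, add_mul, one_mul, coeff_add, mul_assoc,
    coeff_C_mul, coeff_X_mul]
  rfl

/-- Division of the generating polynomial by its factor `1 + k i X`. This is why the Newton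
transformation acts on the `i`-th principal direction by the symmetric function of the other
curvatures. -/
theorem sum_neg_one_pow_mul_es (k : ι → ℝ) {s : Finset ι} {i : ι} (hi : i ∈ s) (j : ℕ) :
    ∑ l ∈ Finset.range (j + 1), (-1) ^ l * es k s (j - l) * k i ^ l = es k (s.erase i) j := by
  induction j with
  | zero => simp [es_zero]
  | succ j ih =>
    rw [Finset.sum_range_succ']
    have : ∀ l, (-1 : ℝ) ^ (l + 1) * es k s (j + 1 - (l + 1)) * k i ^ (l + 1) =
        -k i * ((-1) ^ l * es k s (j - l) * k i ^ l) := by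
      intro l
      rw [Nat.add_sub_add_right]
      ring
    simp_rw [this]
    rw [← Finset.mul_sum, ih]
    simp only [pow_zero, Nat.sub_zero, one_mul, mul_one]
    rw [es_succ k hi]
    ring

/-- Compare coefficients in the product rule for the derivative of `esPoly k s`. Geometrically this
is `tr (P_j A) = (j + 1) σ_{j+1}`. -/
theorem sum_es_erase_mul (k : ι → ℝ) (s : Finset ι) (j : ℕ) :
    ∑ i ∈ s, es k (s.erase i) j * k i = (j + 1) * es k s (j + 1) := by
  have h := congrArg (fun p => coeff p j)
    (derivative_prod_finset (s := s) (f := fun i => (1 + C (k i) * X : ℝ[X])))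
  simp only [derivative_add, derivative_one, derivative_C_mul, derivative_X, zero_add, mul_one,
    finsetSum_coeff, coeff_mul_C, coeff_derivative] at h
  rw [mul_comm]
  exact h.symm

end ElementarySymmetric

/-! ### Differentiating symmetric functions of eigenvalues through determinants. -/

section DetDerivative

open Polynomial

/-- A coefficient of a polynomial of bounded degree is a fixed linear combination of values. -/
theorem exists_coeff_eq_sum_eval (n j : ℕ) : ∃ c : ℕ → ℝ, ∀ f : ℝ[X], f.natDegree ≤ n →
    f.coeff j = ∑ i ∈ Finset.range (n + 1), f.eval (i : ℝ) * c i := by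
  have hinj : Set.InjOn (fun i : ℕ => (i : ℝ)) (Finset.range (n + 1)) :=
    fun a _ b _ hab => Nat.cast_injective hab
  refine ⟨fun i => (Lagrange.basis (Finset.range (n + 1)) (fun i : ℕ => (i : ℝ)) i).coeff j, ?_⟩
  intro f hf
  have hdeg : f.degree < (Finset.range (n + 1)).card := by
    rw [Finset.card_range]
    exact (degree_le_natDegree).trans_lt (by exact_mod_cast Nat.lt_succ_of_le hf)
  conv_lhs => rw [Lagrange.eq_interpolate hinj hdeg, Lagrange.interpolate_apply, finsetSum_coeff]
  simp_rw [coeff_C_mul]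

/-- Interpolation passes differentiability from values to coefficients. The roots themselves, which
may fail to be differentiable where they collide, are never differentiated. -/
theorem hasDerivAt_coeff {p : ℝ → ℝ[X]} {q : ℝ[X]} {n : ℕ} {t₀ : ℝ}
    (hp : ∀ t, (p t).natDegree ≤ n) (hq : q.natDegree ≤ n)
    (h : ∀ s, HasDerivAt (fun t => (p t).eval s) (q.eval s) t₀) (j : ℕ) :
    HasDerivAt (fun t => (p t).coeff j) (q.coeff j) t₀ := by
  obtain ⟨c, hc⟩ := exists_coeff_eq_sum_eval n j
  simp_rw [hc _ (hp _)]
  rw [hc _ hq]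
  exact HasDerivAt.fun_sum fun i _ => (h i).mul_const _

/-- The derivative of the determinant at a diagonal matrix. -/
theorem hasDerivAt_det_of_diagonal {ι : Type*} [Fintype ι] [DecidableEq ι] {M : ℝ → Matrix ι ι ℝ}
    {M' : Matrix ι ι ℝ} {d : ι → ℝ} {t₀ : ℝ} (h0 : M t₀ = Matrix.diagonal d)
    (h : ∀ i j, HasDerivAt (fun t => M t i j) (M' i j) t₀) :
    HasDerivAt (fun t => (M t).det) (∑ i, (∏ j ∈ Finset.univ.erase i, d j) * M' i i) t₀ := by
  simp_rw [Matrix.det_apply]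
  have h1 : ∀ σ : Equiv.Perm ι, HasDerivAt (fun t => Equiv.Perm.sign σ • ∏ i, M t (σ i) i)
      (Equiv.Perm.sign σ • ∑ i, (∏ j ∈ Finset.univ.erase i, M t₀ (σ j) j) • M' (σ i) i) t₀ := by
    intro σ
    have := HasDerivAt.fun_finsetProd (u := Finset.univ) fun i _ => h (σ i) i
    simpa only [Units.smul_def, zsmul_eq_mul] using this.const_mul _
  have h2 := HasDerivAt.fun_sum (u := Finset.univ) fun σ _ => h1 σ
  convert! h2 using 1
  rw [Finset.sum_eq_single (1 : Equiv.Perm ι)]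
  · simp [h0]
  · intro σ _ hσ
    rw [Finset.sum_eq_zero, smul_zero]
    intro i _
    -- A nontrivial permutation moves at least two indices. Besides the differentiated factor, the
    -- product therefore contains an off-diagonal entry, which vanishes at `t₀`.
    obtain ⟨j, hji, hj⟩ : ∃ j, j ≠ i ∧ σ j ≠ j := by
      by_contra! hcon
      refine hσ (Equiv.ext fun j => ?_)
      by_cases hji : j = i
      · subst hji
        by_contra h3
        have h3 : σ j ≠ j := h3
        exact h3 (σ.injective (hcon _ h3))
      · exact hcon j hji
    rw [Finset.prod_eq_zero (Finset.mem_erase.2 ⟨hji, Finset.mem_univ j⟩), zero_smul]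
    rw [h0, Matrix.diagonal_apply_ne _ hj]
  · simp

/-- The derivative of the elementary symmetric functions of a matrix at a diagonal one. -/
theorem hasDerivAt_es_of_diagonal {ι : Type*} [Fintype ι] [DecidableEq ι]
    {M : ℝ → Matrix ι ι ℝ} {M' : Matrix ι ι ℝ} {k : ι → ℝ} {t₀ : ℝ}
    (h0 : M t₀ = Matrix.diagonal k) (h : ∀ i j, HasDerivAt (fun t => M t i j) (M' i j) t₀)
    {κ : ℝ → ι → ℝ} (hκ : ∀ᶠ t in nhds t₀, ∀ s : ℝ, (1 + s • M t).det = ∏ i, (1 + s * κ t i))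
    (r : ℕ) :
    HasDerivAt (fun t => es (κ t) Finset.univ (r + 1))
      (∑ i, es k (Finset.univ.erase i) r * M' i i) t₀ := by
  have hq : ∑ i, es k (Finset.univ.erase i) r * M' i i =
      (∑ i, C (M' i i) * (X * esPoly k (Finset.univ.erase i))).coeff (r + 1) := by
    rw [finsetSum_coeff]
    simp_rw [coeff_C_mul, coeff_X_mul, es, mul_comm]
  rw [hq]
  refine hasDerivAt_coeff (n := Fintype.card ι) (fun t => natDegree_esPoly_le _ _) ?_ ?_ (r + 1)
  · refine natDegree_sum_le_of_forall_le _ _ fun i _ => (natDegree_C_mul_le _ _).trans ?_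
    refine natDegree_mul_le.trans ?_
    have h1 := natDegree_esPoly_le k (Finset.univ.erase i)
    rw [Finset.card_erase_of_mem (Finset.mem_univ i), Finset.card_univ] at h1
    have h2 : 0 < Fintype.card ι := Fintype.card_pos_iff.2 ⟨i⟩
    rw [natDegree_X]
    lia
  · intro s
    refine HasDerivAt.congr_of_eventuallyEq (f := fun t => (1 + s • M t).det) ?_
      (hκ.mono fun t ht => (eval_esPoly _ _ _).trans (ht s).symm)
    have := hasDerivAt_det_of_diagonal (M := fun t => 1 + s • M t) (M' := s • M') (t₀ := t₀)
      (d := fun i => 1 + s * k i) (by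
        rw [h0]
        ext i j
        by_cases hij : i = j
        · subst hij; simp
        · simp [hij]) (fun i j => by
        simpa using ((h i j).const_mul s).const_add ((1 : Matrix ι ι ℝ) i j))
    convert! this using 1
    rw [eval_finsetSum]
    refine Finset.sum_congr rfl fun i _ => ?_
    simp only [eval_mul, eval_C, eval_X, eval_esPoly, Matrix.smul_apply, smul_eq_mul]
    ring

end DetDerivative

/-! ### Tangential projection at a point of a hypersurface. -/

section PseudoInverse

variable {n : ℕ} {D B : Euc n →L[ℝ] Euc (n + 1)} {ν : Euc (n + 1)}

/-- The Moore–Penrose inverse `(D* D)⁻¹ D*` of an injective linear map. -/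
def pinv (D : Euc n →L[ℝ] Euc (n + 1)) : Euc (n + 1) →L[ℝ] Euc n :=
  (D.adjoint ∘L D).inverse ∘L D.adjoint

theorem exists_equiv_adjoint_comp_self (hD : Function.Injective D) :
    ∃ e : Euc n ≃L[ℝ] Euc n, (e : Euc n →L[ℝ] Euc n) = D.adjoint ∘L D := by
  have hinj : Function.Injective (D.adjoint ∘L D) := by
    rw [injective_iff_map_eq_zero]
    intro u hu
    have h1 : inner ℝ ((D.adjoint ∘L D) u) u = 0 := by rw [hu, inner_zero_left]
    rw [ContinuousLinearMap.comp_apply, ContinuousLinearMap.adjoint_inner_left,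
      inner_self_eq_zero] at h1
    exact hD (by rw [h1, map_zero])
  exact ⟨(LinearEquiv.ofInjectiveEndo (D.adjoint ∘L D).toLinearMap hinj).toContinuousLinearEquiv,
    by ext1 u; rfl⟩

theorem pinv_eq (hD : Function.Injective D) {z : Euc (n + 1)} {w : Euc n}
    (h : ∀ v, inner ℝ (D v) (z - D w) = 0) : pinv D z = w := by
  obtain ⟨e, he⟩ := exists_equiv_adjoint_comp_self hD
  have h1 : D.adjoint (z - D w) = 0 := by
    rw [← inner_self_eq_zero (𝕜 := ℝ), ContinuousLinearMap.adjoint_inner_left, real_inner_comm, h]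
  rw [map_sub, sub_eq_zero] at h1
  rw [pinv, ← he, ContinuousLinearMap.inverse_equiv, ContinuousLinearMap.comp_apply, h1]
  have h2 : D.adjoint (D w) = e w := (congrArg (fun f : Euc n →L[ℝ] Euc n => f w) he).symm
  rw [h2]
  exact e.symm_apply_apply w

theorem inner_sub_pinv (hD : Function.Injective D) (z : Euc (n + 1)) (v : Euc n) :
    inner ℝ (D v) (z - D (pinv D z)) = 0 := by
  obtain ⟨e, he⟩ := exists_equiv_adjoint_comp_self hD
  rw [← ContinuousLinearMap.adjoint_inner_right, map_sub]
  have h2 : ∀ w, D.adjoint (D w) = e w := fun w =>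
    (congrArg (fun f : Euc n →L[ℝ] Euc n => f w) he).symm
  rw [h2, pinv, ← he, ContinuousLinearMap.inverse_equiv, ContinuousLinearMap.comp_apply]
  simp

theorem pinv_self (hD : Function.Injective D) (w : Euc n) : pinv D (D w) = w :=
  pinv_eq hD (by simp)

theorem pinv_eq_zero (hD : Function.Injective D) (h : ∀ v, inner ℝ (D v) ν = 0) : pinv D ν = 0 :=
  pinv_eq hD (by simpa using h)

theorem pinv_comp_equiv (hD : Function.Injective D) (T : Euc n ≃L[ℝ] Euc n) (z : Euc (n + 1)) :
    pinv (D ∘L (T : Euc n →L[ℝ] Euc n)) z = T.symm (pinv D z) := by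
  refine pinv_eq (fun a b hab => T.injective (hD hab)) fun v => ?_
  simpa using inner_sub_pinv hD z (T v)

/-- A vector orthogonal to a hyperplane and to its unit normal vanishes. -/
theorem eq_zero_of_inner_eq_zero (hD : Function.Injective D) (hν : ‖ν‖ = 1)
    (ho : ∀ v, inner ℝ (D v) ν = 0) {z : Euc (n + 1)} (h1 : inner ℝ ν z = 0)
    (h2 : ∀ v, inner ℝ (D v) z = 0) : z = 0 := by
  set R := D.toLinearMap.range with hR
  have hfin : Module.finrank ℝ R = n := by
    rw [hR, LinearMap.finrank_range_of_inj hD]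
    simp
  have hfin' : Module.finrank ℝ Rᗮ = 1 := by
    have := R.finrank_add_finrank_orthogonal
    simp only [hfin, finrank_euclideanSpace, Fintype.card_fin] at this
    exact Nat.add_left_cancel this
  have hνR : ν ∈ Rᗮ := by
    rw [Submodule.mem_orthogonal]
    rintro _ ⟨v, rfl⟩
    exact ho v
  have hzR : z ∈ Rᗮ := by
    rw [Submodule.mem_orthogonal]
    rintro _ ⟨v, rfl⟩
    exact h2 v
  have hν0 : (⟨ν, hνR⟩ : Rᗮ) ≠ 0 := by
    intro h
    have : ν = 0 := congrArg Subtype.val h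
    simp [this] at hν
  obtain ⟨c, hc⟩ := exists_smul_eq_of_finrank_eq_one hfin' hν0 ⟨z, hzR⟩
  have hc : c • ν = z := congrArg Subtype.val hc
  rw [← hc, real_inner_smul_right, real_inner_self_eq_norm_sq, hν] at h1
  rw [← hc, show c = 0 by linarith, zero_smul]

theorem apply_pinv (hD : Function.Injective D) (hν : ‖ν‖ = 1)
    (ho : ∀ v, inner ℝ (D v) ν = 0) (z : Euc (n + 1)) :
    D (pinv D z) = z - inner ℝ ν z • ν := by
  refine (sub_eq_zero.1 (eq_zero_of_inner_eq_zero hD hν ho (z := z - inner ℝ ν z • ν - _)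
    ?_ fun v => ?_)).symm
  · rw [inner_sub_right, inner_sub_right, real_inner_comm (D _) ν, ho, real_inner_smul_right,
      real_inner_self_eq_norm_sq, hν]
    ring
  · rw [sub_right_comm, inner_sub_right, inner_sub_pinv hD, real_inner_smul_right, ho]
    ring

end PseudoInverse

/-! ### Symmetry and diagonalization of the shape operator. -/

section Frames

variable {n : ℕ} {D B : Euc n →L[ℝ] Euc (n + 1)} {ν : Euc (n + 1)}

/-- The linear algebra of a hypersurface at a point: `D` is the differential of the position vector,
`ν` a unit normal and `B` the differential of the normal field. -/
structure IsGaussPair (D B : Euc n →L[ℝ] Euc (n + 1)) (ν : Euc (n + 1)) : Prop where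
  injective : Function.Injective D
  norm_eq_one : ‖ν‖ = 1
  orthogonal : ∀ v, inner ℝ (D v) ν = 0
  orthogonal' : ∀ v, inner ℝ (B v) ν = 0
  symm : ∀ v w, inner ℝ (B v) (D w) = inner ℝ (B w) (D v)

/-- The shape operator attached to a pair of differentials. -/
def shapeMap (D B : Euc n →L[ℝ] Euc (n + 1)) : Euc n →L[ℝ] Euc n := -(pinv D ∘L B)

theorem shapeMap_comp_equiv (hD : Function.Injective D) (T : Euc n ≃L[ℝ] Euc n) (v : Euc n) :
    shapeMap (D ∘L (T : Euc n →L[ℝ] Euc n)) (B ∘L (T : Euc n →L[ℝ] Euc n)) v =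
      T.symm (shapeMap D B (T v)) := by
  simp [shapeMap, pinv_comp_equiv hD]

namespace IsGaussPair

variable (h : IsGaussPair D B ν)
include h

theorem apply_shapeMap (v : Euc n) : D (shapeMap D B v) = -B v := by
  rw [shapeMap, neg_apply, map_neg, ContinuousLinearMap.comp_apply,
    apply_pinv h.injective h.norm_eq_one h.orthogonal, real_inner_comm, h.orthogonal' v, zero_smul,
    sub_zero]

theorem inner_shapeMap (v w : Euc n) :
    inner ℝ (D (shapeMap D B v)) (D w) = inner ℝ (D v) (D (shapeMap D B w)) := by
  rw [h.apply_shapeMap, h.apply_shapeMap, inner_neg_left, inner_neg_right, h.symm,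
    real_inner_comm]

/-- The inner product of the model space is not the induced metric. The shape operator is therefore
transported to the tangent hyperplane `range D`, where it is symmetric for the ambient inner product
and the spectral theorem applies. -/
theorem exists_frame : ∃ (e : Module.Basis (Fin n) ℝ (Euc n)) (k : Fin n → ℝ),
    Orthonormal ℝ (fun i => D (e i)) ∧ ∀ i, shapeMap D B (e i) = k i • e i := by
  set R := D.toLinearMap.range
  let L : Euc n ≃ₗ[ℝ] R := LinearEquiv.ofInjective D.toLinearMap h.injective
  have hL : ∀ v, ((L v : R) : Euc (n + 1)) = D v := fun v => rfl
  have hfin : Module.finrank ℝ R = n := by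
    rw [← L.finrank_eq]; simp
  let T : R →ₗ[ℝ] R := L.toLinearMap ∘ₗ (shapeMap D B).toLinearMap ∘ₗ L.symm.toLinearMap
  have hT : T.IsSymmetric := by
    intro x y
    obtain ⟨v, rfl⟩ := L.surjective x
    obtain ⟨w, rfl⟩ := L.surjective y
    simpa [T, hL] using h.inner_shapeMap v w
  let b := hT.eigenvectorBasis hfin
  refine ⟨b.toBasis.map L.symm, hT.eigenvalues hfin, ?_, fun i => ?_⟩
  · have h1 : (fun i => D ((b.toBasis.map L.symm) i)) = fun i => ((b i : R) : Euc (n + 1)) := by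
      funext i
      rw [← hL]
      simp
    rw [h1]
    exact b.orthonormal.comp_linearIsometry R.subtypeₗᵢ
  · have h2 := hT.apply_eigenvectorBasis hfin i
    have h3 : shapeMap D B (L.symm (b i)) = L.symm (T (b i)) := by simp [T]
    have h4 : (b.toBasis.map L.symm) i = L.symm (b i) := by simp
    rw [h4, h3, h2, map_smul]
    rfl

end IsGaussPair

end Frames

/-! ### Curvature quantities in a frame of principal directions. -/

section EigenFrame

variable {n : ℕ} {M : Type*} [TopologicalSpace M] [ChartedSpace (Euc n) M]

/-- `e` is a `g`-orthonormal frame of principal directions at `p`, with principal curvatures `k`. -/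
structure IsPrincipalFrame (X N : M → Euc (n + 1)) (p : M) (e : Module.Basis (Fin n) ℝ (Euc n))
    (k : Fin n → ℝ) : Prop where
  orthonormal : Orthonormal ℝ (fun i => differential X p (e i))
  shape : ∀ i, shapeOperator X N p (e i) = k i • e i

theorem shapeOperator_eq_shapeMap (X N : M → Euc (n + 1)) (p : M) :
    shapeOperator X N p = (shapeMap (differential X p) (differential N p)).toLinearMap := rfl

theorem exists_isPrincipalFrame {X N : M → Euc (n + 1)} {p : M}
    (h : IsGaussPair (differential X p) (differential N p) (N p)) :
    ∃ e k, IsPrincipalFrame X N p e k := by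
  obtain ⟨e, k, h1, h2⟩ := h.exists_frame
  exact ⟨e, k, h1, h2⟩

namespace IsPrincipalFrame

variable {X N : M → Euc (n + 1)} {p : M} {e : Module.Basis (Fin n) ℝ (Euc n)} {k : Fin n → ℝ}
  (h : IsPrincipalFrame X N p e k)
include h

theorem toMatrix_shape :
    LinearMap.toMatrix e e (shapeOperator X N p) = Matrix.diagonal k := by
  ext i j
  rw [LinearMap.toMatrix_apply, h.shape, map_smul, Module.Basis.repr_self, Finsupp.smul_apply,
    Finsupp.single_apply, Matrix.diagonal_apply]
  by_cases hij : i = j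
  · subst hij; simp
  · simp [hij, Ne.symm hij]

theorem sigma_eq (j : ℕ) : sigma X N j p = es k Finset.univ j := by
  have h1 : principalCurvatures X N p = Finset.univ.val.map k := by
    rw [principalCurvatures, ← LinearMap.charpoly_toMatrix _ e, h.toMatrix_shape,
      Matrix.charpoly_diagonal, Polynomial.roots_prod _ _
        (Finset.prod_ne_zero_iff.2 fun i _ => Polynomial.X_sub_C_ne_zero _)]
    simp [Polynomial.roots_X_sub_C, Multiset.bind_singleton]
  rw [sigma, h1, esymm_eq_es]

theorem det_one_add (s : ℝ) : LinearMap.det (1 + s • shapeOperator X N p) = ∏ i, (1 + s * k i) := by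
  rw [← LinearMap.det_toMatrix e, map_add, map_smul, h.toMatrix_shape, LinearMap.toMatrix_one,
    ← Matrix.diagonal_one, ← Matrix.diagonal_smul, Matrix.diagonal_add, Matrix.det_diagonal]
  simp

theorem pow_shape (i : Fin n) (j : ℕ) : (shapeOperator X N p ^ j) (e i) = k i ^ j • e i := by
  induction j with
  | zero => simp
  | succ j ih => rw [pow_succ, Module.End.mul_apply, h.shape, map_smul, ih, smul_smul, pow_succ,
      mul_comm]

theorem newton_apply (j : ℕ) (i : Fin n) :
    newton X N j p (e i) = es k (Finset.univ.erase i) j • e i := by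
  rw [newton, LinearMap.sum_apply, ← sum_neg_one_pow_mul_es k (Finset.mem_univ i),
    Finset.sum_smul]
  refine Finset.sum_congr rfl fun l _ => ?_
  rw [LinearMap.smul_apply, h.pow_shape, h.sigma_eq, smul_smul]

theorem modifiedNormSq_eq (j : ℕ) :
    modifiedNormSq X N j p = ∑ i, es k (Finset.univ.erase i) j * k i ^ 2 := by
  rw [modifiedNormSq, LinearMap.trace_eq_matrix_trace ℝ e, Matrix.trace]
  refine Finset.sum_congr rfl fun i _ => ?_
  rw [Matrix.diag_apply, LinearMap.toMatrix_apply, Module.End.mul_apply, h.pow_shape, map_smul,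
    h.newton_apply, smul_smul, map_smul, Module.Basis.repr_self]
  simp [mul_comm]

theorem firstForm_newton (j : ℕ) (i : Fin n) :
    firstForm X p (newton X N j p (e i)) (e i) = es k (Finset.univ.erase i) j := by
  rw [firstForm, h.newton_apply, map_smul, real_inner_smul_left, real_inner_self_eq_norm_sq,
    h.orthonormal.1 i]
  simp

theorem es_nonneg {j : ℕ} (hP : ∀ v, 0 ≤ firstForm X p (newton X N j p v) v) (i : Fin n) :
    0 ≤ es k (Finset.univ.erase i) j := by
  rw [← h.firstForm_newton]
  exact hP _

theorem es_pos {j : ℕ} (hP : ∀ v, v ≠ 0 → 0 < firstForm X p (newton X N j p v) v) (i : Fin n) :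
    0 < es k (Finset.univ.erase i) j := by
  rw [← h.firstForm_newton]
  exact hP _ (e.ne_zero i)

theorem es_le {j : ℕ} {C : ℝ} (hP : ∀ v, √(firstForm X p (newton X N j p v) (newton X N j p v)) ≤
    C * √(firstForm X p v v)) (i : Fin n) : es k (Finset.univ.erase i) j ≤ C := by
  have h1 := hP (e i)
  rw [h.newton_apply] at h1
  simp only [firstForm, map_smul, real_inner_self_eq_norm_sq, norm_smul, h.orthonormal.1 i,
    mul_one, one_pow, Real.sqrt_one, Real.norm_eq_abs, sq_abs, Real.sqrt_sq_eq_abs] at h1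
  exact (le_abs_self _).trans h1

end IsPrincipalFrame

end EigenFrame

/-! ### Derivatives along lines and smoothness of the basic constructions. -/

section LineDerivatives

open Topology

variable {E F : Type*} [NormedAddCommGroup E] [NormedSpace ℝ E] [NormedAddCommGroup F]
  [NormedSpace ℝ F]

theorem hasDerivAt_line {f : E → F} {f' : E →L[ℝ] F} {y : E} (hf : HasFDerivAt f f' y) (v : E) :
    HasDerivAt (fun t : ℝ => f (y + t • v)) (f' v) 0 := by
  have h1 : HasDerivAt (fun t : ℝ => y + t • v) v 0 := by
    simpa using ((hasDerivAt_id (0 : ℝ)).smul_const v).const_add y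
  have h2 : HasFDerivAt f f' (y + (0 : ℝ) • v) := by simpa using hf
  exact h2.comp_hasDerivAt (0 : ℝ) h1

theorem eventually_line_mem {U : Set E} (hU : IsOpen U) {y : E} (hy : y ∈ U) (v : E) :
    ∀ᶠ t : ℝ in 𝓝 0, y + t • v ∈ U := by
  have h1 : ContinuousAt (fun t : ℝ => y + t • v) 0 := by fun_prop
  exact h1.eventually_mem (hU.mem_nhds (by simpa using hy))

/-- The device by which an identity valid on an open set is differentiated: both sides have the same
derivative in the direction `v`. -/
theorem eq_of_eqOn_of_hasDerivAt_line {U : Set E} (hU : IsOpen U) {y : E} (hy : y ∈ U) {v : E}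
    {f g : E → F} (hfg : Set.EqOn f g U) {a b : F}
    (hf : HasDerivAt (fun t : ℝ => f (y + t • v)) a 0)
    (hg : HasDerivAt (fun t : ℝ => g (y + t • v)) b 0) : a = b := by
  refine (hf.congr_of_eventuallyEq ?_).unique hg
  filter_upwards [eventually_line_mem hU hy v] with t ht
  exact (hfg ht).symm

end LineDerivatives

/-- A parametrized hypersurface with a smooth unit normal field. -/
structure IsPatch {n : ℕ} (U : Set (Euc n)) (x ν : Euc n → Euc (n + 1)) : Prop where
  isOpen : IsOpen U
  smooth : ContDiffOn ℝ ∞ x U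
  smooth_normal : ContDiffOn ℝ ∞ ν U
  injective : ∀ y ∈ U, Function.Injective (fderiv ℝ x y)
  norm_eq_one : ∀ y ∈ U, ‖ν y‖ = 1
  orthogonal : ∀ y ∈ U, ∀ v, inner ℝ (fderiv ℝ x y v) (ν y) = 0

theorem differential_eq_fderiv {n : ℕ} (x : Euc n → Euc (n + 1)) (y : Euc n) :
    differential x y = fderiv ℝ x y := mfderiv_eq_fderiv

section SmoothAux

open Topology

variable {E F : Type*} [NormedAddCommGroup E] [NormedSpace ℝ E] [NormedAddCommGroup F]
  [NormedSpace ℝ F]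

theorem contDiffAt_fderiv {U : Set E} {f : E → F} (hU : IsOpen U) (hf : ContDiffOn ℝ ∞ f U) {y : E}
    (hy : y ∈ U) : ContDiffAt ℝ ∞ (fderiv ℝ f) y :=
  (hf.contDiffAt (hU.mem_nhds hy)).fderiv_right (by simp)

theorem hasFDerivAt_of_contDiffOn {U : Set E} {f : E → F} (hU : IsOpen U) (hf : ContDiffOn ℝ ∞ f U)
    {y : E} (hy : y ∈ U) : HasFDerivAt f (fderiv ℝ f y) y :=
  ((hf.contDiffAt (hU.mem_nhds hy)).differentiableAt (by simp)).hasFDerivAt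

theorem hasFDerivAt_fderiv {U : Set E} {f : E → F} (hU : IsOpen U) (hf : ContDiffOn ℝ ∞ f U)
    {y : E} (hy : y ∈ U) : HasFDerivAt (fderiv ℝ f) (fderiv ℝ (fderiv ℝ f) y) y :=
  ((contDiffAt_fderiv hU hf hy).differentiableAt (by simp)).hasFDerivAt

theorem fderiv_fderiv_symm {U : Set E} {f : E → F} (hU : IsOpen U) (hf : ContDiffOn ℝ ∞ f U)
    {y : E} (hy : y ∈ U) (v w : E) :
    fderiv ℝ (fderiv ℝ f) y v w = fderiv ℝ (fderiv ℝ f) y w v :=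
  (hf.contDiffAt (hU.mem_nhds hy)).isSymmSndFDerivAt (by
    rw [minSmoothness_of_isRCLikeNormedField]
    exact WithTop.coe_le_coe.2 (le_top : (2 : ℕ∞) ≤ ⊤)) v w

theorem hasDerivAt_line_fderiv {U : Set E} {f : E → F} (hU : IsOpen U) (hf : ContDiffOn ℝ ∞ f U)
    {y : E} (hy : y ∈ U) (v w : E) :
    HasDerivAt (fun t : ℝ => fderiv ℝ f (y + t • v) w) (fderiv ℝ (fderiv ℝ f) y v w) 0 := by
  have h1 := hasDerivAt_line (hasFDerivAt_fderiv hU hf hy) v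
  simpa using h1.clm_apply (hasDerivAt_const (0 : ℝ) w)

theorem contDiff_adjoint {n m : ℕ} :
    ContDiff ℝ ∞ (fun D : Euc n →L[ℝ] Euc m => D.adjoint) := by
  let L : (Euc n →L[ℝ] Euc m) →ₗ[ℝ] (Euc m →L[ℝ] Euc n) :=
    { toFun := fun D => D.adjoint
      map_add' := fun a b => map_add _ a b
      map_smul' := fun c a => by simp }
  exact L.toContinuousLinearMap.contDiff

theorem contDiffAt_pinv {n : ℕ} {D : Euc n →L[ℝ] Euc (n + 1)} (hD : Function.Injective D) :
    ContDiffAt ℝ ∞ (pinv (n := n)) D := by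
  obtain ⟨e, he⟩ := exists_equiv_adjoint_comp_self hD
  have h1 : ContDiffAt ℝ ∞ (fun D : Euc n →L[ℝ] Euc (n + 1) => D.adjoint) D :=
    contDiff_adjoint.contDiffAt
  have h2 : ContDiffAt ℝ ∞ (fun D : Euc n →L[ℝ] Euc (n + 1) => D.adjoint ∘L D) D :=
    h1.clm_comp contDiffAt_id
  have h3 : ContDiffAt ℝ ∞
      (fun D : Euc n →L[ℝ] Euc (n + 1) => (D.adjoint ∘L D).inverse) D := by
    refine ContDiffAt.comp D (g := ContinuousLinearMap.inverse) ?_ h2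
    rw [← he]
    exact contDiffAt_map_inverse e
  exact h3.clm_comp h1

end SmoothAux

/-! ### Structure equations of a parametrized hypersurface and the derivative of `σ_r`. -/

namespace IsPatch

variable {n : ℕ} {U : Set (Euc n)} {x ν : Euc n → Euc (n + 1)} (h : IsPatch U x ν)
include h

theorem hasDerivAt_x {y : Euc n} (hy : y ∈ U) (v : Euc n) :
    HasDerivAt (fun t : ℝ => x (y + t • v)) (fderiv ℝ x y v) 0 :=
  hasDerivAt_line (hasFDerivAt_of_contDiffOn h.isOpen h.smooth hy) v

theorem hasDerivAt_normal {y : Euc n} (hy : y ∈ U) (v : Euc n) :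
    HasDerivAt (fun t : ℝ => ν (y + t • v)) (fderiv ℝ ν y v) 0 :=
  hasDerivAt_line (hasFDerivAt_of_contDiffOn h.isOpen h.smooth_normal hy) v

theorem inner_fderiv_normal {y : Euc n} (hy : y ∈ U) (v : Euc n) :
    inner ℝ (fderiv ℝ ν y v) (ν y) = 0 := by
  have h1 := (h.hasDerivAt_normal hy v).inner ℝ (h.hasDerivAt_normal hy v)
  have h2 := eq_of_eqOn_of_hasDerivAt_line h.isOpen hy (v := v)
    (f := fun y => inner ℝ (ν y) (ν y)) (g := fun _ => (1 : ℝ))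
    (fun z hz => by simp [h.norm_eq_one z hz]) h1 (hasDerivAt_const _ _)
  simp only [zero_smul, add_zero] at h2
  rw [real_inner_comm] at h2
  linarith

theorem inner_sndDeriv {y : Euc n} (hy : y ∈ U) (v w : Euc n) :
    inner ℝ (fderiv ℝ (fderiv ℝ x) y v w) (ν y) =
      -inner ℝ (fderiv ℝ x y w) (fderiv ℝ ν y v) := by
  have h1 := (hasDerivAt_line_fderiv h.isOpen h.smooth hy v w).inner ℝ (h.hasDerivAt_normal hy v)
  have h2 := eq_of_eqOn_of_hasDerivAt_line h.isOpen hy (v := v)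
    (f := fun y => inner ℝ (fderiv ℝ x y w) (ν y)) (g := fun _ => (0 : ℝ))
    (fun z hz => h.orthogonal z hz w) h1 (hasDerivAt_const _ _)
  simp only [zero_smul, add_zero] at h2
  linarith

theorem isGaussPair {y : Euc n} (hy : y ∈ U) :
    IsGaussPair (fderiv ℝ x y) (fderiv ℝ ν y) (ν y) where
  injective := h.injective y hy
  norm_eq_one := h.norm_eq_one y hy
  orthogonal := h.orthogonal y hy
  orthogonal' := h.inner_fderiv_normal hy
  -- Both sides are the second derivative of `x` paired with the normal, up to sign, and second
  -- derivatives commute.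
  symm v w := by
    have h1 := h.inner_sndDeriv hy v w
    have h2 := h.inner_sndDeriv hy w v
    rw [fderiv_fderiv_symm h.isOpen h.smooth hy] at h1
    rw [real_inner_comm, real_inner_comm _ (fderiv ℝ ν y w)]
    linarith

theorem exists_frame {y : Euc n} (hy : y ∈ U) : ∃ e k, IsPrincipalFrame x ν y e k :=
  exists_isPrincipalFrame (by simpa only [differential_eq_fderiv] using h.isGaussPair hy)

theorem contDiffAt_pinv_fderiv {y : Euc n} (hy : y ∈ U) :
    ContDiffAt ℝ ∞ (fun z => pinv (fderiv ℝ x z)) y :=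
  ContDiffAt.comp y (contDiffAt_pinv (h.injective y hy)) (contDiffAt_fderiv h.isOpen h.smooth hy)

theorem contDiffAt_shapeMap {y : Euc n} (hy : y ∈ U) :
    ContDiffAt ℝ ∞ (fun z => shapeMap (fderiv ℝ x z) (fderiv ℝ ν z)) y :=
  ((h.contDiffAt_pinv_fderiv hy).clm_comp (contDiffAt_fderiv h.isOpen h.smooth_normal hy)).neg

/-- The derivative of `σ_{r+1}` is `tr (P_r ∇A)`. -/
theorem hasDerivAt_sigma {y : Euc n} (hy : y ∈ U) {e : Module.Basis (Fin n) ℝ (Euc n)}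
    {k : Fin n → ℝ} (hf : IsPrincipalFrame x ν y e k) (v : Euc n) (r : ℕ) :
    HasDerivAt (fun t : ℝ => sigma x ν (r + 1) (y + t • v))
      (∑ i, es k (Finset.univ.erase i) r *
        (-inner ℝ (fderiv ℝ (fderiv ℝ ν) y v (e i)) (fderiv ℝ x y (e i)) -
          k i * inner ℝ (fderiv ℝ (fderiv ℝ x) y v (e i)) (fderiv ℝ x y (e i)))) 0 := by
  classical
  set A : Euc n → (Euc n →L[ℝ] Euc n) := fun z => shapeMap (fderiv ℝ x z) (fderiv ℝ ν z) with hA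
  have hAs : ∀ z, shapeOperator x ν z = (A z).toLinearMap := fun z => by
    simp only [hA, shapeOperator_eq_shapeMap, differential_eq_fderiv]
  have hAd : ∀ w, HasDerivAt (fun t : ℝ => A (y + t • v) w) (fderiv ℝ A y v w) 0 := fun w => by
    have h1 := hasDerivAt_line (((h.contDiffAt_shapeMap hy).differentiableAt
      (by simp)).hasFDerivAt) v
    simpa using h1.clm_apply (hasDerivAt_const (0 : ℝ) w)
  -- The curvatures are chosen independently at each point. No regularity of the choice is needed,
  -- since only `det (1 + s A)` is differentiated.
  have hchoice : ∀ z, ∃ κ : Fin n → ℝ, z ∈ U → ∃ e', IsPrincipalFrame x ν z e' κ := fun z => by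
    by_cases hz : z ∈ U
    · obtain ⟨e', κ, h'⟩ := h.exists_frame hz
      exact ⟨κ, fun _ => ⟨e', h'⟩⟩
    · exact ⟨0, fun hz' => (hz hz').elim⟩
  choose κ hκ using hchoice
  have hAe : ∀ i, A y (e i) = k i • e i := fun i => by
    have := hf.shape i
    rwa [hAs] at this
  have hcoord : ∀ (w : Euc n) i, e.repr w i = inner ℝ (fderiv ℝ x y w) (fderiv ℝ x y (e i)) := by
    intro w i
    have h1 := congrArg (fderiv ℝ x y) (e.sum_repr w)
    rw [← h1, map_sum, sum_inner]
    have horth := hf.orthonormal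
    rw [orthonormal_iff_ite] at horth
    simp only [differential_eq_fderiv] at horth
    simp_rw [map_smul, real_inner_smul_left, horth]
    simp
  have hmain := hasDerivAt_es_of_diagonal (t₀ := 0)
    (M := fun t : ℝ => LinearMap.toMatrix e e (A (y + t • v)).toLinearMap)
    (M' := LinearMap.toMatrix e e (fderiv ℝ A y v).toLinearMap) (k := k)
    (κ := fun t => κ (y + t • v)) (by
      simp only [zero_smul, add_zero]
      rw [← hAs, hf.toMatrix_shape]) (fun i j => by
      simp only [LinearMap.toMatrix_apply]
      exact (LinearMap.toContinuousLinearMap (e.coord i)).hasFDerivAt.comp_hasDerivAt 0 (hAd (e j)))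
    (by
      filter_upwards [eventually_line_mem h.isOpen hy v] with t ht s
      obtain ⟨e', he'⟩ := hκ _ ht
      have := he'.det_one_add s
      rw [← LinearMap.det_toMatrix e, map_add, map_smul, LinearMap.toMatrix_one, hAs] at this
      exact this) r
  refine (hmain.congr_of_eventuallyEq ?_).congr_deriv ?_
  · filter_upwards [eventually_line_mem h.isOpen hy v] with t ht
    obtain ⟨e', he'⟩ := hκ _ ht
    exact he'.sigma_eq _
  · refine Finset.sum_congr rfl fun i _ => ?_
    rw [LinearMap.toMatrix_apply, hcoord]
    -- Differentiating the Weingarten formula `dx (A e_i) = -dν e_i` gives the derivative of `A` in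
    -- terms of second derivatives of `x` and `ν`.
    have h1 := eq_of_eqOn_of_hasDerivAt_line h.isOpen hy (v := v)
      (f := fun z => fderiv ℝ x z (A z (e i))) (g := fun z => -fderiv ℝ ν z (e i))
      (fun z hz => (h.isGaussPair hz).apply_shapeMap (e i))
      ((hasDerivAt_line (hasFDerivAt_fderiv h.isOpen h.smooth hy) v).clm_apply (hAd (e i)))
      (hasDerivAt_line_fderiv h.isOpen h.smooth_normal hy v (e i)).neg
    simp only [zero_smul, add_zero, hAe, map_smul] at h1
    have h2 : fderiv ℝ x y ((fderiv ℝ A y v) (e i)) = -fderiv ℝ (fderiv ℝ ν) y v (e i) -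
        k i • fderiv ℝ (fderiv ℝ x) y v (e i) := by
      rw [← h1]; abel
    have h3 : fderiv ℝ x y ((fderiv ℝ A y v).toLinearMap (e i)) = -fderiv ℝ (fderiv ℝ ν) y v (e i) -
        k i • fderiv ℝ (fderiv ℝ x) y v (e i) := h2
    rw [h3, inner_sub_left, inner_neg_left, real_inner_smul_left]

end IsPatch

/-- The first order coefficients of the operator `tr (P Hess ·) - ⟨X, ∇ ·⟩` in a parametrization,
where `P` has eigenvalues `μ` in the frame `e`. -/
def drift {n : ℕ} (x : Euc n → Euc (n + 1)) (y : Euc n) (e : Module.Basis (Fin n) ℝ (Euc n))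
    (μ : Fin n → ℝ) : Euc n :=
  ∑ i, μ i • pinv (fderiv ℝ x y) (fderiv ℝ (fderiv ℝ x) y (e i) (e i)) + pinv (fderiv ℝ x y) (x y)

theorem IsPrincipalFrame.orthonormal_fderiv {n : ℕ} {x ν : Euc n → Euc (n + 1)} {y : Euc n}
    {e : Module.Basis (Fin n) ℝ (Euc n)} {k : Fin n → ℝ} (hf : IsPrincipalFrame x ν y e k) :
    Orthonormal ℝ fun i => fderiv ℝ x y (e i) := by
  simpa only [differential_eq_fderiv] using hf.orthonormal

/-! ### The operator `L` applied to the squared distance and to the support function. -/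

namespace IsPatch

variable {n : ℕ} {U : Set (Euc n)} {x ν : Euc n → Euc (n + 1)} (h : IsPatch U x ν)
include h

theorem fderiv_normal_frame {y : Euc n} (hy : y ∈ U) {e : Module.Basis (Fin n) ℝ (Euc n)}
    {k : Fin n → ℝ} (hf : IsPrincipalFrame x ν y e k) (i : Fin n) :
    fderiv ℝ ν y (e i) = -(k i • fderiv ℝ x y (e i)) := by
  have h1 := (h.isGaussPair hy).apply_shapeMap (e i)
  have h2 := hf.shape i
  rw [shapeOperator_eq_shapeMap, differential_eq_fderiv, differential_eq_fderiv] at h2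
  have h3 : shapeMap (fderiv ℝ x y) (fderiv ℝ ν y) (e i) = k i • e i := h2
  rw [h3, map_smul] at h1
  rw [h1, neg_neg]

theorem contDiffOn_support : ContDiffOn ℝ ∞ (fun z => inner ℝ (x z) (ν z) : Euc n → ℝ) U :=
  h.smooth.inner ℝ h.smooth_normal

theorem contDiffOn_normSq : ContDiffOn ℝ ∞ (fun z => ‖x z‖ ^ 2 : Euc n → ℝ) U :=
  h.smooth.norm_sq ℝ

theorem fderiv_support {y : Euc n} (hy : y ∈ U) (v : Euc n) :
    fderiv ℝ (fun z => inner ℝ (x z) (ν z) : Euc n → ℝ) y v = inner ℝ (x y) (fderiv ℝ ν y v) := by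
  have h1 := (h.hasDerivAt_x hy v).inner ℝ (h.hasDerivAt_normal hy v)
  have h2 := hasDerivAt_line (hasFDerivAt_of_contDiffOn h.isOpen h.contDiffOn_support hy) v
  have h3 := h2.unique h1
  simpa [h.orthogonal y hy] using h3

theorem fderiv_fderiv_support {y : Euc n} (hy : y ∈ U) (v w : Euc n) :
    fderiv ℝ (fderiv ℝ (fun z => inner ℝ (x z) (ν z) : Euc n → ℝ)) y v w =
      inner ℝ (fderiv ℝ x y v) (fderiv ℝ ν y w) +
        inner ℝ (x y) (fderiv ℝ (fderiv ℝ ν) y v w) := by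
  have h1 := (h.hasDerivAt_x hy v).inner ℝ
    (hasDerivAt_line_fderiv h.isOpen h.smooth_normal hy v w)
  have h2 := eq_of_eqOn_of_hasDerivAt_line h.isOpen hy (v := v)
    (fun z hz => h.fderiv_support hz w)
    (hasDerivAt_line_fderiv h.isOpen h.contDiffOn_support hy v w) h1
  rw [h2]
  simp [add_comm]

theorem fderiv_normSq {y : Euc n} (hy : y ∈ U) (v : Euc n) :
    fderiv ℝ (fun z => ‖x z‖ ^ 2 : Euc n → ℝ) y v = 2 * inner ℝ (x y) (fderiv ℝ x y v) := by
  have h1 := (h.hasDerivAt_x hy v).norm_sq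
  have h2 := hasDerivAt_line (hasFDerivAt_of_contDiffOn h.isOpen h.contDiffOn_normSq hy) v
  have h3 := h2.unique h1
  simpa using h3

theorem fderiv_fderiv_normSq {y : Euc n} (hy : y ∈ U) (v w : Euc n) :
    fderiv ℝ (fderiv ℝ (fun z => ‖x z‖ ^ 2 : Euc n → ℝ)) y v w =
      2 * (inner ℝ (fderiv ℝ x y v) (fderiv ℝ x y w) +
        inner ℝ (x y) (fderiv ℝ (fderiv ℝ x) y v w)) := by
  have h1 := ((h.hasDerivAt_x hy v).inner ℝ
    (hasDerivAt_line_fderiv h.isOpen h.smooth hy v w)).const_mul 2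
  have h2 := eq_of_eqOn_of_hasDerivAt_line h.isOpen hy (v := v)
    (fun z hz => h.fderiv_normSq hz w)
    (hasDerivAt_line_fderiv h.isOpen h.contDiffOn_normSq hy v w) h1
  rw [h2]
  simp [add_comm]

theorem inner_fderiv_fderiv_normal {y : Euc n} (hy : y ∈ U) (v w : Euc n) :
    inner ℝ (ν y) (fderiv ℝ (fderiv ℝ ν) y v w) =
      -inner ℝ (fderiv ℝ ν y v) (fderiv ℝ ν y w) := by
  have h1 := (h.hasDerivAt_normal hy v).inner ℝ
    (hasDerivAt_line_fderiv h.isOpen h.smooth_normal hy v w)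
  have h2 := eq_of_eqOn_of_hasDerivAt_line h.isOpen hy (v := v)
    (f := fun y => inner ℝ (ν y) (fderiv ℝ ν y w)) (g := fun _ => (0 : ℝ))
    (fun z hz => (real_inner_comm _ _).trans (h.inner_fderiv_normal hz w)) h1
    (hasDerivAt_const _ _)
  simp only [zero_smul, add_zero] at h2
  linarith

/-- The Codazzi equation. -/
theorem codazzi {y : Euc n} (hy : y ∈ U) (a v w : Euc n) :
    inner ℝ (fderiv ℝ ν y v) (fderiv ℝ (fderiv ℝ x) y a w) +
        inner ℝ (fderiv ℝ (fderiv ℝ ν) y a v) (fderiv ℝ x y w) =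
      inner ℝ (fderiv ℝ ν y w) (fderiv ℝ (fderiv ℝ x) y a v) +
        inner ℝ (fderiv ℝ (fderiv ℝ ν) y a w) (fderiv ℝ x y v) := by
  have h1 := fun v w => (hasDerivAt_line_fderiv h.isOpen h.smooth_normal hy a v).inner ℝ
    (hasDerivAt_line_fderiv h.isOpen h.smooth hy a w)
  have h2 := eq_of_eqOn_of_hasDerivAt_line h.isOpen hy (v := a)
    (f := fun y => inner ℝ (fderiv ℝ ν y v) (fderiv ℝ x y w))
    (g := fun y => inner ℝ (fderiv ℝ ν y w) (fderiv ℝ x y v))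
    (fun z hz => (h.isGaussPair hz).symm v w) (h1 v w) (h1 w v)
  simpa using h2

/-- Gauss formula. The tangential part carries the Christoffel terms, which `drift` collects so that
coordinate second derivatives become covariant Hessians. -/
theorem inner_sndDeriv_frame {y : Euc n} (hy : y ∈ U) {e : Module.Basis (Fin n) ℝ (Euc n)}
    {k : Fin n → ℝ} (hf : IsPrincipalFrame x ν y e k) (i : Fin n) (z : Euc (n + 1)) :
    inner ℝ z (fderiv ℝ (fderiv ℝ x) y (e i) (e i)) =
      inner ℝ z (fderiv ℝ x y (pinv (fderiv ℝ x y) (fderiv ℝ (fderiv ℝ x) y (e i) (e i)))) +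
        k i * inner ℝ z (ν y) := by
  have hG := h.isGaussPair hy
  have h1 := h.inner_sndDeriv hy (e i) (e i)
  rw [h.fderiv_normal_frame hy hf, inner_neg_right, real_inner_smul_right,
    real_inner_self_eq_norm_sq, hf.orthonormal_fderiv.1 i, neg_neg] at h1
  rw [apply_pinv hG.injective hG.norm_eq_one hG.orthogonal, inner_sub_right, real_inner_smul_right,
    real_inner_comm _ (ν y), h1]
  ring

/-- The covariant Hessian of `‖x‖² / 2` is the metric plus `⟨x, ν⟩` times the second fundamental
form. Its `P_r` trace uses `tr (P_r A) = (r + 1) σ_{r+1} = -(r + 1) ⟨x, ν⟩`. The tangential part of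
`x` has squared norm `‖x‖² - ⟨x, ν⟩²`, which returns one of the `r + 1` copies of `⟨x, ν⟩²`. -/
theorem sum_hess_normSq {y : Euc n} (hy : y ∈ U) {e : Module.Basis (Fin n) ℝ (Euc n)}
    {k : Fin n → ℝ} (hf : IsPrincipalFrame x ν y e k) {r : ℕ}
    (hs : sigma x ν (r + 1) y = -inner ℝ (x y) (ν y)) :
    ∑ i, es k (Finset.univ.erase i) r *
        fderiv ℝ (fderiv ℝ (fun z => ‖x z‖ ^ 2 : Euc n → ℝ)) y (e i) (e i) =
      fderiv ℝ (fun z => ‖x z‖ ^ 2 : Euc n → ℝ) y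
          (drift x y e fun i => es k (Finset.univ.erase i) r) +
        2 * ∑ i, es k (Finset.univ.erase i) r - 2 * r * inner ℝ (x y) (ν y) ^ 2 -
          2 * ‖x y‖ ^ 2 := by
  have hG := h.isGaussPair hy
  have hσ := sum_es_erase_mul k Finset.univ r
  rw [← hf.sigma_eq, hs] at hσ
  have h1 : ∀ i, es k (Finset.univ.erase i) r *
        fderiv ℝ (fderiv ℝ (fun z => ‖x z‖ ^ 2 : Euc n → ℝ)) y (e i) (e i) =
      es k (Finset.univ.erase i) r * fderiv ℝ (fun z => ‖x z‖ ^ 2 : Euc n → ℝ) y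
        (pinv (fderiv ℝ x y) (fderiv ℝ (fderiv ℝ x) y (e i) (e i))) +
      2 * es k (Finset.univ.erase i) r +
      2 * inner ℝ (x y) (ν y) * (es k (Finset.univ.erase i) r * k i) := by
    intro i
    rw [h.fderiv_fderiv_normSq hy, h.inner_sndDeriv_frame hy hf, h.fderiv_normSq hy,
      real_inner_self_eq_norm_sq, hf.orthonormal_fderiv.1 i]
    ring
  have h2 : fderiv ℝ (fun z => ‖x z‖ ^ 2 : Euc n → ℝ) y (pinv (fderiv ℝ x y) (x y)) =
      2 * ‖x y‖ ^ 2 - 2 * inner ℝ (x y) (ν y) ^ 2 := by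
    rw [h.fderiv_normSq hy, apply_pinv hG.injective hG.norm_eq_one hG.orthogonal, inner_sub_right,
      real_inner_smul_right, real_inner_self_eq_norm_sq, real_inner_comm (x y) (ν y)]
    ring
  simp_rw [h1]
  rw [Finset.sum_add_distrib, Finset.sum_add_distrib, ← Finset.mul_sum, ← Finset.mul_sum, hσ,
    drift, map_add, map_sum, h2]
  simp_rw [map_smul, smul_eq_mul]
  ring

/-- By Codazzi, the Hessian of the support function contains the derivative of `A` along the
tangential part `ξ` of `x`. The `P_r` trace of that derivative is `dσ_{r+1}(ξ)`, known from the
shrinker equation. This uses the equation on all of `U`, not only at `y`. -/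
theorem sum_hess_support {y : Euc n} (hy : y ∈ U) {e : Module.Basis (Fin n) ℝ (Euc n)}
    {k : Fin n → ℝ} (hf : IsPrincipalFrame x ν y e k) {r : ℕ}
    (hs : ∀ z ∈ U, sigma x ν (r + 1) z = -inner ℝ (x z) (ν z)) :
    ∑ i, es k (Finset.univ.erase i) r *
        fderiv ℝ (fderiv ℝ (fun z => inner ℝ (x z) (ν z) : Euc n → ℝ)) y (e i) (e i) =
      fderiv ℝ (fun z => inner ℝ (x z) (ν z) : Euc n → ℝ) y
          (drift x y e fun i => es k (Finset.univ.erase i) r) +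
        ((r + 1 : ℝ) - modifiedNormSq x ν r y) * inner ℝ (x y) (ν y) := by
  have hG := h.isGaussPair hy
  have hσ := sum_es_erase_mul k Finset.univ r
  rw [← hf.sigma_eq, hs y hy] at hσ
  set ξ := pinv (fderiv ℝ x y) (x y) with hξ
  set u : Euc n → ℝ := fun z => inner ℝ (x z) (ν z) with hu
  have hDξ : x y = fderiv ℝ x y ξ + inner ℝ (x y) (ν y) • ν y := by
    rw [hξ, apply_pinv hG.injective hG.norm_eq_one hG.orthogonal, real_inner_comm (x y) (ν y)]
    abel
  -- The shrinker equation, differentiated along `ξ`, turns the trace of `P_r` against the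
  -- derivative of `A` into the first order term `-du(ξ)`.
  have hdσ := eq_of_eqOn_of_hasDerivAt_line h.isOpen hy (v := ξ) hs (h.hasDerivAt_sigma hy hf ξ r)
    (hasDerivAt_line (hasFDerivAt_of_contDiffOn h.isOpen h.contDiffOn_support hy) ξ).neg
  have h1 : ∀ i, es k (Finset.univ.erase i) r * fderiv ℝ (fderiv ℝ u) y (e i) (e i) =
      es k (Finset.univ.erase i) r * fderiv ℝ u y
        (pinv (fderiv ℝ x y) (fderiv ℝ (fderiv ℝ x) y (e i) (e i))) -
      es k (Finset.univ.erase i) r * k i -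
      u y * (es k (Finset.univ.erase i) r * k i ^ 2) -
      es k (Finset.univ.erase i) r *
        (-inner ℝ (fderiv ℝ (fderiv ℝ ν) y ξ (e i)) (fderiv ℝ x y (e i)) -
          k i * inner ℝ (fderiv ℝ (fderiv ℝ x) y ξ (e i)) (fderiv ℝ x y (e i))) := by
    intro i
    have hB := h.fderiv_normal_frame hy hf i
    have hon : inner ℝ (fderiv ℝ x y (e i)) (fderiv ℝ x y (e i)) = (1 : ℝ) := by
      rw [real_inner_self_eq_norm_sq, hf.orthonormal_fderiv.1 i, one_pow]
    -- Codazzi trades a derivative of `dν` in the direction `e_i`, tested against `ξ`, for one in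
    -- the direction `ξ`, tested against `e_i`.
    have hco := h.codazzi hy (e i) (e i) ξ
    rw [fderiv_fderiv_symm h.isOpen h.smooth hy (e i) ξ,
      fderiv_fderiv_symm h.isOpen h.smooth_normal hy (e i) ξ, hB, inner_neg_left,
      real_inner_smul_left, h.inner_sndDeriv_frame hy hf, hG.orthogonal' ξ, hG.symm,
      real_inner_comm (fderiv ℝ (fderiv ℝ x) y ξ (e i))] at hco
    have hnn := h.inner_fderiv_fderiv_normal hy (e i) (e i)
    rw [hB, inner_neg_left, inner_neg_right, real_inner_smul_left, real_inner_smul_right, hon]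
      at hnn
    set γ := pinv (fderiv ℝ x y) (fderiv ℝ (fderiv ℝ x) y (e i) (e i))
    have hγ : fderiv ℝ u y γ = inner ℝ (fderiv ℝ ν y γ) (fderiv ℝ x y ξ) := by
      rw [hu, h.fderiv_support hy, hDξ, inner_add_left, real_inner_smul_left,
        real_inner_comm _ (ν y), hG.orthogonal', real_inner_comm (fderiv ℝ ν y γ),
        mul_zero, add_zero]
    rw [hγ, hu, h.fderiv_fderiv_support hy, hB, inner_neg_right, real_inner_smul_right, hon]
    have hx : inner ℝ (x y) (fderiv ℝ (fderiv ℝ ν) y (e i) (e i)) =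
        inner ℝ (fderiv ℝ (fderiv ℝ ν) y (e i) (e i)) (fderiv ℝ x y ξ) +
          inner ℝ (x y) (ν y) * inner ℝ (ν y) (fderiv ℝ (fderiv ℝ ν) y (e i) (e i)) := by
      conv_lhs => rw [hDξ]
      rw [inner_add_left, real_inner_smul_left, real_inner_comm (fderiv ℝ x y ξ)]
    rw [hx, hnn]
    linear_combination es k (Finset.univ.erase i) r * hco
  simp_rw [h1]
  rw [Finset.sum_sub_distrib, Finset.sum_sub_distrib, Finset.sum_sub_distrib, hdσ,
    ← Finset.mul_sum, hσ, drift, map_add, map_sum, hf.modifiedNormSq_eq]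
  simp_rw [map_smul, smul_eq_mul]
  ring

end IsPatch

/-! ### Smoothness of the unit normal. -/

section NormalRegularity

open Topology

/-- A continuous unit normal field of a smooth parametrized hypersurface is smooth. -/
theorem contDiffOn_normal {n : ℕ} {U : Set (Euc n)} {x ν : Euc n → Euc (n + 1)} (hU : IsOpen U)
    (hx : ContDiffOn ℝ ∞ x U) (hinj : ∀ y ∈ U, Function.Injective (fderiv ℝ x y))
    (hν : ContinuousOn ν U) (hnorm : ∀ y ∈ U, ‖ν y‖ = 1)
    (horth : ∀ y ∈ U, ∀ v, inner ℝ (fderiv ℝ x y v) (ν y) = 0) : ContDiffOn ℝ ∞ ν U := by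
  intro y hy
  refine ContDiffAt.contDiffWithinAt ?_
  set m := ν y with hm
  -- The normal component at `z` of the fixed vector `ν y`. It depends smoothly on the differential
  -- of `x` alone, and equals `⟨ν z, ν y⟩ ν z`. Near `y` the factor is positive by continuity, so
  -- normalizing `P` recovers `ν` rather than `-ν`.
  set P : Euc n → Euc (n + 1) := fun z => m - fderiv ℝ x z (pinv (fderiv ℝ x z) m) with hP
  have hPz : ∀ z ∈ U, P z = inner ℝ (ν z) m • ν z := fun z hz => by
    rw [hP]
    simp only
    rw [apply_pinv (hinj z hz) (hnorm z hz) (horth z hz), sub_sub_cancel]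
  have hD : ContDiffAt ℝ ∞ (fderiv ℝ x) y := contDiffAt_fderiv hU hx hy
  have hPs : ContDiffAt ℝ ∞ P y :=
    contDiffAt_const.sub (hD.clm_apply
      ((ContDiffAt.comp y (contDiffAt_pinv (hinj y hy)) hD).clm_apply contDiffAt_const))
  have hPy : P y = m := by
    rw [hPz y hy, ← hm, real_inner_self_eq_norm_sq, hm, hnorm y hy]
    simp
  have hm0 : m ≠ 0 := by
    intro h0
    have := hnorm y hy
    rw [← hm, h0, norm_zero] at this
    exact zero_ne_one this
  have hlim : Filter.Tendsto (fun z => inner ℝ (ν z) m : Euc n → ℝ) (𝓝 y) (𝓝 1) := by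
    have h1 : ContinuousAt ν y := hν.continuousAt (hU.mem_nhds hy)
    have h2 : ContinuousAt (fun z => inner ℝ (ν z) m : Euc n → ℝ) y :=
      h1.inner continuousAt_const
    have h3 : inner ℝ (ν y) m = (1 : ℝ) := by
      rw [← hm, real_inner_self_eq_norm_sq, hm, hnorm y hy, one_pow]
    rw [← h3]
    exact h2
  have hev : ν =ᶠ[𝓝 y] fun z => ‖P z‖⁻¹ • P z := by
    filter_upwards [hU.mem_nhds hy, hlim.eventually (lt_mem_nhds zero_lt_one)] with z hz hpos
    rw [hPz z hz, norm_smul, hnorm z hz, mul_one, Real.norm_of_nonneg hpos.le, smul_smul,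
      inv_mul_cancel₀ hpos.ne', one_smul]
  refine ContDiffAt.congr_of_eventuallyEq ?_ hev
  have hPy0 : P y ≠ 0 := by rwa [hPy]
  exact ((hPs.norm ℝ hPy0).inv (norm_ne_zero_iff.2 hPy0)).smul hPs

theorem IsPatch.of_continuousOn {n : ℕ} {U : Set (Euc n)} {x ν : Euc n → Euc (n + 1)}
    (hU : IsOpen U) (hx : ContDiffOn ℝ ∞ x U) (hinj : ∀ y ∈ U, Function.Injective (fderiv ℝ x y))
    (hν : ContinuousOn ν U) (hnorm : ∀ y ∈ U, ‖ν y‖ = 1)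
    (horth : ∀ y ∈ U, ∀ v, inner ℝ (fderiv ℝ x y v) (ν y) = 0) : IsPatch U x ν :=
  ⟨hU, hx, contDiffOn_normal hU hx hinj hν hnorm horth, hinj, hnorm, horth⟩

end NormalRegularity

/-! ### Invariance of the curvature quantities under changes of coordinates. -/

section Conjugation

variable {n : ℕ} {M M' : Type*} [TopologicalSpace M] [ChartedSpace (Euc n) M] [TopologicalSpace M']
  [ChartedSpace (Euc n) M']

/-- The pair `(x, ν)` at `y` is obtained from `(X, N)` at `q` by the change of coordinates `T`. -/
structure IsReparam (X N : M → Euc (n + 1)) (q : M) (x ν : M' → Euc (n + 1)) (y : M')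
    (T : Euc n ≃L[ℝ] Euc n) : Prop where
  differential_eq : differential x y = differential X q ∘L (T : Euc n →L[ℝ] Euc n)
  differential_normal_eq : differential ν y = differential N q ∘L (T : Euc n →L[ℝ] Euc n)
  injective : Function.Injective (differential X q)

namespace IsReparam

variable {X N : M → Euc (n + 1)} {q : M} {x ν : M' → Euc (n + 1)} {y : M'}
  {T : Euc n ≃L[ℝ] Euc n} (h : IsReparam X N q x ν y T)
include h

theorem shapeOperator_eq_conj : shapeOperator x ν y =
    T.symm.toLinearEquiv.conjAlgEquiv ℝ (shapeOperator X N q) := by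
  ext1 v
  rw [shapeOperator_eq_shapeMap, h.differential_eq, h.differential_normal_eq]
  exact shapeMap_comp_equiv h.injective T v

theorem sigma_eq (j : ℕ) : sigma x ν j y = sigma X N j q := by
  rw [sigma, sigma, principalCurvatures, principalCurvatures, h.shapeOperator_eq_conj]
  congr 2
  exact LinearEquiv.charpoly_conj _ _

theorem newton_eq_conj (j : ℕ) : newton x ν j y =
    T.symm.toLinearEquiv.conjAlgEquiv ℝ (newton X N j q) := by
  simp only [newton, h.sigma_eq, h.shapeOperator_eq_conj, map_sum, map_smul, map_pow]

theorem newton_apply (j : ℕ) (v : Euc n) : T (newton x ν j y v) = newton X N j q (T v) := by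
  rw [h.newton_eq_conj]
  exact T.apply_symm_apply _

theorem shapeOperator_apply (v : Euc n) :
    T (shapeOperator x ν y v) = shapeOperator X N q (T v) := by
  rw [h.shapeOperator_eq_conj]
  exact T.apply_symm_apply _

theorem modifiedNormSq_eq (j : ℕ) : modifiedNormSq x ν j y = modifiedNormSq X N j q := by
  rw [modifiedNormSq, modifiedNormSq, h.newton_eq_conj, h.shapeOperator_eq_conj, ← map_pow,
    ← map_mul]
  exact LinearMap.trace_conj' _ _

theorem firstForm_eq (v w : Euc n) : firstForm x y v w = firstForm X q (T v) (T w) := by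
  rw [firstForm, firstForm, h.differential_eq]
  rfl

theorem pinv_eq (z : Euc (n + 1)) :
    pinv (differential x y) z = T.symm (pinv (differential X q) z) := by
  rw [h.differential_eq, pinv_comp_equiv h.injective]

end IsReparam

end Conjugation

/-! ### Passage from the manifold to parametrized hypersurfaces. -/

section Charts

variable {n : ℕ} {M : Type*} [TopologicalSpace M] [ChartedSpace (Euc n) M] [IsManifold (𝓡 n) ∞ M]
  {X N : M → Euc (n + 1)}

omit [IsManifold (𝓡 n) ∞ M] in
theorem isOpen_chart_target (p : M) : IsOpen (extChartAt (𝓡 n) p).target :=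
  isOpen_extChartAt_target p

theorem contDiffOn_comp_chart {F : M → Euc (n + 1)}
    (hF : ContMDiff (𝓡 n) 𝓘(ℝ, Euc (n + 1)) ∞ F) (p : M) :
    ContDiffOn ℝ ∞ (F ∘ (extChartAt (𝓡 n) p).symm) (extChartAt (𝓡 n) p).target := by
  rw [← contMDiffOn_iff_contDiffOn]
  exact hF.comp_contMDiffOn (contMDiffOn_extChartAt_symm p)

/-- The differential at a point is written in the preferred chart of that point, which need not be
the chart at `p`; `T` is the change of tangent coordinates. One `T` serves all `F`, so `X` and `N`
are reparametrized together. -/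
theorem exists_fderiv_comp_chart (p : M) {y : Euc n} (hy : y ∈ (extChartAt (𝓡 n) p).target) :
    ∃ T : Euc n ≃L[ℝ] Euc n, ∀ F : M → Euc (n + 1),
      MDifferentiableAt (𝓡 n) 𝓘(ℝ, Euc (n + 1)) F ((extChartAt (𝓡 n) p).symm y) →
      fderiv ℝ (F ∘ (extChartAt (𝓡 n) p).symm) y =
        differential F ((extChartAt (𝓡 n) p).symm y) ∘L (T : Euc n →L[ℝ] Euc n) := by
  have : IsManifold (𝓡 n) 1 M := IsManifold.of_le (n := ∞) (by simp)
  have hinv := isInvertible_mfderivWithin_extChartAt_symm (I := 𝓡 n) hy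
  have hd := mdifferentiableWithinAt_extChartAt_symm (I := 𝓡 n) hy
  rw [ModelWithCorners.range_eq_univ] at hinv hd
  rw [mfderivWithin_univ] at hinv
  rw [mdifferentiableWithinAt_univ] at hd
  obtain ⟨T, hT⟩ := hinv
  refine ⟨T, fun F hF => ?_⟩
  rw [← mfderiv_eq_fderiv, mfderiv_comp y hF hd, ← hT]
  rfl

theorem IsSmoothImmersion.isPatch_chart (hX : IsSmoothImmersion X) (hN : IsUnitNormal X N) (p : M) :
    IsPatch (extChartAt (𝓡 n) p).target (X ∘ (extChartAt (𝓡 n) p).symm)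
      (N ∘ (extChartAt (𝓡 n) p).symm) := by
  have hXd : ∀ q, MDifferentiableAt (𝓡 n) 𝓘(ℝ, Euc (n + 1)) X q := fun q =>
    (hX.smooth q).mdifferentiableAt (by simp)
  refine IsPatch.of_continuousOn (isOpen_chart_target p) (contDiffOn_comp_chart hX.smooth p)
    (fun y hy => ?_) (hN.continuous.comp_continuousOn (continuousOn_extChartAt_symm p))
    (fun y _ => hN.norm_eq_one _) fun y hy v => ?_
  · obtain ⟨T, hT⟩ := exists_fderiv_comp_chart p hy
    rw [hT X (hXd _)]
    exact (hX.injective _).comp T.injective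
  · obtain ⟨T, hT⟩ := exists_fderiv_comp_chart p hy
    rw [hT X (hXd _)]
    exact hN.orthogonal _ _

theorem IsSmoothImmersion.contMDiff_normal (hX : IsSmoothImmersion X) (hN : IsUnitNormal X N) :
    ContMDiff (𝓡 n) 𝓘(ℝ, Euc (n + 1)) ∞ N := by
  intro q
  rw [contMDiffAt_iff]
  refine ⟨hN.continuous.continuousAt, ?_⟩
  have h1 := (hX.isPatch_chart hN q).smooth_normal.contDiffAt
    ((isOpen_chart_target q).mem_nhds (mem_extChartAt_target q))
  exact h1.contDiffWithinAt

theorem IsSmoothImmersion.exists_isReparam (hX : IsSmoothImmersion X) (hN : IsUnitNormal X N)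
    (p : M) {y : Euc n} (hy : y ∈ (extChartAt (𝓡 n) p).target) :
    ∃ T : Euc n ≃L[ℝ] Euc n, IsReparam X N ((extChartAt (𝓡 n) p).symm y)
      (X ∘ (extChartAt (𝓡 n) p).symm) (N ∘ (extChartAt (𝓡 n) p).symm) y T := by
  obtain ⟨T, hT⟩ := exists_fderiv_comp_chart p hy
  refine ⟨T, ?_, ?_, hX.injective _⟩
  · rw [differential_eq_fderiv, hT X ((hX.smooth _).mdifferentiableAt (by simp))]
  · rw [differential_eq_fderiv, hT N ((hX.contMDiff_normal hN _).mdifferentiableAt (by simp))]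

end Charts

/-! ### The weak maximum principle. -/

section MaximumPrinciple

open Topology

variable {E : Type*} [NormedAddCommGroup E] [NormedSpace ℝ E]

/-- A positive second derivative would make the point also a local minimum. Then `g` would be
locally constant, with zero second derivative. -/
theorem deriv_deriv_nonpos_of_isLocalMax {g : ℝ → ℝ} {t₀ : ℝ} (h : IsLocalMax g t₀)
    (hc : ContinuousAt g t₀) : deriv (deriv g) t₀ ≤ 0 := by
  by_contra! hpos
  have hmin := isLocalMin_of_deriv_deriv_pos hpos h.deriv_eq_zero hc
  have h1 : g =ᶠ[𝓝 t₀] fun _ => g t₀ := by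
    filter_upwards [h, hmin] with t h1 h2
    exact le_antisymm h1 h2
  have h2 : deriv (deriv g) t₀ = 0 := by
    rw [h1.deriv.deriv_eq]
    simp
  exact hpos.ne' h2

/-- The second order necessary condition at an interior maximum. -/
theorem fderiv_fderiv_nonpos_of_isLocalMax {U : Set E} (hU : IsOpen U) {f : E → ℝ}
    (hf : ContDiffOn ℝ ∞ f U) {y : E} (hy : y ∈ U) (h : IsLocalMax f y) (v : E) :
    fderiv ℝ (fderiv ℝ f) y v v ≤ 0 := by
  set g : ℝ → ℝ := fun t => f (y + t • v) with hg
  have hline : ContinuousAt (fun t : ℝ => y + t • v) 0 := by fun_prop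
  have hd : ∀ᶠ t : ℝ in 𝓝 0, deriv g t = fderiv ℝ f (y + t • v) v := by
    filter_upwards [eventually_line_mem hU hy v] with t ht
    have h1 := hasDerivAt_line (hasFDerivAt_of_contDiffOn hU hf ht) v
    have h2 : HasDerivAt (fun s : ℝ => s - t) 1 t := (hasDerivAt_id t).sub_const t
    have h3 : HasDerivAt (fun s : ℝ => f (y + t • v + s • v)) (fderiv ℝ f (y + t • v) v)
        (t - t) := by simpa using h1
    have h4 := HasDerivAt.comp t (h₂ := fun s : ℝ => f (y + t • v + s • v))
      (h := fun s : ℝ => s - t) h3 h2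
    rw [mul_one] at h4
    refine HasDerivAt.deriv (h4.congr_of_eventuallyEq (.of_forall fun s => ?_))
    simp only [hg, Function.comp]
    congr 1
    rw [add_assoc, ← add_smul]
    congr 2
    ring
  have h2 : deriv (deriv g) 0 = fderiv ℝ (fderiv ℝ f) y v v := by
    rw [Filter.EventuallyEq.deriv_eq hd]
    exact (hasDerivAt_line_fderiv hU hf hy v v).deriv
  rw [← h2]
  refine deriv_deriv_nonpos_of_isLocalMax ?_ ?_
  · have h3 : Filter.Tendsto (fun t : ℝ => y + t • v) (𝓝 0) (𝓝 y) := by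
      simpa using hline.tendsto
    have h4 := h3.eventually h
    simpa [IsLocalMax, IsMaxFilter, hg] using h4
  · exact (hasDerivAt_line (hasFDerivAt_of_contDiffOn hU hf hy) v).continuousAt

end MaximumPrinciple

/-! ### Hopf's barrier and the strong maximum principle. -/

section Barrier

open Topology

variable {E : Type*} [NormedAddCommGroup E] [InnerProductSpace ℝ E]

/-- Hopf's barrier. -/
def hopfBarrier (α ε c : ℝ) (p : E) (y : E) : ℝ := ε * (Real.exp (-α * ‖y - p‖ ^ 2) - c)

theorem contDiff_hopfBarrier (α ε c : ℝ) (p : E) : ContDiff ℝ ∞ (hopfBarrier α ε c p) := by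
  unfold hopfBarrier
  exact contDiff_const.mul (((contDiff_const.mul
    ((contDiff_id.sub contDiff_const).norm_sq ℝ)).exp).sub contDiff_const)

theorem fderiv_hopfBarrier (α ε c : ℝ) (p y v : E) :
    fderiv ℝ (hopfBarrier α ε c p) y v =
      ε * (Real.exp (-α * ‖y - p‖ ^ 2) * (-α * (2 * inner ℝ (y - p) v))) := by
  have h1 := hasDerivAt_line (((contDiff_hopfBarrier α ε c p).differentiable
    (by simp) y).hasFDerivAt) v
  have h0 : HasDerivAt (fun t : ℝ => y + t • v - p) v 0 := by
    simpa using (((hasDerivAt_id (0 : ℝ)).smul_const v).const_add y).sub_const p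
  have h2 := (((h0.norm_sq.const_mul (-α)).exp).sub_const c).const_mul ε
  refine (h1.unique h2).trans ?_
  simp

theorem fderiv_fderiv_hopfBarrier (α ε c : ℝ) (p y v : E) :
    fderiv ℝ (fderiv ℝ (hopfBarrier α ε c p)) y v v =
      ε * (Real.exp (-α * ‖y - p‖ ^ 2) *
        (4 * α ^ 2 * inner ℝ (y - p) v ^ 2 - 2 * α * ‖v‖ ^ 2)) := by
  have h0 : HasDerivAt (fun t : ℝ => y + t • v - p) v 0 := by
    simpa using (((hasDerivAt_id (0 : ℝ)).smul_const v).const_add y).sub_const p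
  have h2 := (((h0.norm_sq.const_mul (-α)).exp).mul
    (((h0.inner ℝ (hasDerivAt_const (0 : ℝ) v)).const_mul 2).const_mul (-α))).const_mul ε
  have h1 := eq_of_eqOn_of_hasDerivAt_line isOpen_univ (Set.mem_univ y) (v := v)
    (fun z _ => fderiv_hopfBarrier α ε c p z v)
    (hasDerivAt_line_fderiv isOpen_univ (contDiff_hopfBarrier α ε c p).contDiffOn
      (Set.mem_univ y) v v) h2
  rw [h1]
  simp only [zero_smul, add_zero, inner_zero_right, zero_add, real_inner_self_eq_norm_sq]
  ring

end Barrier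

section StrongMaximumPrinciple

open Topology Metric

variable {E : Type*} [NormedAddCommGroup E] [InnerProductSpace ℝ E]

/-- The ball with diameter `zy` is internally tangent at `y` to the ball about `z` through `y`, and
meets its boundary sphere only there; this is the parallelogram law. -/
theorem lt_dist_of_mem_closedBall_midpoint {y z p : E} (hp : p ≠ y)
    (h : dist p (midpoint ℝ z y) ≤ dist z y / 2) : dist p z < dist z y := by
  set a := p - midpoint ℝ z y with ha
  set b := (1 / 2 : ℝ) • (y - z) with hb
  have hm : midpoint ℝ z y = z + b := by
    rw [midpoint_eq_smul_add, hb, invOf_eq_inv]; module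
  have hpz : p - z = a + b := by rw [ha, hm]; abel
  have hpy : p - y = a - b := by rw [ha, hm, hb]; module
  have hbn : ‖b‖ = dist z y / 2 := by
    rw [hb, norm_smul, dist_comm, dist_eq_norm]; norm_num; ring
  rw [dist_eq_norm, ← ha, ← hbn] at h
  have hd : dist z y = 2 * ‖b‖ := by rw [hbn]; ring
  have hpos : 0 < ‖a - b‖ := by rw [← hpy]; exact norm_pos_iff.2 (sub_ne_zero.2 hp)
  rw [dist_eq_norm, hpz, hd]
  have h1 := parallelogram_law_with_norm ℝ a b
  nlinarith [norm_nonneg a, norm_nonneg b, norm_nonneg (a + b)]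

/-- Hopf's strong maximum principle, for functions that are subsolutions in the viscosity sense,
where positive, of a uniformly elliptic operator without zeroth order term. -/
theorem eq_of_subsolution_of_isMax [ProperSpace E] {ι : Type*} [Fintype ι] {y₀ : E} {R : ℝ}
    {f : E → ℝ} {m c C : ℝ} (hm : 0 < m) (hc : 0 < c)
    (hf : ContinuousOn f (ball y₀ R)) (hle : ∀ y ∈ ball y₀ R, f y ≤ m) (h0 : f y₀ = m)
    (H : ∀ y ∈ ball y₀ R, 0 < f y → ∀ w : E → ℝ, ContDiff ℝ ∞ w →
      IsLocalMax (fun z => f z + w z) y → ∃ (μ : ι → ℝ) (e : ι → E) (β : E),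
        ∑ i, μ i * fderiv ℝ (fderiv ℝ w) y (e i) (e i) ≤ fderiv ℝ w y β ∧
        (∀ z, c * ‖z‖ ^ 2 ≤ ∑ i, μ i * inner ℝ z (e i) ^ 2) ∧
        ∑ i, μ i * ‖e i‖ ^ 2 ≤ C ∧ ‖β‖ ≤ C) :
    ∀ z ∈ ball y₀ (R / 4), f z = m := by
  intro z hz
  by_contra hzm
  rw [mem_ball] at hz
  have hR : 0 < R := by linarith [dist_nonneg (x := z) (y := y₀)]
  have hsub : closedBall y₀ (R / 2) ⊆ ball y₀ R := closedBall_subset_ball (by linarith)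
  -- Let `y` be a point of the maximum set closest to `z`. The open ball about `z` through `y` stays
  -- inside the domain and contains no maximum point.
  set F := closedBall y₀ (R / 2) ∩ f ⁻¹' {m} with hF
  have hFcomp : IsCompact F := by
    refine (isCompact_closedBall y₀ (R / 2)).of_isClosed_subset ?_ Set.inter_subset_left
    exact (hf.mono hsub).preimage_isClosed_of_isClosed isClosed_closedBall isClosed_singleton
  obtain ⟨y, hyF, hymin⟩ := hFcomp.exists_isMinOn
    ⟨y₀, mem_closedBall_self (by linarith), h0⟩ (f := fun p => dist z p)
    (continuous_const.dist continuous_id).continuousOn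
  set d := dist z y with hd
  have hfy : f y = m := hyF.2
  have hd0 : 0 < d := by
    rw [hd, dist_pos]
    rintro rfl
    exact hzm hfy
  have hdR : d < R / 4 := by
    have : dist z y ≤ dist z y₀ :=
      hymin (show y₀ ∈ F from ⟨mem_closedBall_self (by linarith), h0⟩)
    linarith
  have hyy₀ : dist y y₀ < R / 2 := by
    have := dist_triangle_left y y₀ z
    linarith
  have hball : ∀ p, dist p z < d → f p < m := by
    intro p hp
    have hpR : dist p y₀ ≤ R / 2 := by
      have := dist_triangle p z y₀
      linarith
    refine lt_of_le_of_ne (hle p (hsub hpR)) fun hpm => ?_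
    have : dist z y ≤ dist z p := hymin (show p ∈ F from ⟨hpR, hpm⟩)
    rw [dist_comm z p] at this
    linarith
  -- Halving the ball leaves `y` as its only boundary point in the maximum set.
  set q := midpoint ℝ z y with hq
  set ρ := d / 2 with hρ
  have hρ0 : 0 < ρ := by rw [hρ]; linarith
  have hyq : dist y q = ρ := by
    rw [hq, dist_comm, dist_midpoint_right, hρ, hd]
    norm_num
    ring
  -- The threshold for `α` is exactly what the final inequality contradicts. On the ball `V` below,
  -- `‖p - q‖` lies between `ρ / 2` and `3ρ / 2`, so the quadratic term in `α` beats the trace and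
  -- drift terms.
  obtain ⟨α, hα0, hα⟩ : ∃ α : ℝ, 0 < α ∧ C * (2 + 3 * ρ) < α * (c * ρ ^ 2) := by
    have hp : 0 < c * ρ ^ 2 := by positivity
    refine ⟨(|C * (2 + 3 * ρ)| + 1) / (c * ρ ^ 2), by positivity, ?_⟩
    rw [div_mul_cancel₀ _ hp.ne']
    linarith [le_abs_self (C * (2 + 3 * ρ))]
  set V := closedBall y (ρ / 2) with hV
  have hVR : V ⊆ ball y₀ R := by
    intro p hp
    rw [hV, mem_closedBall] at hp
    rw [mem_ball]
    have := dist_triangle p y y₀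
    linarith
  have hfV : ContinuousOn f V := hf.mono hVR
  obtain ⟨δ, hδ0, hδ⟩ : ∃ δ > 0, ∀ p ∈ sphere y (ρ / 2) ∩ closedBall q ρ, f p ≤ m - δ := by
    rcases (sphere y (ρ / 2) ∩ closedBall q ρ).eq_empty_or_nonempty with hem | hne
    · exact ⟨1, one_pos, by simp [hem]⟩
    · have hcomp : IsCompact (sphere y (ρ / 2) ∩ closedBall q ρ) :=
        (isCompact_sphere y (ρ / 2)).inter_right isClosed_closedBall
      obtain ⟨p, hp, hpmax⟩ := hcomp.exists_isMaxOn hne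
        (hfV.mono (Set.inter_subset_left.trans sphere_subset_closedBall))
      have hpy : p ≠ y := by
        rintro rfl
        have := hp.1
        rw [mem_sphere, dist_self] at this
        linarith
      have h1 : f p < m := hball p (lt_dist_of_mem_closedBall_midpoint hpy hp.2)
      refine ⟨m - f p, by linarith, fun p' hp' => ?_⟩
      have : f p' ≤ f p := hpmax hp'
      linarith
  -- Below `δ`, so that `f + w < m` on the part of the boundary of `V` inside the ball about `q`;
  -- below `m`, so that `f` is positive at the interior maximum of `f + w`, where `H` is to be
  -- applied.
  set ε := min δ m / 2 with hε
  have hε0 : 0 < ε := by rw [hε]; have := lt_min hδ0 hm; linarith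
  have hεδ : ε < δ := by rw [hε]; have := min_le_left δ m; linarith
  have hεm : ε < m := by rw [hε]; have := min_le_right δ m; linarith
  set w := hopfBarrier α ε (Real.exp (-α * ρ ^ 2)) q with hw
  have hwle : ∀ p, w p ≤ ε := by
    intro p
    have h1 : Real.exp (-α * ‖p - q‖ ^ 2) ≤ 1 :=
      Real.exp_le_one_iff.2 (by nlinarith [sq_nonneg ‖p - q‖])
    have h2 := Real.exp_pos (-α * ρ ^ 2)
    have : w p = ε * (Real.exp (-α * ‖p - q‖ ^ 2) - Real.exp (-α * ρ ^ 2)) := rfl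
    rw [this]
    nlinarith
  have hwout : ∀ p, ρ < dist p q → w p < 0 := by
    intro p hp
    have : w p = ε * (Real.exp (-α * ‖p - q‖ ^ 2) - Real.exp (-α * ρ ^ 2)) := rfl
    rw [this]
    refine mul_neg_of_pos_of_neg hε0 (sub_neg.2 (Real.exp_lt_exp.2 ?_))
    rw [dist_eq_norm] at hp
    have : ρ ^ 2 < ‖p - q‖ ^ 2 := by gcongr
    nlinarith
  have hwy : w y = 0 := by
    have : w y = ε * (Real.exp (-α * ‖y - q‖ ^ 2) - Real.exp (-α * ρ ^ 2)) := rfl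
    rw [this, ← dist_eq_norm, hyq, sub_self, mul_zero]
  have hwC : ContDiff ℝ ∞ w := contDiff_hopfBarrier _ _ _ _
  obtain ⟨p, hpV, hpmax⟩ := (isCompact_closedBall y (ρ / 2)).exists_isMaxOn
    ⟨y, mem_closedBall_self (by linarith)⟩ (hfV.add hwC.continuous.continuousOn)
  have hpge : m ≤ f p + w p := by
    have : f y + w y ≤ f p + w p := hpmax (mem_closedBall_self (by linarith))
    linarith
  -- On the sphere, either `f ≤ m - δ` and `w ≤ ε < δ`, or `w < 0` and `f ≤ m`. Both keep `f + w`
  -- below its value `m` at `y`.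
  have hpnot : p ∉ sphere y (ρ / 2) := by
    intro hps
    by_cases hpq : dist p q ≤ ρ
    · have h1 := hδ p ⟨hps, hpq⟩
      have h2 := hwle p
      linarith
    · have h1 := hwout p (not_le.1 hpq)
      have h2 := hle p (hVR hpV)
      linarith
  have hpball : p ∈ ball y (ρ / 2) := by
    rw [mem_ball]
    exact lt_of_le_of_ne hpV fun h => hpnot h
  have hlocal : IsLocalMax (fun z => f z + w z) p :=
    hpmax.isLocalMax (Filter.mem_of_superset (isOpen_ball.mem_nhds hpball) ball_subset_closedBall)
  have hfp : 0 < f p := by linarith [hwle p]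
  obtain ⟨μ, e, β, h1, h2, h3, h4⟩ := H p (hVR hpV) hfp w hwC hlocal
  set X := Real.exp (-α * ‖p - q‖ ^ 2) with hX
  have hX0 : 0 < X := Real.exp_pos _
  have hpq1 : ρ / 2 ≤ ‖p - q‖ := by
    rw [← dist_eq_norm]
    have h5 := dist_triangle_left y q p
    rw [mem_ball] at hpball
    linarith
  have hpq2 : ‖p - q‖ ≤ 3 * ρ / 2 := by
    rw [← dist_eq_norm]
    have h5 := dist_triangle p y q
    rw [mem_ball] at hpball
    linarith
  have hlhs : ∑ i, μ i * fderiv ℝ (fderiv ℝ w) p (e i) (e i) =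
      ε * X * (4 * α ^ 2 * (∑ i, μ i * inner ℝ (p - q) (e i) ^ 2) -
        2 * α * ∑ i, μ i * ‖e i‖ ^ 2) := by
    rw [Finset.mul_sum, Finset.mul_sum, ← Finset.sum_sub_distrib, Finset.mul_sum]
    refine Finset.sum_congr rfl fun i _ => ?_
    rw [hw, fderiv_fderiv_hopfBarrier]
    ring
  have hrhs : fderiv ℝ w p β = ε * X * (-2 * α * inner ℝ (p - q) β) := by
    rw [hw, fderiv_hopfBarrier]
    ring
  rw [hlhs, hrhs] at h1
  have h5 := le_of_mul_le_mul_left h1 (mul_pos hε0 hX0)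
  have h6 : -inner ℝ (p - q) β ≤ 3 * ρ / 2 * C := by
    have h7 := abs_real_inner_le_norm (p - q) β
    have h8 : ‖p - q‖ * ‖β‖ ≤ 3 * ρ / 2 * C :=
      mul_le_mul hpq2 h4 (norm_nonneg _) (by linarith)
    linarith [neg_abs_le (inner ℝ (p - q) β : ℝ)]
  have h9 : c * (ρ / 2) ^ 2 ≤ ∑ i, μ i * inner ℝ (p - q) (e i) ^ 2 :=
    le_trans (by gcongr) (h2 (p - q))
  have h10 : 4 * α ^ 2 * (c * (ρ / 2) ^ 2) - 2 * α * C ≤ 2 * α * (3 * ρ / 2 * C) := by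
    have h11 : 4 * α ^ 2 * (c * (ρ / 2) ^ 2) ≤
      4 * α ^ 2 * ∑ i, μ i * inner ℝ (p - q) (e i) ^ 2 := by gcongr
    have h12 : 2 * α * ∑ i, μ i * ‖e i‖ ^ 2 ≤ 2 * α * C := by gcongr
    have h13 : 2 * α * -inner ℝ (p - q) β ≤ 2 * α * (3 * ρ / 2 * C) := by gcongr
    linarith
  have h14 : α * (α * (c * ρ ^ 2)) ≤ α * (C * (2 + 3 * ρ)) := by linarith
  exact absurd (le_of_mul_le_mul_left h14 hα0) (not_le.2 hα)

end StrongMaximumPrinciple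

/-! ### Derivatives of linear combinations. -/

section LinearCombination

variable {E : Type*} [NormedAddCommGroup E] [NormedSpace ℝ E] {U : Set E} {f g : E → ℝ} {y : E}

theorem fderiv_lincomb (hU : IsOpen U) (hf : ContDiffOn ℝ ∞ f U) (hg : ContDiffOn ℝ ∞ g U)
    (hy : y ∈ U) (a b : ℝ) (v : E) :
    fderiv ℝ (fun z => a * f z + b * g z) y v = a * fderiv ℝ f y v + b * fderiv ℝ g y v := by
  have h1 := (hasFDerivAt_of_contDiffOn hU hf hy).const_mul a
  have h2 := (hasFDerivAt_of_contDiffOn hU hg hy).const_mul b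
  rw [(h1.fun_add h2).fderiv]
  rfl

theorem fderiv_fderiv_lincomb (hU : IsOpen U) (hf : ContDiffOn ℝ ∞ f U) (hg : ContDiffOn ℝ ∞ g U)
    (hy : y ∈ U) (a b : ℝ) (v : E) :
    fderiv ℝ (fderiv ℝ fun z => a * f z + b * g z) y v v =
      a * fderiv ℝ (fderiv ℝ f) y v v + b * fderiv ℝ (fderiv ℝ g) y v v := by
  have h := (contDiffOn_const (c := a)).mul hf |>.add ((contDiffOn_const (c := b)).mul hg)
  exact eq_of_eqOn_of_hasDerivAt_line hU hy (v := v)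
    (fun z hz => fderiv_lincomb hU hf hg hz a b v) (hasDerivAt_line_fderiv hU h hy v v)
    (((hasDerivAt_line_fderiv hU hf hy v v).const_mul a).add
      ((hasDerivAt_line_fderiv hU hg hy v v).const_mul b))

end LinearCombination

/-! ### Maximum principles for the support function in a parametrization. -/

namespace IsPatch

variable {n : ℕ} {U : Set (Euc n)} {x ν : Euc n → Euc (n + 1)} (h : IsPatch U x ν)
include h

/-- The maximum principle for combinations of the support function and the squared distance. -/
theorem support_le_of_isLocalMax {y : Euc n} (hy : y ∈ U) {r : ℕ} {C s ε : ℝ} (hε : 0 ≤ ε)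
    (hs : ∀ z ∈ U, sigma x ν (r + 1) z = -inner ℝ (x z) (ν z))
    (hpsd : ∀ v, 0 ≤ firstForm x y (newton x ν r y v) v)
    (hbdd : ∀ v, √(firstForm x y (newton x ν r y v) (newton x ν r y v)) ≤
      C * √(firstForm x y v v))
    (hmax : IsLocalMax (fun z => s * inner ℝ (x z) (ν z) + (-ε) * ‖x z‖ ^ 2) y) :
    ((r + 1 : ℝ) - modifiedNormSq x ν r y) * (s * inner ℝ (x y) (ν y)) ≤
      ε * (2 * (n * C) - 2 * ‖x y‖ ^ 2) := by
  obtain ⟨e, k, hf⟩ := h.exists_frame hy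
  have hu := h.contDiffOn_support
  have hh := h.contDiffOn_normSq
  have hcd : ContDiffOn ℝ ∞ (fun z => s * inner ℝ (x z) (ν z) + (-ε) * ‖x z‖ ^ 2) U :=
    (contDiffOn_const.mul hu).add (contDiffOn_const.mul hh)
  set μ : Fin n → ℝ := fun i => es k (Finset.univ.erase i) r with hμ
  have hμ0 : ∀ i, 0 ≤ μ i := hf.es_nonneg hpsd
  have hμC : ∀ i, μ i ≤ C := hf.es_le hbdd
  have h1 : ∑ i, μ i * fderiv ℝ (fderiv ℝ fun z => s * inner ℝ (x z) (ν z) + (-ε) * ‖x z‖ ^ 2) y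
      (e i) (e i) ≤ 0 := by
    refine Finset.sum_nonpos fun i _ => mul_nonpos_of_nonneg_of_nonpos (hμ0 i) ?_
    exact fderiv_fderiv_nonpos_of_isLocalMax h.isOpen hcd hy hmax _
  have h2 := fderiv_lincomb h.isOpen hu hh hy s (-ε) (drift x y e μ)
  rw [hmax.fderiv_eq_zero, zero_apply] at h2
  have h3 := h.sum_hess_support hy hf hs
  have h4 := h.sum_hess_normSq hy hf (hs y hy)
  have h5 : ∑ i, μ i * fderiv ℝ (fderiv ℝ fun z => s * inner ℝ (x z) (ν z) + (-ε) * ‖x z‖ ^ 2) y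
      (e i) (e i) =
      s * (∑ i, μ i * fderiv ℝ (fderiv ℝ fun z => inner ℝ (x z) (ν z)) y (e i) (e i)) +
      (-ε) * ∑ i, μ i * fderiv ℝ (fderiv ℝ fun z => ‖x z‖ ^ 2) y (e i) (e i) := by
    rw [Finset.mul_sum, Finset.mul_sum, ← Finset.sum_add_distrib]
    refine Finset.sum_congr rfl fun i _ => ?_
    rw [fderiv_fderiv_lincomb h.isOpen hu hh hy]
    ring
  rw [h5, h3, h4] at h1
  have h6 : ∑ i, μ i ≤ n * C := by
    refine (Finset.sum_le_card_nsmul _ _ C fun i _ => hμC i).trans ?_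
    simp
  -- Only an upper bound for `L ‖x‖²` is needed: `tr P_r ≤ n C`, and the term in `⟨x, ν⟩²` has a
  -- favourable sign.
  have h7 : ε * (2 * ∑ i, μ i - 2 * r * inner ℝ (x y) (ν y) ^ 2 - 2 * ‖x y‖ ^ 2) ≤
      ε * (2 * (n * C) - 2 * ‖x y‖ ^ 2) := by
    refine mul_le_mul_of_nonneg_left ?_ hε
    have : 0 ≤ (2 * r * inner ℝ (x y) (ν y) ^ 2 : ℝ) := by positivity
    linarith
  refine le_trans ?_ h7
  linarith

omit h in
theorem _root_.RMeanCurvature.continuousOn_continuousLinearMap_det {Z : Type*} [TopologicalSpace Z]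
    {S : Set Z} {A : Z → (Euc n →L[ℝ] Euc n)} (hA : ContinuousOn A S) :
    ContinuousOn (fun z => (A z).det) S :=
  ContinuousLinearMap.continuous_det.comp_continuousOn hA

theorem continuousOn_shapeMap :
    ContinuousOn (fun z => shapeMap (fderiv ℝ x z) (fderiv ℝ ν z)) U :=
  fun _ hy => (h.contDiffAt_shapeMap hy).continuousAt.continuousWithinAt

/-- Interpolation expresses `σ_j` through finitely many determinants `det (1 + i A)`, so continuity
of the eigenvalues is not involved. -/
theorem continuousOn_sigma (j : ℕ) : ContinuousOn (sigma x ν j) U := by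
  obtain ⟨c, hc⟩ := exists_coeff_eq_sum_eval n j
  have h1 : ∀ y ∈ U, sigma x ν j y = ∑ i ∈ Finset.range (n + 1),
      (1 + (i : ℝ) • shapeMap (fderiv ℝ x y) (fderiv ℝ ν y)).det * c i := by
    intro y hy
    obtain ⟨e, k, hf⟩ := h.exists_frame hy
    rw [hf.sigma_eq, es, hc _ ((natDegree_esPoly_le _ _).trans (by simp))]
    refine Finset.sum_congr rfl fun i _ => ?_
    rw [eval_esPoly, ← hf.det_one_add, shapeOperator_eq_shapeMap, differential_eq_fderiv,
      differential_eq_fderiv]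
    rfl
  refine ContinuousOn.congr ?_ h1
  refine continuousOn_finsetSum _ fun i _ => ContinuousOn.mul ?_ continuousOn_const
  refine continuousOn_continuousLinearMap_det ?_
  have := h.continuousOn_shapeMap
  fun_prop

theorem exists_continuousOn_newton (r : ℕ) : ∃ P : Euc n → (Euc n →L[ℝ] Euc n),
    ContinuousOn P U ∧ ∀ y v, newton x ν r y v = P y v := by
  refine ⟨fun y => ∑ j ∈ Finset.range (r + 1), ((-1 : ℝ) ^ j * sigma x ν (r - j) y) •
    shapeMap (fderiv ℝ x y) (fderiv ℝ ν y) ^ j, ?_, fun y v => ?_⟩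
  · exact continuousOn_finsetSum _ fun j _ =>
      (continuousOn_const.mul (h.continuousOn_sigma _)).smul (h.continuousOn_shapeMap.pow j)
  · rw [newton, LinearMap.sum_apply, sum_apply]
    refine Finset.sum_congr rfl fun j hj => ?_
    clear hj
    rw [LinearMap.smul_apply, shapeOperator_eq_shapeMap, differential_eq_fderiv,
      differential_eq_fderiv, smul_apply]
    congr 1
    induction j generalizing v with
    | zero => rfl
    | succ j ih =>
      rw [pow_succ, pow_succ, Module.End.mul_apply, ih]
      rfl

theorem exists_le_firstForm_newton {K : Set (Euc n)} (hK : IsCompact K) (hKU : K ⊆ U) {r : ℕ}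
    (hpos : ∀ y ∈ K, ∀ v, v ≠ 0 → 0 < firstForm x y (newton x ν r y v) v) :
    ∃ c > 0, ∀ y ∈ K, ∀ v, c * ‖v‖ ^ 2 ≤ firstForm x y (newton x ν r y v) v := by
  obtain ⟨P, hP, hPn⟩ := h.exists_continuousOn_newton r
  have hD : ContinuousOn (fderiv ℝ x) U := fun y hy =>
    (contDiffAt_fderiv h.isOpen h.smooth hy).continuousAt.continuousWithinAt
  set Φ : Euc n × Euc n → ℝ := fun p => firstForm x p.1 (newton x ν r p.1 p.2) p.2 with hΦ
  have hΦeq : ∀ p, Φ p = inner ℝ (fderiv ℝ x p.1 (P p.1 p.2)) (fderiv ℝ x p.1 p.2) := fun p => by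
    rw [hΦ]
    simp only [firstForm, differential_eq_fderiv, hPn]
  have hcont : ContinuousOn Φ (K ×ˢ Metric.sphere 0 1) := by
    have h1 : Set.MapsTo Prod.fst (K ×ˢ Metric.sphere (0 : Euc n) 1) U := fun p hp => hKU hp.1
    have hD' := hD.comp continuousOn_fst h1
    have hP' := hP.comp continuousOn_fst h1
    refine ContinuousOn.congr ?_ fun p _ => hΦeq p
    exact (hD'.clm_apply (hP'.clm_apply continuousOn_snd)).inner (hD'.clm_apply continuousOn_snd)
  -- The product is empty when `K` is, and also when `n = 0`.
  rcases (K ×ˢ Metric.sphere (0 : Euc n) 1).eq_empty_or_nonempty with hem | hne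
  · refine ⟨1, one_pos, fun y hy v => ?_⟩
    by_cases hv : v = 0
    · simp [hv, firstForm]
    · exfalso
      have : (y, ‖v‖⁻¹ • v) ∈ K ×ˢ Metric.sphere (0 : Euc n) 1 :=
        ⟨hy, by simp [norm_smul, hv]⟩
      rw [hem] at this
      exact this
  · obtain ⟨p, hp, hmin⟩ := (hK.prod (isCompact_sphere 0 1)).exists_isMinOn hne hcont
    have hp0 : p.2 ≠ 0 := fun h0 => by
      have := hp.2
      rw [h0] at this
      simp at this
    refine ⟨Φ p, hpos _ hp.1 _ hp0, fun y hy v => ?_⟩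
    by_cases hv : v = 0
    · simp [hv, firstForm]
    · have h1 : Φ p ≤ Φ (y, ‖v‖⁻¹ • v) := hmin ⟨hy, by simp [norm_smul, hv]⟩
      have h2 : Φ (y, ‖v‖⁻¹ • v) = (‖v‖⁻¹) ^ 2 * Φ (y, v) := by
        simp only [hΦ, firstForm, map_smul, real_inner_smul_left, real_inner_smul_right]
        ring
      have hv' : 0 < ‖v‖ := norm_pos_iff.2 hv
      rw [h2] at h1
      calc Φ p * ‖v‖ ^ 2 ≤ (‖v‖⁻¹) ^ 2 * Φ (y, v) * ‖v‖ ^ 2 := by gcongr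
        _ = Φ (y, v) := by field_simp

/-- Uniform ellipticity on compact sets of the operator `tr (P_r Hess ·) - ⟨X, ∇ ·⟩`. -/
theorem exists_uniform_bounds {K : Set (Euc n)} (hK : IsCompact K) (hKU : K ⊆ U) {r : ℕ}
    (hpos : ∀ y ∈ K, ∀ v, v ≠ 0 → 0 < firstForm x y (newton x ν r y v) v) {C : ℝ}
    (hbdd : ∀ y ∈ K, ∀ v, √(firstForm x y (newton x ν r y v) (newton x ν r y v)) ≤
      C * √(firstForm x y v v)) :
    ∃ c > 0, ∃ C' : ℝ, ∀ y ∈ K, ∀ e k, IsPrincipalFrame x ν y e k →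
      (∀ z, c * ‖z‖ ^ 2 ≤ ∑ i, es k (Finset.univ.erase i) r * inner ℝ z (e i) ^ 2) ∧
      ∑ i, es k (Finset.univ.erase i) r * ‖e i‖ ^ 2 ≤ C' ∧
      ‖drift x y e fun i => es k (Finset.univ.erase i) r‖ ≤ C' := by
  have hD : ContinuousOn (fderiv ℝ x) K := fun y hy =>
    (contDiffAt_fderiv h.isOpen h.smooth (hKU hy)).continuousAt.continuousWithinAt
  have hD2 : ContinuousOn (fderiv ℝ (fderiv ℝ x)) K := fun y hy =>
    ((contDiffAt_fderiv h.isOpen h.smooth (hKU hy)).fderiv_right (m := ∞)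
      (by simp)).continuousAt.continuousWithinAt
  have hpinv : ContinuousOn (fun z => pinv (fderiv ℝ x z)) K := fun y hy =>
    (h.contDiffAt_pinv_fderiv (hKU hy)).continuousAt.continuousWithinAt
  obtain ⟨c₀, hc₀, hc₀'⟩ := h.exists_le_firstForm_newton hK hKU hpos
  obtain ⟨d, hd⟩ := hK.exists_bound_of_continuousOn hD
  obtain ⟨d2, hd2⟩ := hK.exists_bound_of_continuousOn
    (E := Euc n →L[ℝ] Euc n →L[ℝ] Euc (n + 1)) hD2
  obtain ⟨b, hb⟩ := hK.exists_bound_of_continuousOn hpinv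
  obtain ⟨a, ha⟩ := hK.exists_bound_of_continuousOn (h.smooth.continuousOn.mono hKU)
  set d' := |d| + 1 with hd'
  have hd'0 : 0 < d' := by positivity
  -- A lower bound for the eigenvalues of `P_r`: `e i` has unit length in the induced metric, so `d'
  -- ‖e i‖ ≥ 1`, and the eigenvalue is the quadratic form of `P_r` at `e i`. The `+ 1` in `d'` keeps
  -- the denominator positive.
  set δ := c₀ / d' ^ 2 with hδ
  have hδ0 : 0 < δ := by positivity
  refine ⟨δ / d' ^ 2, by positivity,
    max (n * (|C| * |b| ^ 2)) (n * (|C| * (|b| * (|d2| * |b| * |b|))) + |b| * |a|), ?_⟩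
  intro y hy e k hf
  have hon := hf.orthonormal_fderiv
  have hbd : ‖fderiv ℝ x y‖ ≤ d' := (hd y hy).trans (by rw [hd']; linarith [le_abs_self d])
  have hb' : ‖pinv (fderiv ℝ x y)‖ ≤ |b| := (hb y hy).trans (le_abs_self b)
  have heb : ∀ i, ‖e i‖ ≤ |b| := fun i => by
    have h1 := (pinv (fderiv ℝ x y)).le_opNorm (fderiv ℝ x y (e i))
    rw [pinv_self (h.injective y (hKU hy)), hon.1 i, mul_one] at h1
    exact h1.trans hb'
  have hde : ∀ i, 1 ≤ d' * ‖e i‖ := fun i => by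
    have h1 := (fderiv ℝ x y).le_opNorm (e i)
    rw [hon.1 i] at h1
    exact h1.trans (by gcongr)
  have hμδ : ∀ i, δ ≤ es k (Finset.univ.erase i) r := fun i => by
    have h1 := hc₀' y hy (e i)
    rw [hf.firstForm_newton] at h1
    refine le_trans ?_ h1
    rw [hδ, div_le_iff₀ (by positivity)]
    have h2 : 1 ≤ (d' * ‖e i‖) ^ 2 := one_le_pow₀ (hde i)
    calc c₀ = c₀ * 1 := (mul_one _).symm
      _ ≤ c₀ * (d' * ‖e i‖) ^ 2 := by gcongr
      _ = _ := by ring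
  have hμ0 : ∀ i, 0 ≤ es k (Finset.univ.erase i) r := fun i => hδ0.le.trans (hμδ i)
  have hμC : ∀ i, es k (Finset.univ.erase i) r ≤ |C| := fun i =>
    (hf.es_le (hbdd y hy) i).trans (le_abs_self C)
  refine ⟨fun z => ?_, ?_, ?_⟩
  · by_cases hz : z = 0
    · simp [hz]
    have hz0 : 0 < ‖z‖ ^ 2 := by positivity
    -- The basis `e` is orthonormal for the induced metric, not for the model. Coercivity follows by
    -- Cauchy–Schwarz, since the coordinates of `z` have square sum at most `‖dx z‖² ≤ d'² ‖z‖²`.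
    have h1 : ‖z‖ ^ 2 = ∑ i, e.repr z i * inner ℝ z (e i) := by
      conv_lhs => rw [← real_inner_self_eq_norm_sq, ← e.sum_repr z, inner_sum]
      simp_rw [real_inner_smul_right]
      rw [e.sum_repr z]
    have hcoord : ∀ i, e.repr z i = inner ℝ (fderiv ℝ x y (e i)) (fderiv ℝ x y z) := by
      intro i
      conv_rhs => rw [← e.sum_repr z, map_sum, inner_sum]
      simp_rw [map_smul, real_inner_smul_right]
      simp_rw [orthonormal_iff_ite.1 hon]
      simp
    have h2 : ∑ i, e.repr z i ^ 2 ≤ d' ^ 2 * ‖z‖ ^ 2 := by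
      have h3 := hon.sum_inner_products_le (fderiv ℝ x y z) (s := Finset.univ)
      simp_rw [← hcoord, Real.norm_eq_abs, sq_abs] at h3
      refine h3.trans ?_
      rw [← mul_pow]
      have h4 := (fderiv ℝ x y).le_opNorm z
      gcongr
      exact h4.trans (by gcongr)
    have h3 := Finset.sum_mul_sq_le_sq_mul_sq Finset.univ (fun i => e.repr z i)
      (fun i => inner ℝ z (e i))
    rw [← h1] at h3
    set S := ∑ i, (inner ℝ z (e i)) ^ 2 with hS
    have hS0 : 0 ≤ S := Finset.sum_nonneg fun i _ => sq_nonneg _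
    have h4 : ‖z‖ ^ 2 ≤ d' ^ 2 * S := by
      have h5 : ‖z‖ ^ 2 * ‖z‖ ^ 2 ≤ ‖z‖ ^ 2 * (d' ^ 2 * S) := by
        calc ‖z‖ ^ 2 * ‖z‖ ^ 2 = (‖z‖ ^ 2) ^ 2 := by ring
          _ ≤ _ := h3
          _ ≤ d' ^ 2 * ‖z‖ ^ 2 * S := by gcongr
          _ = _ := by ring
      exact le_of_mul_le_mul_left h5 hz0
    have h5 : δ * S ≤ ∑ i, es k (Finset.univ.erase i) r * inner ℝ z (e i) ^ 2 := by
      rw [hS, Finset.mul_sum]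
      exact Finset.sum_le_sum fun i _ => by gcongr; exact hμδ i
    refine le_trans ?_ h5
    rw [div_mul_eq_mul_div, div_le_iff₀ (by positivity)]
    calc δ * ‖z‖ ^ 2 ≤ δ * (d' ^ 2 * S) := by gcongr
      _ = _ := by ring
  · refine le_trans ?_ (le_max_left _ _)
    refine (Finset.sum_le_card_nsmul _ _ (|C| * |b| ^ 2) fun i _ => ?_).trans (by simp)
    exact mul_le_mul (hμC i) (by gcongr; exact heb i) (by positivity) (by positivity)
  · refine le_trans ?_ (le_max_right _ _)
    refine (norm_add_le _ _).trans (add_le_add ?_ ?_)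
    · refine (norm_sum_le _ _).trans ?_
      refine (Finset.sum_le_card_nsmul _ _ (|C| * (|b| * (|d2| * |b| * |b|))) fun i _ => ?_).trans
        (by simp)
      rw [norm_smul, Real.norm_of_nonneg (hμ0 i)]
      refine mul_le_mul (hμC i) ?_ (norm_nonneg _) (abs_nonneg _)
      refine ((pinv (fderiv ℝ x y)).le_opNorm _).trans ?_
      refine mul_le_mul hb' ?_ (norm_nonneg _) (abs_nonneg _)
      refine ((fderiv ℝ (fderiv ℝ x) y).le_opNorm₂ _ _).trans ?_
      have hd2' := (hd2 y hy).trans (le_abs_self d2)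
      have := heb i
      gcongr
    · refine ((pinv (fderiv ℝ x y)).le_opNorm _).trans ?_
      exact mul_le_mul hb' ((ha y hy).trans (le_abs_self a)) (norm_nonneg _) (abs_nonneg _)

/-- The strong maximum principle for the support function. -/
theorem support_eq_of_isMax {y₀ : Euc n} (hy₀ : y₀ ∈ U) {r : ℕ} {C s m : ℝ} (hm : 0 < m)
    (hs : ∀ z ∈ U, sigma x ν (r + 1) z = -inner ℝ (x z) (ν z))
    (hpos : ∀ y ∈ U, ∀ v, v ≠ 0 → 0 < firstForm x y (newton x ν r y v) v)
    (hbdd : ∀ y ∈ U, ∀ v, √(firstForm x y (newton x ν r y v) (newton x ν r y v)) ≤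
      C * √(firstForm x y v v))
    (hT : ∀ y ∈ U, modifiedNormSq x ν r y ≤ r + 1)
    (hle : ∀ y ∈ U, s * inner ℝ (x y) (ν y) ≤ m) (h0 : s * inner ℝ (x y₀) (ν y₀) = m) :
    ∀ᶠ y in nhds y₀, s * inner ℝ (x y) (ν y) = m := by
  obtain ⟨R, hR, hRU⟩ := Metric.nhds_basis_closedBall.mem_iff.1 (h.isOpen.mem_nhds hy₀)
  have hRU' : Metric.ball y₀ R ⊆ U := Metric.ball_subset_closedBall.trans hRU
  obtain ⟨c, hc, C', hbounds⟩ := h.exists_uniform_bounds (isCompact_closedBall y₀ R) hRU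
    (fun y hy => hpos y (hRU hy)) (fun y hy => hbdd y (hRU hy))
  have hu := h.contDiffOn_support
  have key := eq_of_subsolution_of_isMax (ι := Fin n) (y₀ := y₀) (R := R)
    (f := fun y => s * inner ℝ (x y) (ν y)) (C := C') hm hc
    ((continuousOn_const.mul hu.continuousOn).mono hRU') (fun y hy => hle y (hRU' hy)) h0 (by
      intro y hy hfy w hw hmax
      have hyU := hRU' hy
      obtain ⟨e, k, hf⟩ := h.exists_frame hyU
      obtain ⟨hb1, hb2, hb3⟩ := hbounds y (Metric.ball_subset_closedBall hy) e k hf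
      refine ⟨fun i => es k (Finset.univ.erase i) r, e, _, ?_, hb1, hb2, hb3⟩
      have hcd : ContDiffOn ℝ ∞ (fun z => s * inner ℝ (x z) (ν z) + 1 * w z) U :=
        (contDiffOn_const.mul hu).add (contDiffOn_const.mul hw.contDiffOn)
      have hmax' : IsLocalMax (fun z => s * inner ℝ (x z) (ν z) + 1 * w z) y := by
        simpa only [one_mul] using hmax
      have h1 : ∑ i, es k (Finset.univ.erase i) r *
          fderiv ℝ (fderiv ℝ fun z => s * inner ℝ (x z) (ν z) + 1 * w z) y (e i) (e i) ≤ 0 :=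
        Finset.sum_nonpos fun i _ => mul_nonpos_of_nonneg_of_nonpos
          (hf.es_pos (hpos y hyU) i).le
          (fderiv_fderiv_nonpos_of_isLocalMax h.isOpen hcd hyU hmax' _)
      have h2 := fderiv_lincomb h.isOpen hu hw.contDiffOn hyU s 1
        (drift x y e fun i => es k (Finset.univ.erase i) r)
      rw [hmax'.fderiv_eq_zero, zero_apply] at h2
      have h3 := h.sum_hess_support hyU hf hs
      have h5 : ∑ i, es k (Finset.univ.erase i) r *
          fderiv ℝ (fderiv ℝ fun z => s * inner ℝ (x z) (ν z) + 1 * w z) y (e i) (e i) =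
          s * (∑ i, es k (Finset.univ.erase i) r *
            fderiv ℝ (fderiv ℝ fun z => inner ℝ (x z) (ν z)) y (e i) (e i)) +
          ∑ i, es k (Finset.univ.erase i) r * fderiv ℝ (fderiv ℝ w) y (e i) (e i) := by
        rw [Finset.mul_sum, ← Finset.sum_add_distrib]
        refine Finset.sum_congr rfl fun i _ => ?_
        rw [fderiv_fderiv_lincomb h.isOpen hu hw.contDiffOn hyU]
        ring
      rw [h5, h3] at h1
      -- Where `s u > 0` the zeroth order term is nonnegative, so `s u` is a subsolution of the
      -- operator without it.
      have h6 : 0 ≤ ((r + 1 : ℝ) - modifiedNormSq x ν r y) * (s * inner ℝ (x y) (ν y)) :=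
        mul_nonneg (sub_nonneg.2 (hT y hyU)) hfy.le
      linarith)
  filter_upwards [Metric.ball_mem_nhds y₀ (by linarith : 0 < R / 4)] with y hy
  exact key y hy

end IsPatch

/-! ### Extrema and constancy of the support function. -/

section GlobalMaximum

open Topology

variable {n : ℕ} {M : Type*} [TopologicalSpace M] [ChartedSpace (Euc n) M] [IsManifold (𝓡 n) ∞ M]
  {X N : M → Euc (n + 1)}

namespace IsReparam

variable {M' : Type*} [TopologicalSpace M'] [ChartedSpace (Euc n) M'] {q : M}
  {x ν : M' → Euc (n + 1)} {y : M'} {T : Euc n ≃L[ℝ] Euc n} (h : IsReparam X N q x ν y T)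
include h

omit [IsManifold (𝓡 n) ∞ M] in
theorem firstForm_newton_nonneg {r : ℕ} (hP : NewtonPosSemidef X N r) (v : Euc n) :
    0 ≤ firstForm x y (newton x ν r y v) v := by
  rw [h.firstForm_eq, h.newton_apply]
  exact hP _ _

omit [IsManifold (𝓡 n) ∞ M] in
theorem firstForm_newton_pos {r : ℕ} (hP : NewtonPosDef X N r) (v : Euc n) (hv : v ≠ 0) :
    0 < firstForm x y (newton x ν r y v) v := by
  rw [h.firstForm_eq, h.newton_apply]
  exact hP _ _ (by simpa using hv)

omit [IsManifold (𝓡 n) ∞ M] in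
theorem norm_newton_le {r : ℕ} {C : ℝ}
    (hP : ∀ p v, √(firstForm X p (newton X N r p v) (newton X N r p v)) ≤ C * √(firstForm X p v v))
    (v : Euc n) :
    √(firstForm x y (newton x ν r y v) (newton x ν r y v)) ≤ C * √(firstForm x y v v) := by
  rw [h.firstForm_eq, h.firstForm_eq, h.newton_apply]
  exact hP _ _

end IsReparam

theorem IsSelfShrinker.sigma_chart {r : ℕ} (hs : IsSelfShrinker X N r) (hX : IsSmoothImmersion X)
    (hN : IsUnitNormal X N) (p : M) : ∀ y ∈ (extChartAt (𝓡 n) p).target,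
      sigma (X ∘ (extChartAt (𝓡 n) p).symm) (N ∘ (extChartAt (𝓡 n) p).symm) r y =
        -inner ℝ ((X ∘ (extChartAt (𝓡 n) p).symm) y) ((N ∘ (extChartAt (𝓡 n) p).symm) y) := by
  intro y hy
  obtain ⟨T, hT⟩ := hX.exists_isReparam hN p hy
  rw [hT.sigma_eq]
  exact hs _

omit [IsManifold (𝓡 n) ∞ M] in
theorem isLocalMax_comp_chart {f : M → ℝ} {q : M} (h : IsLocalMax f q) :
    IsLocalMax (f ∘ (extChartAt (𝓡 n) q).symm) (extChartAt (𝓡 n) q q) := by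
  have h1 := (continuousAt_extChartAt_symm (I := 𝓡 n) q).tendsto
  rw [extChartAt_to_inv] at h1
  have h2 := h1.eventually h
  simpa [IsLocalMax, IsMaxFilter] using h2

theorem support_le_of_isLocalMax_manifold {r : ℕ} (hX : IsSmoothImmersion X) (hN : IsUnitNormal X N)
    (hs : IsSelfShrinker X N (r + 1)) (hpsd : NewtonPosSemidef X N r) {C : ℝ}
    (hbdd : ∀ p v, √(firstForm X p (newton X N r p v) (newton X N r p v)) ≤
      C * √(firstForm X p v v)) {s ε : ℝ} (hε : 0 ≤ ε) {q : M}
    (hmax : IsLocalMax (fun p => s * inner ℝ (X p) (N p) + (-ε) * ‖X p‖ ^ 2) q) :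
    ((r + 1 : ℝ) - modifiedNormSq X N r q) * (s * inner ℝ (X q) (N q)) ≤
      ε * (2 * (n * C) - 2 * ‖X q‖ ^ 2) := by
  have hy := mem_extChartAt_target (I := 𝓡 n) q
  obtain ⟨T, hT⟩ := hX.exists_isReparam hN q hy
  have h := (hX.isPatch_chart hN q).support_le_of_isLocalMax (C := C) (s := s) (r := r) hy hε
    (hs.sigma_chart hX hN q) (hT.firstForm_newton_nonneg hpsd) (hT.norm_newton_le hbdd)
    (isLocalMax_comp_chart hmax)
  rw [hT.modifiedNormSq_eq] at h
  simpa only [Function.comp, extChartAt_to_inv] using h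

omit [IsManifold (𝓡 n) ∞ M] in
theorem continuous_support (hX : IsSmoothImmersion X) (hN : IsUnitNormal X N) :
    Continuous (fun p => inner ℝ (X p) (N p) : M → ℝ) :=
  hX.smooth.continuous.inner hN.continuous

omit [IsManifold (𝓡 n) ∞ M] in
theorem support_le_norm (hN : IsUnitNormal X N) {s : ℝ} (hs : |s| ≤ 1) (p : M) :
    s * inner ℝ (X p) (N p) ≤ ‖X p‖ := by
  have h1 := abs_real_inner_le_norm (X p) (N p)
  rw [hN.norm_eq_one, mul_one] at h1
  calc s * inner ℝ (X p) (N p) ≤ |s * inner ℝ (X p) (N p)| := le_abs_self _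
    _ = |s| * |inner ℝ (X p) (N p)| := abs_mul _ _
    _ ≤ 1 * ‖X p‖ := by gcongr
    _ = ‖X p‖ := one_mul _

-- The support function grows at most like `‖X‖`, so the quadratic term wins as `‖X‖ → ∞`, and
-- properness makes sublevel sets of `‖X‖` compact.
omit [IsManifold (𝓡 n) ∞ M] in
theorem exists_isMax_perturbed_support (hX : IsSmoothImmersion X) (hproper : IsProperMap X)
    (hN : IsUnitNormal X N) {s ε : ℝ} (hs : |s| ≤ 1) (hε : 0 < ε) (p₀ : M) :
    ∃ q, ∀ p, s * inner ℝ (X p) (N p) + (-ε) * ‖X p‖ ^ 2 ≤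
      s * inner ℝ (X q) (N q) + (-ε) * ‖X q‖ ^ 2 := by
  refine Continuous.exists_forall_ge' ((continuous_const.mul (continuous_support hX hN)).add
    (continuous_const.mul (hX.smooth.continuous.norm.pow 2))) p₀ ?_
  set a := s * inner ℝ (X p₀) (N p₀) + (-ε) * ‖X p₀‖ ^ 2 with ha
  -- Outside this ball `ε ‖X‖ ≥ 1 + |a|` and `‖X‖ ≥ 1`, hence `‖X‖ - ε ‖X‖² ≤ -|a| ≤ a`.
  have hK := hproper.isCompact_preimage
    (isCompact_closedBall (0 : Euc (n + 1)) (max 1 ((1 + |a|) / ε)))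
  filter_upwards [hK.compl_mem_cocompact] with p hp
  rw [Set.mem_compl_iff, Set.mem_preimage, mem_closedBall_zero_iff, not_le, max_lt_iff,
    div_lt_iff₀ hε] at hp
  have h1 := support_le_norm hN hs p
  have h2 := neg_abs_le a
  have h3 : ‖X p‖ * 1 ≤ ‖X p‖ * (‖X p‖ * ε - |a|) := by
    gcongr
    linarith
  have h4 : |a| * 1 ≤ |a| * ‖X p‖ := by
    gcongr
    exact hp.1.le
  nlinarith

/-- The support function of a self-shrinker attains its extrema. -/
theorem exists_isMax_support {r : ℕ} (hX : IsSmoothImmersion X) (hproper : IsProperMap X)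
    (hN : IsUnitNormal X N) (hshr : IsSelfShrinker X N (r + 1)) (hpsd : NewtonPosSemidef X N r)
    (hbdd : NewtonBounded X N r) (hle : ∀ p, modifiedNormSq X N r p ≤ r + 1)
    {s : ℝ} (hs : |s| ≤ 1) {p₀ : M} (hp₀ : 0 < s * inner ℝ (X p₀) (N p₀)) :
    ∃ q, ∀ p, s * inner ℝ (X p) (N p) ≤ s * inner ℝ (X q) (N q) := by
  obtain ⟨C, hC⟩ := hbdd
  -- For `ε ≤ ε₀` the perturbed function is still positive at `p₀`. Thus `s u` is positive at the
  -- perturbed maximum, as needed to read off `‖X q‖² ≤ n C` there.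
  set ε₀ := s * inner ℝ (X p₀) (N p₀) / (‖X p₀‖ ^ 2 + 1) with hε₀
  have hε₀0 : 0 < ε₀ := by positivity
  set K : Set M := X ⁻¹' Metric.closedBall 0 (√(n * C)) with hK
  have key : ∀ ε, 0 < ε → ε ≤ ε₀ → ∃ q ∈ K, ∀ p,
      s * inner ℝ (X p) (N p) + (-ε) * ‖X p‖ ^ 2 ≤ s * inner ℝ (X q) (N q) := by
    intro ε hε hεε₀
    obtain ⟨q, hq⟩ := exists_isMax_perturbed_support hX hproper hN hs hε p₀
    have hmax : IsLocalMax (fun p => s * inner ℝ (X p) (N p) + (-ε) * ‖X p‖ ^ 2) q :=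
      Filter.Eventually.of_forall hq
    have h1 := support_le_of_isLocalMax_manifold hX hN hshr hpsd hC hε.le hmax
    have h2 : 0 < s * inner ℝ (X p₀) (N p₀) + (-ε) * ‖X p₀‖ ^ 2 := by
      have h3 : ε₀ * (‖X p₀‖ ^ 2 + 1) = s * inner ℝ (X p₀) (N p₀) := by
        rw [hε₀]; field_simp
      have h4 : ε * ‖X p₀‖ ^ 2 ≤ ε₀ * ‖X p₀‖ ^ 2 := by gcongr
      linarith
    have h3 : 0 ≤ ε * ‖X q‖ ^ 2 := by positivity
    have h4 : 0 < s * inner ℝ (X q) (N q) := by linarith [hq p₀]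
    have h5 : 0 ≤ ε * (2 * (n * C) - 2 * ‖X q‖ ^ 2) :=
      (mul_nonneg (sub_nonneg.2 (hle q)) h4.le).trans h1
    have h6 : 0 ≤ 2 * (n * C) - 2 * ‖X q‖ ^ 2 := nonneg_of_mul_nonneg_right h5 hε
    refine ⟨q, ?_, fun p => by linarith [hq p]⟩
    rw [hK, Set.mem_preimage, mem_closedBall_zero_iff]
    exact Real.le_sqrt_of_sq_le (by linarith)
  obtain ⟨q₁, hq₁, -⟩ := key ε₀ hε₀0 le_rfl
  have hKc : IsCompact K := hproper.isCompact_preimage (isCompact_closedBall _ _)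
  obtain ⟨q, -, hqmax⟩ := hKc.exists_isMaxOn ⟨q₁, hq₁⟩
    (continuous_const.mul (continuous_support hX hN) :
      Continuous fun p => s * inner ℝ (X p) (N p)).continuousOn
  -- The compact set `K` does not depend on `ε`. The maximum over `K` therefore dominates every
  -- perturbed maximum, and `ε ‖X p‖²` can be made smaller than any `δ`.
  refine ⟨q, fun p => le_of_forall_pos_le_add fun δ hδ => ?_⟩
  obtain ⟨q', hq', h1⟩ := key (min ε₀ (δ / (‖X p‖ ^ 2 + 1))) (lt_min hε₀0 (by positivity))
    (min_le_left _ _)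
  have h2 : s * inner ℝ (X q') (N q') ≤ s * inner ℝ (X q) (N q) := hqmax hq'
  have h3 : min ε₀ (δ / (‖X p‖ ^ 2 + 1)) * ‖X p‖ ^ 2 ≤ δ := by
    calc min ε₀ (δ / (‖X p‖ ^ 2 + 1)) * ‖X p‖ ^ 2 ≤ δ / (‖X p‖ ^ 2 + 1) * (‖X p‖ ^ 2 + 1) := by
          gcongr
          · exact min_le_right _ _
          · linarith
      _ = δ := by field_simp
  linarith [h1 p]

/-- Strict inequality forces the support function to vanish. -/
theorem support_eq_zero_of_lt {r : ℕ} (hX : IsSmoothImmersion X) (hproper : IsProperMap X)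
    (hN : IsUnitNormal X N) (hshr : IsSelfShrinker X N (r + 1)) (hpsd : NewtonPosSemidef X N r)
    (hbdd : NewtonBounded X N r) (hlt : ∀ p, modifiedNormSq X N r p < r + 1) (p : M) :
    inner ℝ (X p) (N p) = (0 : ℝ) := by
  have key : ∀ s : ℝ, |s| ≤ 1 → s * inner ℝ (X p) (N p) ≤ 0 := by
    intro s hs
    by_contra! hp
    obtain ⟨q, hq⟩ := exists_isMax_support hX hproper hN hshr hpsd hbdd (fun p => (hlt p).le) hs hp
    obtain ⟨C, hC⟩ := hbdd
    -- The case `ε = 0`: a positive maximum of `s u` makes the left side of the inequality positive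
    -- and the right side zero.
    have hmax : IsLocalMax (fun p => s * inner ℝ (X p) (N p) + (-0) * ‖X p‖ ^ 2) q :=
      Filter.Eventually.of_forall fun p => by simpa using hq p
    have h1 := support_le_of_isLocalMax_manifold hX hN hshr hpsd hC le_rfl hmax
    rw [zero_mul] at h1
    exact absurd h1 (not_le.2 (mul_pos (sub_pos.2 (hlt q)) (hp.trans_le (hq p))))
  have h1 := key 1 (by simp)
  have h2 := key (-1) (by simp)
  linarith

/-- When `P_r` is positive definite, the support function is constant. -/
theorem exists_support_eq [ConnectedSpace M] {r : ℕ} (hX : IsSmoothImmersion X)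
    (hproper : IsProperMap X) (hN : IsUnitNormal X N) (hshr : IsSelfShrinker X N (r + 1))
    (hpsd : NewtonPosSemidef X N r) (hbdd : NewtonBounded X N r)
    (hle : ∀ p, modifiedNormSq X N r p ≤ r + 1) (hpos : NewtonPosDef X N r) :
    ∃ a : ℝ, ∀ p, inner ℝ (X p) (N p) = a := by
  have key : ∀ s : ℝ, |s| ≤ 1 → ∀ p₀ : M, 0 < s * inner ℝ (X p₀) (N p₀) →
      ∃ a : ℝ, ∀ p, s * inner ℝ (X p) (N p) = a := by
    intro s hs p₀ hp₀
    obtain ⟨q, hq⟩ := exists_isMax_support hX hproper hN hshr hpsd hbdd hle hs hp₀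
    obtain ⟨C, hC⟩ := hbdd
    set m := s * inner ℝ (X q) (N q) with hm
    have hm0 : 0 < m := hp₀.trans_le (hq p₀)
    refine ⟨m, ?_⟩
    set S : Set M := {p | s * inner ℝ (X p) (N p) = m} with hS
    have hclosed : IsClosed S :=
      isClosed_eq (continuous_const.mul (continuous_support hX hN)) continuous_const
    -- Hopf's principle applies at each point of the maximum set, in the chart at that point.
    have hopen : IsOpen S := by
      rw [isOpen_iff_mem_nhds]
      intro p hp
      have hy := mem_extChartAt_target (I := 𝓡 n) p
      have hre := fun y hy => hX.exists_isReparam hN p (y := y) hy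
      have h1 := (hX.isPatch_chart hN p).support_eq_of_isMax (r := r) (C := C) (s := s) hy hm0
        (hshr.sigma_chart hX hN p)
        (fun y hy => (hre y hy).choose_spec.firstForm_newton_pos hpos)
        (fun y hy => (hre y hy).choose_spec.norm_newton_le hC)
        (fun y hy => by
          rw [(hre y hy).choose_spec.modifiedNormSq_eq]
          exact hle _)
        (fun y _ => hq _) (by
          have hp' : s * inner ℝ (X p) (N p) = m := hp
          simpa only [Function.comp, extChartAt_to_inv] using hp')
      have h2 := (continuousAt_extChartAt (I := 𝓡 n) p).eventually h1
      filter_upwards [h2, extChartAt_source_mem_nhds (I := 𝓡 n) p] with z hz hzs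
      change s * inner ℝ (X z) (N z) = m
      simpa only [Function.comp, (extChartAt (𝓡 n) p).left_inv hzs] using hz
    have huniv : S = Set.univ := IsClopen.eq_univ ⟨hclosed, hopen⟩ ⟨q, rfl⟩
    intro p
    have : p ∈ S := huniv ▸ Set.mem_univ p
    exact this
  by_cases h : ∃ p₀, inner ℝ (X p₀) (N p₀) ≠ (0 : ℝ)
  · obtain ⟨p₀, hp₀⟩ := h
    rcases lt_or_gt_of_ne hp₀ with h0 | h0
    · obtain ⟨a, ha⟩ := key (-1) (by simp) p₀ (by linarith)
      exact ⟨-a, fun p => by linarith [ha p]⟩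
    · obtain ⟨a, ha⟩ := key 1 (by simp) p₀ (by linarith)
      exact ⟨a, fun p => by linarith [ha p]⟩
  · push Not at h
    exact ⟨0, h⟩

end GlobalMaximum

/-! ### Constant support function: the ruling by rays and their focal points. -/

section Rays

open Topology Asymptotics

namespace IsPatch

variable {n : ℕ} {U : Set (Euc n)} {x ν : Euc n → Euc (n + 1)} (h : IsPatch U x ν)
include h

theorem inner_fderiv_normal_of_support_eq {c : ℝ} (hc : ∀ y ∈ U, inner ℝ (x y) (ν y) = -c)
    {y : Euc n} (hy : y ∈ U) (v : Euc n) : inner ℝ (x y) (fderiv ℝ ν y v) = 0 := by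
  rw [← h.fderiv_support hy]
  have h1 : (fun z => inner ℝ (x z) (ν z) : Euc n → ℝ) =ᶠ[𝓝 y] fun _ => -c := by
    filter_upwards [h.isOpen.mem_nhds hy] with z hz using hc z hz
  rw [h1.fderiv_eq]
  simp

/-- Since `⟨x, dν v⟩ = 0` for every `v`, symmetry of the second fundamental form shows that `A`
annihilates the tangential part of `x`. -/
theorem fderiv_normal_tangentialPart {c : ℝ} (hc : ∀ y ∈ U, inner ℝ (x y) (ν y) = -c)
    {y : Euc n} (hy : y ∈ U) : fderiv ℝ ν y (pinv (fderiv ℝ x y) (x y)) = 0 := by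
  have hG := h.isGaussPair hy
  refine eq_zero_of_inner_eq_zero hG.injective hG.norm_eq_one hG.orthogonal ?_ fun v => ?_
  · rw [real_inner_comm]
    exact hG.orthogonal' _
  · rw [real_inner_comm, hG.symm, apply_pinv hG.injective hG.norm_eq_one hG.orthogonal,
      inner_sub_right, real_inner_smul_right, hG.orthogonal', mul_zero, sub_zero, real_inner_comm]
    exact h.inner_fderiv_normal_of_support_eq hc hy v

theorem apply_tangentialPart {c : ℝ} (hc : ∀ y ∈ U, inner ℝ (x y) (ν y) = -c)
    {y : Euc n} (hy : y ∈ U) :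
    fderiv ℝ x y (pinv (fderiv ℝ x y) (x y)) = x y + c • ν y := by
  have hG := h.isGaussPair hy
  rw [apply_pinv hG.injective hG.norm_eq_one hG.orthogonal, real_inner_comm, hc y hy, neg_smul,
    sub_neg_eq_add]

/-- The integral curves of the tangential part of the position vector. -/
theorem exists_local_ray {c : ℝ} (hc : ∀ y ∈ U, inner ℝ (x y) (ν y) = -c)
    {y : Euc n} (hy : y ∈ U) : ∃ ε > 0, ∀ t ∈ Set.Ioo (-ε) ε, ∃ z ∈ U, ν z = ν y ∧
      x z = -(c • ν y) + Real.exp t • (x y + c • ν y) := by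
  have hV : ContDiffAt ℝ ∞ (fun z => pinv (fderiv ℝ x z) (x z)) y :=
    (h.contDiffAt_pinv_fderiv hy).clm_apply (h.smooth.contDiffAt (h.isOpen.mem_nhds hy))
  obtain ⟨α, hα0, ε, hε, hα⟩ :=
    (hV.of_le (by simp)).exists_forall_mem_closedBall_exists_eq_forall_mem_Ioo_hasDerivAt₀ 0
  simp only [zero_sub, zero_add] at hα
  have hαc : ContinuousAt α 0 := (hα 0 (by simp [hε])).continuousAt
  have hmem : ∀ᶠ t in 𝓝 (0 : ℝ), α t ∈ U :=
    hαc.eventually_mem (h.isOpen.mem_nhds (by rw [hα0]; exact hy))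
  obtain ⟨ε', hε', hball⟩ := Metric.eventually_nhds_iff_ball.1 hmem
  set δ := min ε ε' with hδ
  have hδ0 : 0 < δ := lt_min hε hε'
  have hI : ∀ t ∈ Set.Ioo (-δ) δ, α t ∈ U ∧
      HasDerivAt α (pinv (fderiv ℝ x (α t)) (x (α t))) t := by
    intro t ht
    refine ⟨hball t ?_, hα t ⟨?_, ht.2.trans_le (min_le_left _ _)⟩⟩
    · rw [mem_ball_zero_iff, Real.norm_eq_abs, abs_lt]
      exact ⟨by linarith [ht.1, min_le_right ε ε'], ht.2.trans_le (min_le_right _ _)⟩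
    · linarith [ht.1, min_le_left ε ε']
  have h0I : (0 : ℝ) ∈ Set.Ioo (-δ) δ := by simp [hδ0]
  have hν' : ∀ t ∈ Set.Ioo (-δ) δ, HasDerivAt (fun t => ν (α t)) 0 t := by
    intro t ht
    have h1 := (hasFDerivAt_of_contDiffOn h.isOpen h.smooth_normal (hI t ht).1).comp_hasDerivAt t
      (hI t ht).2
    rwa [h.fderiv_normal_tangentialPart hc (hI t ht).1] at h1
  have hνc : ∀ t ∈ Set.Ioo (-δ) δ, ν (α t) = ν y := by
    intro t ht
    have := isOpen_Ioo.is_const_of_deriv_eq_zero isPreconnected_Ioo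
      (fun s hs => (hν' s hs).differentiableAt.differentiableWithinAt)
      (fun s hs => (hν' s hs).deriv) ht h0I
    rwa [hα0] at this
  -- Along the curve `ν` is constant and `x + c ν` is its own derivative, so `exp (-t) (x + c ν)` is
  -- constant.
  have hx' : ∀ t ∈ Set.Ioo (-δ) δ,
      HasDerivAt (fun t => Real.exp (-t) • (x (α t) + c • ν (α t))) 0 t := by
    intro t ht
    have h1 := (hasFDerivAt_of_contDiffOn h.isOpen h.smooth (hI t ht).1).comp_hasDerivAt t
      (hI t ht).2
    rw [h.apply_tangentialPart hc (hI t ht).1] at h1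
    have h2 := (hasDerivAt_neg t).exp.smul (h1.add ((hν' t ht).const_smul c))
    convert! h2 using 1
    simp only [Pi.add_apply, Function.comp, Pi.smul_apply, smul_zero]
    module
  refine ⟨δ, hδ0, fun t ht => ⟨α t, (hI t ht).1, hνc t ht, ?_⟩⟩
  have h1 := isOpen_Ioo.is_const_of_deriv_eq_zero isPreconnected_Ioo
    (fun s hs => (hx' s hs).differentiableAt.differentiableWithinAt)
    (fun s hs => (hx' s hs).deriv) ht h0I
  simp only [neg_zero, Real.exp_zero, one_smul, hα0, hνc t ht] at h1
  rw [← h1, smul_smul, ← Real.exp_add, add_neg_cancel, Real.exp_zero, one_smul]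
  abel

/-- An immersion controls the displacement of the parameter by the displacement of `x`, and `ν` is
differentiable in the parameter. -/
theorem normal_isBigO {y : Euc n} (hy : y ∈ U) :
    (fun z => ν z - ν y) =O[𝓝 y] fun z => x z - x y := by
  have hx := hasFDerivAt_of_contDiffOn h.isOpen h.smooth hy
  have hind : IsInducing (fderiv ℝ x y) := (LinearMap.isClosedEmbedding_of_injective
    (f := (fderiv ℝ x y).toLinearMap) (LinearMap.ker_eq_bot.2 (h.injective y hy))).isInducing
  exact (hasFDerivAt_of_contDiffOn h.isOpen h.smooth_normal hy).isBigO_sub.trans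
    (hx.isTheta_sub hind).2

end IsPatch

variable {n : ℕ} {M : Type*} [TopologicalSpace M] [ChartedSpace (Euc n) M] [IsManifold (𝓡 n) ∞ M]
  {X N : M → Euc (n + 1)}

theorem IsSmoothImmersion.normal_isBigO (hX : IsSmoothImmersion X) (hN : IsUnitNormal X N) (q : M) :
    (fun p => N p - N q) =O[𝓝 q] fun p => X p - X q := by
  have h1 := (hX.isPatch_chart hN q).normal_isBigO (mem_extChartAt_target q)
  have h2 := h1.comp_tendsto (continuousAt_extChartAt (I := 𝓡 n) q).tendsto
  have hev : ∀ F : M → Euc (n + 1), (fun p => F p - F q) =ᶠ[𝓝 q]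
      ((fun z => (F ∘ (extChartAt (𝓡 n) q).symm) z -
        (F ∘ (extChartAt (𝓡 n) q).symm) (extChartAt (𝓡 n) q q)) ∘ extChartAt (𝓡 n) q) := by
    intro F
    filter_upwards [extChartAt_source_mem_nhds (I := 𝓡 n) q] with p hp
    simp only [Function.comp, extChartAt_to_inv, (extChartAt (𝓡 n) q).left_inv hp]
  exact h2.congr' (hev N).symm (hev X).symm

/-- A hypersurface with constant support function is ruled by rays on which the normal is
constant. -/
theorem exists_ray_point (hX : IsSmoothImmersion X) (hproper : IsProperMap X)
    (hN : IsUnitNormal X N) {c : ℝ} (hc : ∀ p, inner ℝ (X p) (N p) = -c) (p : M) {s : ℝ}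
    (hs : 0 ≤ s) : ∃ q, N q = N p ∧ X q = -(c • N p) + s • (X p + c • N p) := by
  set S : Set ℝ := {s | ∃ q, N q = N p ∧ X q = -(c • N p) + s • (X p + c • N p)} with hS
  have hclosed : IsClosed S := by
    have h1 : IsClosed (X '' {q | N q = N p}) :=
      hproper.isClosedMap _ (isClosed_eq hN.continuous continuous_const)
    have h2 : S = (fun s : ℝ => -(c • N p) + s • (X p + c • N p)) ⁻¹' (X '' {q | N q = N p}) := by
      ext s
      simp [hS]
    rw [h2]
    exact h1.preimage (by fun_prop)
  -- The local ray starting at `q`, followed for time `log (s' / s)`, reaches the parameter `s'`.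
  have hopen : ∀ s ∈ S, 0 < s → S ∈ 𝓝 s := by
    rintro s ⟨q, hq1, hq2⟩ hs0
    have hpatch := hX.isPatch_chart hN q
    obtain ⟨ε, hε, hray⟩ := hpatch.exists_local_ray (c := c) (fun y _ => hc _)
      (mem_extChartAt_target q)
    have h1 : Filter.Tendsto (fun s' => Real.log (s' / s)) (𝓝 s) (𝓝 0) := by
      have : ContinuousAt (fun s' => Real.log (s' / s)) s :=
        (continuousAt_id.div_const s).log (by simp [hs0.ne'])
      simpa [ContinuousAt, hs0.ne'] using this
    filter_upwards [h1.eventually (Ioo_mem_nhds (neg_lt_zero.2 hε) hε), lt_mem_nhds hs0]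
      with s' hs' hs'0
    obtain ⟨z, -, hz1, hz2⟩ := hray _ hs'
    simp only [Function.comp, extChartAt_to_inv] at hz1 hz2
    refine ⟨_, hz1.trans hq1, ?_⟩
    rw [hz2, hq1, hq2, Real.exp_log (div_pos hs'0 hs0), neg_add_cancel_comm, smul_smul,
      div_mul_cancel₀ _ hs0.ne']
  have h1S : (1 : ℝ) ∈ S := ⟨p, rfl, by rw [one_smul]; abel⟩
  have hsub : Set.Ioi (0 : ℝ) ⊆ interior S := by
    refine isPreconnected_Ioi.subset_of_closure_inter_subset isOpen_interior
      ⟨1, by simp, mem_interior_iff_mem_nhds.2 (hopen 1 h1S one_pos)⟩ ?_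
    rintro s ⟨hs1, hs2⟩
    have : s ∈ S := by
      rw [← hclosed.closure_eq]
      exact closure_mono interior_subset hs1
    exact mem_interior_iff_mem_nhds.2 (hopen s this hs2)
  -- The flow never reaches `s = 0`; that end of the ray comes from closedness.
  have h2 : Set.Ici (0 : ℝ) ⊆ S := by
    rw [← closure_Ioi]
    exact closure_minimal (hsub.trans interior_subset) hclosed
  exact h2 hs

/-- The rays through nearby points do not focus. -/
theorem principalCurvature_eq_zero_of_focus (hX : IsSmoothImmersion X) (hproper : IsProperMap X)
    (hN : IsUnitNormal X N) {c : ℝ} (hc : ∀ p, inner ℝ (X p) (N p) = -c) (p : M) {y v : Euc n}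
    (hy : y ∈ (extChartAt (𝓡 n) p).target) {k s : ℝ} (hv : v ≠ 0)
    (hk : fderiv ℝ (N ∘ (extChartAt (𝓡 n) p).symm) y v =
      -(k • fderiv ℝ (X ∘ (extChartAt (𝓡 n) p).symm) y v))
    (hs : 0 ≤ s) (hsk : c * k + s * (1 - c * k) = 0) : k = 0 := by
  have hpatch := hX.isPatch_chart hN p
  set x := X ∘ (extChartAt (𝓡 n) p).symm with hx
  set ν := N ∘ (extChartAt (𝓡 n) p).symm with hν
  by_contra hk0
  -- The ends at parameter `s` of the rays through `y + t v`. The choice `t ↦ q t` need not be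
  -- continuous, but `X (q t)` and `N (q t)` are given by explicit formulas and so are
  -- differentiable at `0`.
  choose q hq1 hq2 using fun t : ℝ =>
    exists_ray_point hX hproper hN hc ((extChartAt (𝓡 n) p).symm (y + t • v)) hs
  have hb : HasDerivAt (fun t => N (q t)) (-(k • fderiv ℝ x y v)) 0 := by
    simp_rw [hq1]
    rw [← hk]
    exact hpatch.hasDerivAt_normal hy v
  have ha : HasDerivAt (fun t => X (q t)) 0 0 := by
    simp_rw [hq2]
    have h1 := ((hpatch.hasDerivAt_normal hy v).const_smul c).neg.add
      (((hpatch.hasDerivAt_x hy v).add ((hpatch.hasDerivAt_normal hy v).const_smul c)).const_smul s)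
    convert! h1 using 1
    rw [hk]
    have : -(c • -(k • fderiv ℝ x y v)) +
        s • (fderiv ℝ x y v + c • -(k • fderiv ℝ x y v)) =
        (c * k + s * (1 - c * k)) • fderiv ℝ x y v := by module
    rw [this, hsk, zero_smul]
  have haT : Filter.Tendsto (fun t => X (q t)) (𝓝[≠] 0) (𝓝 (X (q 0))) :=
    ha.continuousAt.tendsto.mono_left nhdsWithin_le_nhds
  have hbT : Filter.Tendsto (fun t => N (q t)) (𝓝[≠] 0) (𝓝 (N (q 0))) :=
    hb.continuousAt.tendsto.mono_left nhdsWithin_le_nhds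
  -- Properness supplies a cluster point `q₀` of `q t` as `t → 0`, at which `X` and `N` take the
  -- values `X (q 0)` and `N (q 0)`.
  have hcl : MapClusterPt (X (q 0)) (Filter.map q (𝓝[≠] 0)) X :=
    Filter.Tendsto.mapClusterPt (Filter.tendsto_map'_iff.2 haT)
  obtain ⟨q₀, hq₀, hq₀c⟩ := hproper.clusterPt_of_mapClusterPt hcl
  have hNq₀ : N q₀ = N (q 0) := by
    by_contra hne
    obtain ⟨V, W, hV, hW, hVq, hWq, hdisj⟩ := t2_separation hne
    have h1 : ∃ᶠ p' in Filter.map q (𝓝[≠] 0), p' ∈ N ⁻¹' V :=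
      hq₀c.frequently (hN.continuous.continuousAt.preimage_mem_nhds (hV.mem_nhds hVq))
    rw [Filter.frequently_map] at h1
    obtain ⟨t, ht1, ht2⟩ := (h1.and_eventually (hbT.eventually (hW.mem_nhds hWq))).exists
    exact Set.disjoint_left.1 hdisj ht1 ht2
  obtain ⟨C, hC⟩ := (hX.normal_isBigO hN q₀).bound
  have hfreq : ∃ᶠ t in 𝓝[≠] (0 : ℝ), ‖N (q t) - N q₀‖ ≤ C * ‖X (q t) - X q₀‖ := by
    have := hq₀c.frequently hC
    rwa [Filter.frequently_map] at this
  have hslope : Filter.Tendsto (fun t => ‖slope (fun t => N (q t)) 0 t‖ -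
      C * ‖slope (fun t => X (q t)) 0 t‖) (𝓝[≠] 0)
      (𝓝 (‖-(k • fderiv ℝ x y v)‖ - C * ‖(0 : Euc (n + 1))‖)) :=
    (hasDerivAt_iff_tendsto_slope.1 hb).norm.sub
      ((hasDerivAt_iff_tendsto_slope.1 ha).norm.const_mul C)
  -- The difference quotients of `N` tend to a nonzero vector and those of `X` to zero, against the
  -- Lipschitz bound of `N` in terms of `X` near `q₀`.
  have hpos : 0 < ‖-(k • fderiv ℝ x y v)‖ - C * ‖(0 : Euc (n + 1))‖ := by
    rw [norm_zero, mul_zero, sub_zero, norm_pos_iff, neg_ne_zero]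
    refine smul_ne_zero hk0 fun h0 => hv ?_
    exact hpatch.injective y hy (by rw [h0, map_zero])
  obtain ⟨t, ht1, ht2⟩ := (hfreq.and_eventually (hslope.eventually (lt_mem_nhds hpos))).exists
  rw [hNq₀, hq₀] at ht1
  simp only [slope, vsub_eq_sub, norm_smul] at ht2
  have h3 : ‖(t - 0)⁻¹‖ * ‖N (q t) - N (q 0)‖ ≤ ‖(t - 0)⁻¹‖ * (C * ‖X (q t) - X (q 0)‖) := by
    gcongr
  linarith

end Rays

/-! ### The projection to the spherical directions, at one point. -/

section SphericalProjection

variable {n : ℕ} {D B : Euc n →L[ℝ] Euc (n + 1)} {ν : Euc (n + 1)}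

/-- When the principal curvatures are `0` and `1/c`, this is the orthogonal projection to the span
of the normal and of the principal directions of curvature `1/c`. -/
def sphericalProj (c : ℝ) (D B : Euc n →L[ℝ] Euc (n + 1)) (ν : Euc (n + 1)) :
    Euc (n + 1) →L[ℝ] Euc (n + 1) :=
  (innerSL ℝ ν).smulRight ν - c • (B ∘L pinv D)

theorem sphericalProj_apply (c : ℝ) (z : Euc (n + 1)) :
    sphericalProj c D B ν z = inner ℝ ν z • ν - c • B (pinv D z) := by
  simp [sphericalProj]

namespace IsGaussPair

variable (h : IsGaussPair D B ν) {c : ℝ}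
include h

omit h in
theorem pinv_apply_normal (w : Euc n) : pinv D (B w) = -shapeMap D B w := by
  simp [shapeMap]

theorem sphericalProj_normal : sphericalProj c D B ν ν = ν := by
  rw [sphericalProj_apply, pinv_eq_zero h.injective h.orthogonal, real_inner_self_eq_norm_sq,
    h.norm_eq_one]
  simp

theorem inner_sphericalProj (z z' : Euc (n + 1)) :
    inner ℝ (sphericalProj c D B ν z) z' = inner ℝ z (sphericalProj c D B ν z') := by
  have key : ∀ z z' : Euc (n + 1), inner ℝ (B (pinv D z)) z' =
      inner ℝ (B (pinv D z)) (D (pinv D z')) := by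
    intro z z'
    rw [apply_pinv h.injective h.norm_eq_one h.orthogonal, inner_sub_right, real_inner_smul_right,
      h.orthogonal', mul_zero, sub_zero]
  rw [sphericalProj_apply, sphericalProj_apply, inner_sub_left, inner_sub_right,
    real_inner_smul_left, real_inner_smul_left, real_inner_smul_right, real_inner_smul_right,
    real_inner_comm (B _) z, key z z', key z' z, h.symm, real_inner_comm z ν]
  ring

variable (hA : ∀ v, c • shapeMap D B (shapeMap D B v) = shapeMap D B v)
include hA

theorem smul_apply_shapeMap (w : Euc n) : c • B (shapeMap D B w) = B w := by
  have h1 := h.apply_shapeMap (shapeMap D B w)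
  have h2 := h.apply_shapeMap w
  rw [← hA, map_smul, h1, smul_neg, neg_inj] at h2
  exact h2

theorem sphericalProj_apply_normal (w : Euc n) : sphericalProj c D B ν (B w) = B w := by
  rw [sphericalProj_apply, pinv_apply_normal, map_neg, smul_neg, h.smul_apply_shapeMap hA,
    real_inner_comm, h.orthogonal']
  simp

theorem sphericalProj_apply_tangent (w : Euc n) :
    sphericalProj c D B ν (D w + c • B w) = 0 := by
  rw [map_add, map_smul, h.sphericalProj_apply_normal hA, sphericalProj_apply,
    pinv_self h.injective, real_inner_comm, h.orthogonal]
  simp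

theorem sphericalProj_idem (z : Euc (n + 1)) :
    sphericalProj c D B ν (sphericalProj c D B ν z) = sphericalProj c D B ν z := by
  rw [sphericalProj_apply c z, map_sub, map_smul, map_smul, h.sphericalProj_normal,
    h.sphericalProj_apply_normal hA]

theorem inner_tangent_normal (v w : Euc n) : inner ℝ (D w + c • B w) (B v) = 0 := by
  rw [← h.sphericalProj_apply_normal hA v, ← h.inner_sphericalProj,
    h.sphericalProj_apply_tangent hA, inner_zero_left]

theorem sphericalProj_eq_zero {z : Euc (n + 1)} (h1 : inner ℝ ν z = 0)
    (h2 : ∀ w, inner ℝ z (B w) = 0) : sphericalProj c D B ν z = 0 := by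
  refine eq_zero_of_inner_eq_zero h.injective h.norm_eq_one h.orthogonal ?_ fun v => ?_
  · rw [← h.inner_sphericalProj, h.sphericalProj_normal, h1]
  · have h3 : D v = (D v + c • B v) - c • B v := by abel
    rw [← h.inner_sphericalProj, h3, map_sub, h.sphericalProj_apply_tangent hA, map_smul,
      h.sphericalProj_apply_normal hA, zero_sub, inner_neg_left, real_inner_smul_left,
      real_inner_comm, h2]
    simp

theorem sphericalProj_eq_self {z : Euc (n + 1)} (h2 : ∀ w, inner ℝ z (D w + c • B w) = 0) :
    sphericalProj c D B ν z = z := by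
  rw [← sub_eq_zero]
  refine eq_zero_of_inner_eq_zero h.injective h.norm_eq_one h.orthogonal ?_ fun v => ?_
  · rw [inner_sub_right, ← h.inner_sphericalProj, h.sphericalProj_normal, sub_self]
  · have h3 : D v = (D v + c • B v) - c • B v := by abel
    rw [inner_sub_right, ← h.inner_sphericalProj, h3, map_sub, h.sphericalProj_apply_tangent hA,
      map_smul, h.sphericalProj_apply_normal hA, inner_sub_left, inner_sub_left, inner_zero_left,
      real_inner_comm z (D v + c • B v), h2]
    ring

end IsGaussPair

end SphericalProjection

/-! ### Local constancy of the projection. -/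

namespace IsPatch

open Topology

variable {n : ℕ} {U : Set (Euc n)} {x ν : Euc n → Euc (n + 1)} (h : IsPatch U x ν) {c : ℝ}
  (hA : ∀ y ∈ U, ∀ v, c • shapeMap (fderiv ℝ x y) (fderiv ℝ ν y)
    (shapeMap (fderiv ℝ x y) (fderiv ℝ ν y) v) = shapeMap (fderiv ℝ x y) (fderiv ℝ ν y) v)
include h

theorem contDiffAt_sphericalProj (c : ℝ) {y : Euc n} (hy : y ∈ U) :
    ContDiffAt ℝ ∞ (fun z => sphericalProj c (fderiv ℝ x z) (fderiv ℝ ν z) (ν z)) y := by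
  have hν := h.smooth_normal.contDiffAt (h.isOpen.mem_nhds hy)
  have h1 : ContDiffAt ℝ ∞ (fun z => (innerSL ℝ (ν z)).smulRight (ν z)) y :=
    ContDiffAt.smulRight ((innerSL ℝ).contDiff.contDiffAt.comp y hν) hν
  exact h1.sub (((contDiffAt_fderiv h.isOpen h.smooth_normal hy).clm_comp
    (h.contDiffAt_pinv_fderiv hy)).const_smul c)

include hA

/-- The total symmetry of the covariant derivative of the shape operator makes it vanish. -/
theorem inner_sndDeriv_normal_eq_zero {y : Euc n} (hy : y ∈ U) (v w z : Euc n) :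
    inner ℝ (fderiv ℝ (fderiv ℝ x) y v w + c • fderiv ℝ (fderiv ℝ ν) y v w) (fderiv ℝ ν y z) = 0 ∧
      inner ℝ (fderiv ℝ x y w + c • fderiv ℝ ν y w) (fderiv ℝ (fderiv ℝ ν) y v z) = 0 := by
  have hG := h.isGaussPair hy
  set A := shapeMap (fderiv ℝ x y) (fderiv ℝ ν y) with hAdef
  set S : Euc n → Euc n → Euc n → ℝ := fun v w z =>
    inner ℝ (fderiv ℝ (fderiv ℝ x) y v w + c • fderiv ℝ (fderiv ℝ ν) y v w) (fderiv ℝ ν y z) with hS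
  have h1 : ∀ v w z, S v w z =
      -inner ℝ (fderiv ℝ x y w + c • fderiv ℝ ν y w) (fderiv ℝ (fderiv ℝ ν) y v z) := by
    intro v w z
    have h2 := ((hasDerivAt_line_fderiv h.isOpen h.smooth hy v w).add
      ((hasDerivAt_line_fderiv h.isOpen h.smooth_normal hy v w).const_smul c)).inner ℝ
      (hasDerivAt_line_fderiv h.isOpen h.smooth_normal hy v z)
    have h3 := eq_of_eqOn_of_hasDerivAt_line h.isOpen hy (v := v)
      (f := fun y => inner ℝ (fderiv ℝ x y w + c • fderiv ℝ ν y w) (fderiv ℝ ν y z))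
      (g := fun _ => (0 : ℝ)) (fun a ha => (h.isGaussPair ha).inner_tangent_normal (hA a ha) z w)
      h2 (hasDerivAt_const _ _)
    simp only [Pi.add_apply, Pi.smul_apply, zero_smul, add_zero] at h3
    simp only [hS]
    linarith
  -- `S` is symmetric in its first two slots, and by `h1` in the outer two, hence totally symmetric.
  -- It vanishes when the middle slot lies in the range of `A`. Since `dν z = c dν (A z)`, the last
  -- slot can always be moved into that range.
  have hs12 : ∀ v w z, S v w z = S w v z := fun v w z => by
    simp only [hS]
    rw [fderiv_fderiv_symm h.isOpen h.smooth hy, fderiv_fderiv_symm h.isOpen h.smooth_normal hy]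
  have hs13 : ∀ v w z, S v w z = S z w v := fun v w z => by
    rw [h1, h1, fderiv_fderiv_symm h.isOpen h.smooth_normal hy]
  have hS2 : ∀ v a z, S v (A a) z = 0 := fun v a z => by
    rw [h1, hG.apply_shapeMap, hG.smul_apply_shapeMap (hA y hy), neg_add_cancel, inner_zero_left,
      neg_zero]
  have hS0 : ∀ v w z, S v w z = 0 := fun v w z => by
    have h2 : fderiv ℝ ν y z = c • fderiv ℝ ν y (A z) :=
      (hG.smul_apply_shapeMap (hA y hy) z).symm
    have h3 : S v w z = c * S v w (A z) := by
      simp only [hS]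
      rw [h2, real_inner_smul_right]
    rw [h3, hs13, hs12, hS2, mul_zero]
  refine ⟨hS0 v w z, ?_⟩
  have h2 := h1 v w z
  rw [hS0] at h2
  linarith

/-- The projection fixes `ν` and every `dν w` and annihilates every `dx w + c dν w`. Differentiating
these identities, with `inner_sndDeriv_normal_eq_zero` for the last two, shows that its derivative
annihilates all three families, which span the ambient space. -/
theorem fderiv_sphericalProj {y : Euc n} (hy : y ∈ U) :
    fderiv ℝ (fun z => sphericalProj c (fderiv ℝ x z) (fderiv ℝ ν z) (ν z)) y = 0 := by
  have hG := h.isGaussPair hy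
  set Q := fun z => sphericalProj c (fderiv ℝ x z) (fderiv ℝ ν z) (ν z) with hQ
  have hQd : HasFDerivAt Q (fderiv ℝ Q y) y :=
    ((h.contDiffAt_sphericalProj c hy).differentiableAt (by simp)).hasFDerivAt
  ext1 v
  have hline := hasDerivAt_line hQd v
  set Q' := fderiv ℝ Q y v with hQ'
  have h1 : Q' (ν y) = 0 := by
    have h2 := eq_of_eqOn_of_hasDerivAt_line h.isOpen hy (v := v) (f := fun z => Q z (ν z))
      (g := ν) (fun z hz => (h.isGaussPair hz).sphericalProj_normal)
      (hline.clm_apply (h.hasDerivAt_normal hy v)) (h.hasDerivAt_normal hy v)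
    simp only [zero_smul, add_zero] at h2
    rw [show Q y (fderiv ℝ ν y v) = fderiv ℝ ν y v from
      hG.sphericalProj_apply_normal (hA y hy) v] at h2
    simpa using h2
  have h2 : ∀ w, Q' (fderiv ℝ ν y w) = 0 := by
    intro w
    have hd := hasDerivAt_line_fderiv h.isOpen h.smooth_normal hy v w
    have h2 := eq_of_eqOn_of_hasDerivAt_line h.isOpen hy (v := v)
      (f := fun z => Q z (fderiv ℝ ν z w)) (g := fun z => fderiv ℝ ν z w)
      (fun z hz => (h.isGaussPair hz).sphericalProj_apply_normal (hA z hz) w)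
      (hline.clm_apply hd) hd
    simp only [zero_smul, add_zero] at h2
    rw [show Q y (fderiv ℝ (fderiv ℝ ν) y v w) = fderiv ℝ (fderiv ℝ ν) y v w from
      hG.sphericalProj_eq_self (hA y hy) fun a => by
        rw [real_inner_comm]
        exact (h.inner_sndDeriv_normal_eq_zero hA hy v a w).2] at h2
    simpa using h2
  have h3 : ∀ w, Q' (fderiv ℝ x y w + c • fderiv ℝ ν y w) = 0 := by
    intro w
    have hd := (hasDerivAt_line_fderiv h.isOpen h.smooth hy v w).add
      ((hasDerivAt_line_fderiv h.isOpen h.smooth_normal hy v w).const_smul c)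
    have h2 := eq_of_eqOn_of_hasDerivAt_line h.isOpen hy (v := v)
      (f := fun z => Q z (fderiv ℝ x z w + c • fderiv ℝ ν z w)) (g := fun z => 0)
      (fun z hz => (h.isGaussPair hz).sphericalProj_apply_tangent (hA z hz) w)
      (hline.clm_apply hd) (hasDerivAt_const _ _)
    have horth : inner ℝ (ν y)
        (fderiv ℝ (fderiv ℝ x) y v w + c • fderiv ℝ (fderiv ℝ ν) y v w) = (0 : ℝ) := by
      rw [inner_add_right, real_inner_smul_right, h.inner_fderiv_fderiv_normal hy, real_inner_comm,
        h.inner_sndDeriv hy]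
      have h5 := hG.inner_tangent_normal (hA y hy) v w
      rw [inner_add_left, real_inner_smul_left,
        real_inner_comm (fderiv ℝ ν y v) (fderiv ℝ ν y w)] at h5
      linarith
    simp only [zero_smul, add_zero] at h2
    rw [show Q y (fderiv ℝ (fderiv ℝ x) y v w + c • fderiv ℝ (fderiv ℝ ν) y v w) = 0 from
      hG.sphericalProj_eq_zero (hA y hy) horth fun a =>
        (h.inner_sndDeriv_normal_eq_zero hA hy v w a).1] at h2
    simpa using h2
  ext1 z
  have hz : z = inner ℝ (ν y) z • ν y + ((fderiv ℝ x y (pinv (fderiv ℝ x y) z) +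
      c • fderiv ℝ ν y (pinv (fderiv ℝ x y) z)) - c • fderiv ℝ ν y (pinv (fderiv ℝ x y) z)) := by
    rw [add_sub_cancel_right, apply_pinv hG.injective hG.norm_eq_one hG.orthogonal]
    abel
  rw [hz, map_add, map_sub, map_smul, map_smul, h1, h2, h3]
  simp

theorem sphericalProj_eventually_eq {y : Euc n} (hy : y ∈ U) :
    ∀ᶠ z in 𝓝 y, sphericalProj c (fderiv ℝ x z) (fderiv ℝ ν z) (ν z) =
      sphericalProj c (fderiv ℝ x y) (fderiv ℝ ν y) (ν y) := by
  obtain ⟨R, hR, hRU⟩ := Metric.isOpen_iff.1 h.isOpen y hy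
  filter_upwards [Metric.ball_mem_nhds y hR] with z hz
  exact Metric.isOpen_ball.is_const_of_fderiv_eq_zero (𝕜 := ℝ)
    (convex_ball y R).isPreconnected
    (fun a ha => ((h.contDiffAt_sphericalProj c (hRU ha)).differentiableAt
      (by simp)).differentiableWithinAt)
    (fun a ha => h.fderiv_sphericalProj hA (hRU ha)) hz (Metric.mem_ball_self hR)

end IsPatch

/-! ### Principal curvatures when the support function is constant. -/

section ConstantSupport

open Topology

variable {n : ℕ} {M : Type*} [TopologicalSpace M] [ChartedSpace (Euc n) M] {X N : M → Euc (n + 1)}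

namespace IsReparam

variable {M' : Type*} [TopologicalSpace M'] [ChartedSpace (Euc n) M'] {q : M}
  {x ν : M' → Euc (n + 1)} {y : M'} {T : Euc n ≃L[ℝ] Euc n} (h : IsReparam X N q x ν y T)
include h

theorem isPrincipalFrame {e : Module.Basis (Fin n) ℝ (Euc n)} {k : Fin n → ℝ}
    (hf : IsPrincipalFrame X N q e k) :
    IsPrincipalFrame x ν y (e.map T.symm.toLinearEquiv) k := by
  refine ⟨?_, fun i => ?_⟩
  · rw [h.differential_eq]
    simpa using hf.orthonormal
  · apply T.injective
    rw [h.shapeOperator_apply, map_smul]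
    simpa using hf.shape i

theorem sphericalProj_eq (c : ℝ) (w : Euc (n + 1)) :
    sphericalProj c (differential x y) (differential ν y) w =
      sphericalProj c (differential X q) (differential N q) w := by
  ext1 z
  rw [sphericalProj_apply, sphericalProj_apply, h.pinv_eq, h.differential_normal_eq]
  simp

theorem isGaussPair_of (hν : ν y = N q)
    (hG : IsGaussPair (differential x y) (differential ν y) (ν y)) :
    IsGaussPair (differential X q) (differential N q) (N q) := by
  have h1 : ∀ v, differential X q v = differential x y (T.symm v) := fun v => by
    simp [h.differential_eq]
  have h2 : ∀ v, differential N q v = differential ν y (T.symm v) := fun v => by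
    simp [h.differential_normal_eq]
  refine ⟨h.injective, hν ▸ hG.norm_eq_one, fun v => ?_, fun v => ?_, fun v w => ?_⟩
  · rw [h1, ← hν, hG.orthogonal]
  · rw [h2, ← hν, hG.orthogonal']
  · rw [h1, h1, h2, h2, hG.symm]

end IsReparam

variable [IsManifold (𝓡 n) ∞ M]

theorem IsSmoothImmersion.isGaussPair (hX : IsSmoothImmersion X) (hN : IsUnitNormal X N) (p : M) :
    IsGaussPair (differential X p) (differential N p) (N p) := by
  have hy := mem_extChartAt_target (I := 𝓡 n) p
  obtain ⟨T, hT⟩ := hX.exists_isReparam hN p hy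
  have h1 := (hX.isPatch_chart hN p).isGaussPair hy
  rw [← differential_eq_fderiv, ← differential_eq_fderiv] at h1
  have h2 := hT.isGaussPair_of rfl h1
  rwa [extChartAt_to_inv] at h2

theorem IsSmoothImmersion.exists_chart_frame (hX : IsSmoothImmersion X) (hN : IsUnitNormal X N)
    {p : M} {e : Module.Basis (Fin n) ℝ (Euc n)} {k : Fin n → ℝ} (hf : IsPrincipalFrame X N p e k) :
    ∃ T : Euc n ≃L[ℝ] Euc n, IsReparam X N p (X ∘ (extChartAt (𝓡 n) p).symm)
      (N ∘ (extChartAt (𝓡 n) p).symm) (extChartAt (𝓡 n) p p) T ∧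
      IsPrincipalFrame (X ∘ (extChartAt (𝓡 n) p).symm) (N ∘ (extChartAt (𝓡 n) p).symm)
        (extChartAt (𝓡 n) p p) (e.map T.symm.toLinearEquiv) k := by
  obtain ⟨T, hT⟩ := hX.exists_isReparam hN p (mem_extChartAt_target (I := 𝓡 n) p)
  rw [extChartAt_to_inv] at hT
  exact ⟨T, hT, hT.isPrincipalFrame hf⟩

namespace IsPrincipalFrame

variable {c : ℝ} {p : M} {e : Module.Basis (Fin n) ℝ (Euc n)} {k : Fin n → ℝ}

theorem curvature_eq_zero_of_focus (hf : IsPrincipalFrame X N p e k) (hX : IsSmoothImmersion X)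
    (hproper : IsProperMap X) (hN : IsUnitNormal X N) (hc : ∀ p, inner ℝ (X p) (N p) = -c)
    (i : Fin n) {s : ℝ} (hs : 0 ≤ s) (hsk : c * k i + s * (1 - c * k i) = 0) : k i = 0 := by
  obtain ⟨T, -, hf'⟩ := hX.exists_chart_frame hN hf
  have hy := mem_extChartAt_target (I := 𝓡 n) p
  exact principalCurvature_eq_zero_of_focus hX hproper hN hc p hy
    ((e.map T.symm.toLinearEquiv).ne_zero i)
    ((hX.isPatch_chart hN p).fderiv_normal_frame hy hf' i) hs hsk

/-- If `c k` lies outside `[0, 1]`, the focal equation `ck + s (1 - ck) = 0` has a solution `s ≥ 0`,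
which forces `k = 0`. -/
theorem mul_curvature_mem_Icc (hf : IsPrincipalFrame X N p e k) (hX : IsSmoothImmersion X)
    (hproper : IsProperMap X) (hN : IsUnitNormal X N) (hc : ∀ p, inner ℝ (X p) (N p) = -c)
    (i : Fin n) : c * k i ∈ Set.Icc 0 1 := by
  constructor
  · by_contra! hneg
    have hs : 0 ≤ -(c * k i) / (1 - c * k i) := div_nonneg (by linarith) (by linarith)
    have h1 := hf.curvature_eq_zero_of_focus hX hproper hN hc i hs (by
      rw [div_mul_cancel₀ _ (by linarith)]; ring)
    simp [h1] at hneg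
  · by_contra! hgt
    have hs : 0 ≤ c * k i / (c * k i - 1) := div_nonneg (by linarith) (by linarith)
    have h1 := hf.curvature_eq_zero_of_focus hX hproper hN hc i hs (by
      rw [← neg_sub (c * k i) 1, mul_neg, div_mul_cancel₀ _ (by linarith)]; ring)
    norm_num [h1] at hgt

/-- Apply the equation for `L u` to a nonzero constant `u`: only the zeroth order coefficient
survives, and it must vanish. -/
theorem modifiedNormSq_of_support_eq (hf : IsPrincipalFrame X N p e k) (hX : IsSmoothImmersion X)
    (hN : IsUnitNormal X N) {r : ℕ} (hshr : IsSelfShrinker X N (r + 1))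
    (hc : ∀ p, inner ℝ (X p) (N p) = -c) (hc0 : c ≠ 0) : modifiedNormSq X N r p = r + 1 := by
  obtain ⟨T, hT, hf'⟩ := hX.exists_chart_frame hN hf
  have h1 := (hX.isPatch_chart hN p).sum_hess_support (mem_extChartAt_target (I := 𝓡 n) p) hf'
    (hshr.sigma_chart hX hN p)
  have h2 : (fun z => inner ℝ ((X ∘ (extChartAt (𝓡 n) p).symm) z)
      ((N ∘ (extChartAt (𝓡 n) p).symm) z) : Euc n → ℝ) = fun _ => -c := funext fun z => hc _
  have h3 : fderiv ℝ (fun _ : Euc n => -c) = fun _ => 0 := by ext1 z; simp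
  have h4 := hc ((extChartAt (𝓡 n) p).symm (extChartAt (𝓡 n) p p))
  rw [h2, h3, hT.modifiedNormSq_eq] at h1
  simp only [Function.comp, h4] at h1
  simp only [fderiv_fun_const, Pi.zero_apply, zero_apply, mul_zero, Finset.sum_const_zero,
    zero_add] at h1
  have h5 := (mul_eq_zero.1 h1.symm).resolve_right (neg_ne_zero.2 hc0)
  linarith

/-- With `μ_i` the eigenvalues of `P_r`, one has `∑ μ_i k_i = (r + 1) c` and `∑ μ_i k_i² = r + 1`,
so `∑ μ_i (c k_i) (1 - c k_i) = 0`. Each term is nonnegative and each `μ_i` is positive. -/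
theorem curvature_eq_or (hf : IsPrincipalFrame X N p e k) (hX : IsSmoothImmersion X)
    (hproper : IsProperMap X) (hN : IsUnitNormal X N) {r : ℕ} (hshr : IsSelfShrinker X N (r + 1))
    (hpos : NewtonPosDef X N r) (hc : ∀ p, inner ℝ (X p) (N p) = -c) (hc0 : c ≠ 0) (i : Fin n) :
    k i = 0 ∨ k i = c⁻¹ := by
  have h1 := hf.modifiedNormSq_of_support_eq hX hN hshr hc hc0
  rw [hf.modifiedNormSq_eq] at h1
  have h2 := sum_es_erase_mul k Finset.univ r
  rw [← hf.sigma_eq, hshr p, hc p, neg_neg] at h2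
  have h3 : ∑ i, es k (Finset.univ.erase i) r * ((c * k i) * (1 - c * k i)) = 0 := by
    calc ∑ i, es k (Finset.univ.erase i) r * ((c * k i) * (1 - c * k i))
        = c * ∑ i, es k (Finset.univ.erase i) r * k i -
            c ^ 2 * ∑ i, es k (Finset.univ.erase i) r * k i ^ 2 := by
          rw [Finset.mul_sum, Finset.mul_sum, ← Finset.sum_sub_distrib]
          exact Finset.sum_congr rfl fun i _ => by ring
      _ = 0 := by rw [h1, h2]; ring
  have h4 := hf.mul_curvature_mem_Icc hX hproper hN hc
  have hμ := hf.es_pos (hpos p)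
  rw [Finset.sum_eq_zero_iff_of_nonneg fun i _ =>
    mul_nonneg (hμ i).le (mul_nonneg (h4 i).1 (sub_nonneg.2 (h4 i).2))] at h3
  rcases mul_eq_zero.1 ((mul_eq_zero.1 (h3 i (Finset.mem_univ i))).resolve_left (hμ i).ne') with
    h5 | h5
  · exact Or.inl ((mul_eq_zero.1 h5).resolve_left hc0)
  · exact Or.inr (eq_inv_of_mul_eq_one_right (by linarith))

-- With `m` curvatures equal to `1/c` and the others zero, `σ_{r+1} = c` reads `c ^ (r + 2) =
-- binom(m, r + 1)`. As `c ≠ 0`, the binomial coefficient does not vanish.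
omit [IsManifold (𝓡 n) ∞ M] in
theorem abs_support_eq_delta (hf : IsPrincipalFrame X N p e k) {r : ℕ}
    (hshr : IsSelfShrinker X N (r + 1)) (hc : ∀ p, inner ℝ (X p) (N p) = -c) (hc0 : c ≠ 0)
    (hk : ∀ i, k i = 0 ∨ k i = c⁻¹) :
    r + 1 ≤ (Finset.univ.filter (k · ≠ 0)).card ∧
      |c| = delta (Finset.univ.filter (k · ≠ 0)).card (r + 1) := by
  set m := (Finset.univ.filter (k · ≠ 0)).card with hm
  have h1 := es_eq_choose k Finset.univ c⁻¹ (fun i _ => hk i) (r + 1)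
  rw [← hf.sigma_eq, hshr p, hc p, neg_neg, ← hm] at h1
  have h2 : c ^ (r + 2) = m.choose (r + 1) := by
    calc c ^ (r + 2) = c * c ^ (r + 1) := by ring
      _ = (m.choose (r + 1) * c⁻¹ ^ (r + 1)) * c ^ (r + 1) := by rw [← h1]
      _ = m.choose (r + 1) := by
        rw [mul_assoc, ← mul_pow, inv_mul_cancel₀ hc0, one_pow, mul_one]
  have h3 : (m.choose (r + 1) : ℝ) = |c| ^ (r + 2) := by
    rw [← abs_pow, h2, Nat.abs_cast]
  constructor
  · by_contra! hlt
    rw [Nat.choose_eq_zero_of_lt hlt, Nat.cast_zero] at h2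
    exact pow_ne_zero _ hc0 h2
  · rw [delta, h3]
    have h4 : (1 : ℝ) / (((r + 1 : ℕ) : ℝ) + 1) = ((r + 2 : ℕ) : ℝ)⁻¹ := by
      push_cast
      rw [one_div]
      ring
    rw [h4, Real.pow_rpow_inv_natCast (abs_nonneg c) (by simp)]

end IsPrincipalFrame

end ConstantSupport

/-! ### The fixed subspace and the cylinder containing the hypersurface. -/

section ConstantProjection

open Topology

variable {n : ℕ} {M : Type*} [TopologicalSpace M] [ChartedSpace (Euc n) M] [IsManifold (𝓡 n) ∞ M]
  {X N : M → Euc (n + 1)}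

theorem IsReparam.smul_shapeMap_shapeMap {M' : Type*} [TopologicalSpace M']
    [ChartedSpace (Euc n) M'] {M : Type*} [TopologicalSpace M] [ChartedSpace (Euc n) M]
    {X N : M → Euc (n + 1)} {q : M} {x ν : M' → Euc (n + 1)} {y : M'} {T : Euc n ≃L[ℝ] Euc n}
    (h : IsReparam X N q x ν y T) {c : ℝ}
    (hA : ∀ v, c • shapeOperator X N q (shapeOperator X N q v) = shapeOperator X N q v)
    (v : Euc n) : c • shapeMap (differential x y) (differential ν y)
      (shapeMap (differential x y) (differential ν y) v) =
        shapeMap (differential x y) (differential ν y) v := by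
  change c • shapeOperator x ν y (shapeOperator x ν y v) = shapeOperator x ν y v
  apply T.injective
  rw [map_smul, h.shapeOperator_apply, h.shapeOperator_apply]
  exact hA _

omit [IsManifold (𝓡 n) ∞ M] in
theorem IsPrincipalFrame.smul_shape_shape {p : M} {e : Module.Basis (Fin n) ℝ (Euc n)}
    {k : Fin n → ℝ} (hf : IsPrincipalFrame X N p e k) {c : ℝ} (hk : ∀ i, c * k i ^ 2 = k i)
    (v : Euc n) : c • shapeOperator X N p (shapeOperator X N p v) = shapeOperator X N p v := by
  have h1 : c • (shapeOperator X N p ∘ₗ shapeOperator X N p) = shapeOperator X N p := by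
    refine e.ext fun i => ?_
    rw [LinearMap.smul_apply, LinearMap.comp_apply, hf.shape, map_smul, hf.shape, smul_smul,
      smul_smul]
    congr 1
    linear_combination hk i
  exact LinearMap.congr_fun h1 v

theorem IsSmoothImmersion.sphericalProj_eventually_eq (hX : IsSmoothImmersion X)
    (hN : IsUnitNormal X N) {c : ℝ}
    (hA : ∀ p v, c • shapeOperator X N p (shapeOperator X N p v) = shapeOperator X N p v) (p : M) :
    ∀ᶠ q in 𝓝 p, sphericalProj c (differential X q) (differential N q) (N q) =
      sphericalProj c (differential X p) (differential N p) (N p) := by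
  set φ := extChartAt (𝓡 n) p with hφ
  have h1 : ∀ q ∈ φ.source, sphericalProj c (fderiv ℝ (X ∘ φ.symm) (φ q))
      (fderiv ℝ (N ∘ φ.symm) (φ q)) ((N ∘ φ.symm) (φ q)) =
        sphericalProj c (differential X q) (differential N q) (N q) := by
    intro q hq
    obtain ⟨T, hT⟩ := hX.exists_isReparam hN p (φ.map_source hq)
    rw [← hφ, φ.left_inv hq] at hT
    rw [← differential_eq_fderiv, ← differential_eq_fderiv, hT.sphericalProj_eq, Function.comp,
      φ.left_inv hq]
  have h2 := (hX.isPatch_chart hN p).sphericalProj_eventually_eq (c := c) (fun y hy v => by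
    obtain ⟨T, hT⟩ := hX.exists_isReparam hN p hy
    rw [← differential_eq_fderiv, ← differential_eq_fderiv]
    exact hT.smul_shapeMap_shapeMap (hA _) v) (mem_extChartAt_target (I := 𝓡 n) p)
  filter_upwards [extChartAt_source_mem_nhds (I := 𝓡 n) p,
    (continuousAt_extChartAt (I := 𝓡 n) p).eventually h2] with q hq1 hq2
  rw [← h1 q hq1, ← h1 p (mem_extChartAt_source p)]
  exact hq2

theorem IsSmoothImmersion.sphericalProj_eq [PreconnectedSpace M] (hX : IsSmoothImmersion X)
    (hN : IsUnitNormal X N) {c : ℝ}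
    (hA : ∀ p v, c • shapeOperator X N p (shapeOperator X N p v) = shapeOperator X N p v)
    (p q : M) : sphericalProj c (differential X p) (differential N p) (N p) =
      sphericalProj c (differential X q) (differential N q) (N q) :=
  IsLocallyConstant.apply_eq_of_isPreconnected
    ((IsLocallyConstant.iff_eventually_eq _).2 fun p => hX.sphericalProj_eventually_eq hN hA p)
    isPreconnected_univ (Set.mem_univ p) (Set.mem_univ q)

theorem IsSmoothImmersion.normal_tangentialPart (hX : IsSmoothImmersion X)
    (hN : IsUnitNormal X N) {c : ℝ} (hc : ∀ p, inner ℝ (X p) (N p) = -c) (p : M) :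
    differential N p (pinv (differential X p) (X p)) = 0 := by
  have hy := mem_extChartAt_target (I := 𝓡 n) p
  obtain ⟨T, hT⟩ := hX.exists_isReparam hN p hy
  have h1 := (hX.isPatch_chart hN p).fderiv_normal_tangentialPart (fun y _ => hc _) hy
  rw [extChartAt_to_inv] at hT
  rw [← differential_eq_fderiv, ← differential_eq_fderiv, hT.pinv_eq, hT.differential_normal_eq,
    Function.comp, extChartAt_to_inv] at h1
  simpa using h1

omit [IsManifold (𝓡 n) ∞ M] in
theorem IsPrincipalFrame.trace_sphericalProj {p : M} {e : Module.Basis (Fin n) ℝ (Euc n)}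
    {k : Fin n → ℝ} (hf : IsPrincipalFrame X N p e k) (hν : ‖N p‖ = 1) (c : ℝ) :
    LinearMap.trace ℝ _ (sphericalProj c (differential X p) (differential N p)
      (N p)).toLinearMap = 1 + ∑ i, c * k i := by
  have h1 : (sphericalProj c (differential X p) (differential N p) (N p)).toLinearMap =
      (innerSL ℝ (N p)).toLinearMap.smulRight (N p) - c • ((differential N p).toLinearMap ∘ₗ
        (pinv (differential X p)).toLinearMap) := by
    ext1 z
    simp [sphericalProj_apply]
  have h2 : (pinv (differential X p)).toLinearMap ∘ₗ (differential N p).toLinearMap =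
      -shapeOperator X N p := by
    ext1 z
    simp [shapeOperator_eq_shapeMap, shapeMap]
  have h3 : LinearMap.trace ℝ _ (shapeOperator X N p) = ∑ i, k i := by
    rw [LinearMap.trace_eq_matrix_trace ℝ e, hf.toMatrix_shape, Matrix.trace_diagonal]
  rw [h1, map_sub, map_smul, LinearMap.trace_comp_comm', h2, map_neg, h3, LinearMap.trace_smulRight]
  simp [hν, Finset.mul_sum]

/-- A hypersurface with constant support function `-c` and principal curvatures in `{0, 1/c}` lies
on a round cylinder of radius `|c|`. -/
theorem exists_subspace_of_support_eq [PreconnectedSpace M] (hX : IsSmoothImmersion X)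
    (hN : IsUnitNormal X N) {c : ℝ} (hc : ∀ p, inner ℝ (X p) (N p) = -c)
    (hk : ∀ (p : M) e k, IsPrincipalFrame X N p e k → ∀ i, c * k i ^ 2 = k i) {p : M}
    {e : Module.Basis (Fin n) ℝ (Euc n)} {k : Fin n → ℝ} (hf : IsPrincipalFrame X N p e k) :
    ∃ W : Submodule ℝ (Euc (n + 1)), (Module.finrank ℝ W : ℝ) = 1 + ∑ i, c * k i ∧
      (∀ q, N q ∈ W) ∧ ∀ q, W.starProjection (X q) = -(c • N q) := by
  have hG := fun q => hX.isGaussPair hN q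
  have hA : ∀ p v, c • shapeOperator X N p (shapeOperator X N p v) = shapeOperator X N p v := by
    intro p
    obtain ⟨e, k, hf⟩ := exists_isPrincipalFrame (hG p)
    exact hf.smul_shape_shape (hk p e k hf)
  set Q := sphericalProj c (differential X p) (differential N p) (N p) with hQ
  have hQq : ∀ q, sphericalProj c (differential X q) (differential N q) (N q) = Q := fun q =>
    hX.sphericalProj_eq hN hA q p
  have hidem : ∀ z, Q (Q z) = Q z := (hG p).sphericalProj_idem (hA p)
  have hproj : LinearMap.IsProj Q.toLinearMap.range Q.toLinearMap := by
    refine ⟨fun z => ⟨z, rfl⟩, ?_⟩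
    rintro _ ⟨z, rfl⟩
    exact hidem z
  have hstar : ∀ z, Q.toLinearMap.range.starProjection z = Q z := by
    intro z
    refine Submodule.eq_starProjection_of_mem_of_inner_eq_zero ⟨z, rfl⟩ ?_
    rintro _ ⟨w, rfl⟩
    change inner ℝ (z - Q z) (Q w) = 0
    rw [hQ, ← (hG p).inner_sphericalProj, ← hQ, map_sub, hidem, sub_self, inner_zero_left]
  refine ⟨Q.toLinearMap.range, ?_, fun q => ⟨N q, ?_⟩, fun q => ?_⟩
  -- The dimension of the range of a projection is its trace.
  · rw [← hproj.trace, hQ, hf.trace_sphericalProj (hN.norm_eq_one p)]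
  · change Q (N q) = N q
    rw [← hQq q, (hG q).sphericalProj_normal]
  · rw [hstar, ← hQq q, sphericalProj_apply, hX.normal_tangentialPart hN hc, real_inner_comm, hc]
    simp

end ConstantProjection

/-! ### Injectivity of coverings of hyperplanes and cylinders. -/

section Coverings

open Topology

/-- A covering by a connected space is injective if the base is the union of two simply connected
open sets with connected intersection. -/
theorem IsCoveringMap.injective_of_isOpenEmbedding {E C A B : Type*} [TopologicalSpace E]
    [TopologicalSpace C] [TopologicalSpace A] [TopologicalSpace B] [PreconnectedSpace E]
    [SimplyConnectedSpace A] [LocallyPathConnectedSpace A] [SimplyConnectedSpace B]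
    [LocallyPathConnectedSpace B] {p : E → C} (hp : IsCoveringMap p)
    (hsurj : Function.Surjective p) {i : A → C} {j : B → C} (hi : IsOpenEmbedding i)
    (hj : IsOpenEmbedding j) (hcover : Set.range i ∪ Set.range j = Set.univ)
    (hconn : IsConnected (Set.range i ∩ Set.range j)) : Function.Injective p := by
  classical
  obtain ⟨⟨c₀, ⟨a₀, ha₀⟩, ⟨b₀, hb₀⟩⟩, hpre⟩ := hconn
  obtain ⟨e₀, he₀⟩ := hsurj c₀
  -- The inclusions of the two simply connected pieces lift through `p`, with the same value `e₀`
  -- over `c₀`. Connectedness of the intersection makes the lifts agree there, and they glue to a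
  -- global section `s`.
  obtain ⟨F, ⟨hF0, hF⟩, -⟩ := hp.existsUnique_continuousMap_lifts ⟨i, hi.continuous⟩ a₀ e₀
    (he₀.trans ha₀.symm)
  obtain ⟨G, ⟨hG0, hG⟩, -⟩ := hp.existsUnique_continuousMap_lifts ⟨j, hj.continuous⟩ b₀ e₀
    (he₀.trans hb₀.symm)
  have : Nonempty A := ⟨a₀⟩
  have : Nonempty B := ⟨b₀⟩
  set φ := hi.toOpenPartialHomeomorph i with hφ
  set ψ := hj.toOpenPartialHomeomorph j with hψ
  have hφi : ∀ a, φ.symm (i a) = a := fun a => hi.toOpenPartialHomeomorph_left_inv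
  have hψj : ∀ b, ψ.symm (j b) = b := fun b => hj.toOpenPartialHomeomorph_left_inv
  have hpF : ∀ c ∈ Set.range i, p (F (φ.symm c)) = c := by
    rintro _ ⟨a, rfl⟩
    rw [hφi]
    exact congrFun hF a
  have hpG : ∀ c ∈ Set.range j, p (G (ψ.symm c)) = c := by
    rintro _ ⟨b, rfl⟩
    rw [hψj]
    exact congrFun hG b
  have hFc : ContinuousOn (fun c => F (φ.symm c)) (Set.range i) := by
    have h1 := φ.continuousOn_symm
    rw [hφ, hi.toOpenPartialHomeomorph_target] at h1
    exact F.continuous.comp_continuousOn h1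
  have hGc : ContinuousOn (fun c => G (ψ.symm c)) (Set.range j) := by
    have h1 := ψ.continuousOn_symm
    rw [hψ, hj.toOpenPartialHomeomorph_target] at h1
    exact G.continuous.comp_continuousOn h1
  have hFG : Set.EqOn (fun c => F (φ.symm c)) (fun c => G (ψ.symm c))
      (Set.range i ∩ Set.range j) :=
    hp.eqOn_of_comp_eqOn hpre (hFc.mono Set.inter_subset_left) (hGc.mono Set.inter_subset_right)
      (fun c hc => (hpF c hc.1).trans (hpG c hc.2).symm) (a := c₀) ⟨⟨a₀, ha₀⟩, ⟨b₀, hb₀⟩⟩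
      (by simp only [← ha₀, hφi, hF0]; rw [ha₀, ← hb₀, hψj, hG0])
  set s : C → E := fun c => if c ∈ Set.range i then F (φ.symm c) else G (ψ.symm c) with hs
  have hsF : Set.EqOn s (fun c => F (φ.symm c)) (Set.range i) := fun c hc => if_pos hc
  have hsG : Set.EqOn s (fun c => G (ψ.symm c)) (Set.range j) := fun c hc => by
    by_cases hci : c ∈ Set.range i
    · exact (hsF hci).trans (hFG ⟨hci, hc⟩)
    · exact if_neg hci
  have hps : ∀ c, p (s c) = c := by
    intro c
    rcases (hcover.symm ▸ Set.mem_univ c : c ∈ Set.range i ∪ Set.range j) with hc | hc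
    · rw [hsF hc, hpF c hc]
    · rw [hsG hc, hpG c hc]
  have hsc : Continuous s := by
    rw [continuous_iff_continuousAt]
    intro c
    rcases (hcover.symm ▸ Set.mem_univ c : c ∈ Set.range i ∪ Set.range j) with hc | hc
    · exact (hFc.congr hsF).continuousAt (hi.isOpen_range.mem_nhds hc)
    · exact (hGc.congr hsG).continuousAt (hj.isOpen_range.mem_nhds hc)
  have hs0 : s (p e₀) = e₀ := by
    rw [he₀, hsF ⟨a₀, ha₀⟩]
    simp only [← ha₀, hφi, hF0]
  -- Both are lifts of `p` through itself that agree at `e₀`, and the total space is connected. A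
  -- section that is also a left inverse gives injectivity.
  have hsp : s ∘ p = id := hp.eq_of_comp_eq (hsc.comp hp.continuous) continuous_id
    (funext fun e => hps (p e)) e₀ hs0
  exact fun a b hab => by
    rw [← id_eq a, ← id_eq b, ← hsp, Function.comp, Function.comp, hab]

/-- A proper local homeomorphism is a covering. -/
theorem IsLocalHomeomorph.isCoveringMap_of_isProperMap {E C : Type*} [TopologicalSpace E]
    [TopologicalSpace C] [T2Space E] {p : E → C} (h : IsLocalHomeomorph p) (hp : IsProperMap p) :
    IsCoveringMap p := by
  rw [isCoveringMap_iff_isCoveringMapOn_univ]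
  refine hp.isClosedMap.isCoveringMapOn_of_isLocalHomeomorphOn (fun x _ => ?_)
    (h.isLocalHomeomorphOn)
  have h1 : IsCompact (p ⁻¹' {x}) := hp.isCompact_preimage isCompact_singleton
  exact h1.finite (IsDiscrete.of_openPartialHomeomorph p subset_rfl fun e _ => by
    obtain ⟨φ, hφ, rfl⟩ := h e
    exact ⟨φ, hφ, rfl⟩)

/-- A covering of the product of a sphere of dimension at least two and a vector space is
injective. -/
theorem IsCoveringMap.injective_of_sphere {E C : Type*} [TopologicalSpace E] [PreconnectedSpace E]
    [TopologicalSpace C] {p : E → C} (hp : IsCoveringMap p) (hsurj : Function.Surjective p)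
    {V F : Type*} [NormedAddCommGroup V] [InnerProductSpace ℝ V] [FiniteDimensional ℝ V]
    [NormedAddCommGroup F] [NormedSpace ℝ F] (hV : 2 < Module.finrank ℝ V)
    (h : Metric.sphere (0 : V) 1 × F ≃ₜ C) : Function.Injective p := by
  have : Nontrivial V := Module.nontrivial_of_finrank_pos (R := ℝ) (by lia)
  obtain ⟨v, hv⟩ := exists_norm_eq V zero_le_one
  have hv' : ‖-v‖ = 1 := by rwa [norm_neg]
  have hi := h.isOpenEmbedding.comp
    ((isOpenEmbedding_stereographic_symm hv).prodMap (IsOpenEmbedding.id (X := F)))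
  have hj := h.isOpenEmbedding.comp
    ((isOpenEmbedding_stereographic_symm hv').prodMap (IsOpenEmbedding.id (X := F)))
  have hri : Set.range (h ∘ Prod.map (stereographic hv).symm (id : F → F)) =
      h '' ({⟨v, by simpa using hv⟩}ᶜ ×ˢ Set.univ) := by
    rw [Set.range_comp, Set.range_prodMap, range_stereographic_symm, Set.range_id]
  have hrj : Set.range (h ∘ Prod.map (stereographic hv').symm (id : F → F)) =
      h '' ({⟨-v, by simpa using hv⟩}ᶜ ×ˢ Set.univ) := by
    rw [Set.range_comp, Set.range_prodMap, range_stereographic_symm, Set.range_id]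
  have hne : v ≠ -v := by
    intro h0
    have h1 := congrArg (inner ℝ v) h0
    rw [inner_neg_right, real_inner_self_eq_norm_sq, hv] at h1
    norm_num at h1
  refine IsCoveringMap.injective_of_isOpenEmbedding hp hsurj hi hj ?_ ?_
  · rw [hri, hrj, ← Set.image_union, ← Set.union_prod, ← Set.compl_inter]
    rw [Set.singleton_inter_eq_empty.2 (by simpa [Subtype.ext_iff] using hne)]
    simp
  · rw [hri, hrj, ← Set.image_inter h.injective, Set.prod_inter_prod, Set.univ_inter]
    refine IsConnected.image ?_ _ h.continuous.continuousOn
    refine IsConnected.prod ?_ isConnected_univ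
    -- The sphere minus two antipodal points is, stereographically, a vector space minus the origin.
    -- It is connected because that space has dimension at least two.
    have h1 : ({⟨v, by simpa using hv⟩}ᶜ ∩ {⟨-v, by simpa using hv⟩}ᶜ :
        Set (Metric.sphere (0 : V) 1)) = (stereographic hv).symm '' {0}ᶜ := by
      have h2 : (stereographic hv).symm 0 = ⟨-v, by simpa using hv⟩ := by
        have h3 := stereographic_apply_neg (⟨v, by simpa using hv⟩ : Metric.sphere (0 : V) 1)
        rw [← h3]
        refine (stereographic hv).left_inv ?_
        simpa [Subtype.ext_iff] using hne.symm
      rw [Set.image_compl_eq_range_sdiff_image (isOpenEmbedding_stereographic_symm hv).injective,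
        Set.image_singleton, h2, range_stereographic_symm, Set.sdiff_eq]
    rw [h1]
    refine IsConnected.image (isConnected_compl_singleton_of_one_lt_rank ?_ 0) _
      (isOpenEmbedding_stereographic_symm hv).continuous.continuousOn
    have h2 := (ℝ ∙ v).finrank_add_finrank_orthogonal
    rw [finrank_span_singleton (norm_ne_zero_iff.1 (hv.trans_ne one_ne_zero))] at h2
    rw [← Module.finrank_eq_rank]
    exact_mod_cast (by lia : 1 < Module.finrank ℝ (ℝ ∙ v)ᗮ)

end Coverings

/-! ### Immersed hypersurfaces contained in a model hypersurface. -/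

section HypersurfaceInHypersurface

open Topology

variable {n : ℕ} {M : Type*} [TopologicalSpace M] [ChartedSpace (Euc n) M] [IsManifold (𝓡 n) ∞ M]
  {X N : M → Euc (n + 1)}

/-- The differential of `(t, z) ↦ x z + t ν z` at `(0, y)` is surjective: the tangent hyperplane and
the normal span the ambient space. -/
theorem IsPatch.map_nhds_normal_variation {U : Set (Euc n)} {x ν : Euc n → Euc (n + 1)}
    (h : IsPatch U x ν) {y : Euc n} (hy : y ∈ U) :
    Filter.map (fun z : ℝ × Euc n => x z.2 + z.1 • ν z.2) (𝓝 (0, y)) = 𝓝 (x y) := by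
  have hG := h.isGaussPair hy
  have hx : HasStrictFDerivAt x (fderiv ℝ x y) y :=
    (h.smooth.contDiffAt (h.isOpen.mem_nhds hy)).hasStrictFDerivAt (by simp)
  have hν : HasStrictFDerivAt ν (fderiv ℝ ν y) y :=
    (h.smooth_normal.contDiffAt (h.isOpen.mem_nhds hy)).hasStrictFDerivAt (by simp)
  have hsnd : HasStrictFDerivAt (Prod.snd : ℝ × Euc n → Euc n) (ContinuousLinearMap.snd ℝ ℝ (Euc n))
      (0, y) := hasStrictFDerivAt_snd
  have hx' := HasStrictFDerivAt.comp (0, y) (g := x) hx hsnd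
  have hν' := HasStrictFDerivAt.comp (0, y) (g := ν) hν hsnd
  have h1 := hx'.add ((hasStrictFDerivAt_fst (p := ((0 : ℝ), y))).smul hν')
  have h2 := h1.map_nhds_eq_of_surj (by
    rw [LinearMap.range_eq_top]
    intro z
    refine ⟨(inner ℝ (ν y) z, pinv (fderiv ℝ x y) z), ?_⟩
    have h3 := apply_pinv hG.injective hG.norm_eq_one hG.orthogonal z
    simp [h3])
  rw [show x y = x y + (0 : ℝ) • ν y by rw [zero_smul, add_zero]]
  exact h2

theorem IsPatch.eventually_injective {U : Set (Euc n)} {x ν : Euc n → Euc (n + 1)}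
    (h : IsPatch U x ν) {y : Euc n} (hy : y ∈ U) :
    ∀ᶠ z in 𝓝 (y, y), x z.1 = x z.2 → z.1 = z.2 := by
  have hx : HasStrictFDerivAt x (fderiv ℝ x y) y :=
    (h.smooth.contDiffAt (h.isOpen.mem_nhds hy)).hasStrictFDerivAt (by simp)
  have hind : IsInducing (fderiv ℝ x y) := (LinearMap.isClosedEmbedding_of_injective
    (f := (fderiv ℝ x y).toLinearMap) (LinearMap.ker_eq_bot.2 (h.injective y hy))).isInducing
  obtain ⟨C, hC⟩ := (hx.isTheta_sub hind).2.bound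
  filter_upwards [hC] with z hz h0
  rw [h0, sub_self, norm_zero, mul_zero, norm_le_zero_iff, sub_eq_zero] at hz
  exact hz

/-- An immersed hypersurface contained in a closed set that it does not leave tangentially is
locally homeomorphic to that set. -/
theorem isLocalHomeomorph_codRestrict (hX : IsSmoothImmersion X) (hN : IsUnitNormal X N)
    {C : Set (Euc (n + 1))} (hC : ∀ p, X p ∈ C) {ε : ℝ} (hε : 0 < ε)
    (hnear : ∀ p t, |t| < ε → X p + t • N p ∈ C → t = 0) :
    IsLocalHomeomorph (Set.codRestrict X C hC) := by
  have hcont : Continuous (Set.codRestrict X C hC) := hX.smooth.continuous.codRestrict hC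
  have hopen : IsOpenMap (Set.codRestrict X C hC) := by
    rw [isOpenMap_iff_nhds_le]
    intro q O hO
    set φ := extChartAt (𝓡 n) q with hφ
    have hy := mem_extChartAt_target (I := 𝓡 n) q
    have h1 := (hX.isPatch_chart hN q).map_nhds_normal_variation hy
    -- Every point near `X q` has the form `X + t N` for small `t` and a point close to `q`. If it
    -- lies in `C` then `t = 0`, so it belongs to the image of `X`; this is openness relative to
    -- `C`.
    have h2 : {z : ℝ × Euc n | |z.1| < ε ∧ Set.codRestrict X C hC (φ.symm z.2) ∈ O} ∈
        𝓝 ((0 : ℝ), φ q) := by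
      refine Filter.inter_mem ?_ ?_
      · exact (continuous_abs.comp continuous_fst).continuousAt.eventually_lt_const (by simpa)
      · have h3 := (continuousAt_extChartAt_symm (I := 𝓡 n) q).tendsto
        rw [extChartAt_to_inv] at h3
        exact (h3.comp (continuous_snd.tendsto ((0 : ℝ), φ q))).eventually hO
    have h3 := Filter.image_mem_map h2 (m := fun z : ℝ × Euc n =>
      (X ∘ φ.symm) z.2 + z.1 • (N ∘ φ.symm) z.2)
    rw [h1, Function.comp, extChartAt_to_inv] at h3
    rw [nhds_subtype_eq_comap]
    refine ⟨_, h3, ?_⟩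
    rintro ⟨c, hc⟩ ⟨⟨t, z⟩, ⟨ht, hz⟩, hzc⟩
    have h4 : t = 0 := hnear (φ.symm z) t ht (by
      have h5 : X (φ.symm z) + t • N (φ.symm z) = c := hzc
      rwa [h5])
    have h5 : Set.codRestrict X C hC (φ.symm z) = ⟨c, hc⟩ := by
      apply Subtype.ext
      simpa [h4] using hzc
    rw [← h5]
    exact hz
  rw [isLocalHomeomorph_iff_isOpenEmbedding_restrict]
  intro q
  have hy := mem_extChartAt_target (I := 𝓡 n) q
  have h1 := (hX.isPatch_chart hN q).eventually_injective hy
  rw [nhds_prod_eq, Filter.eventually_prod_self_iff'] at h1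
  obtain ⟨t, ht, hinj⟩ := h1
  set φ := extChartAt (𝓡 n) q with hφ
  have hO : φ.source ∩ φ ⁻¹' t ∈ 𝓝 q := Filter.inter_mem (extChartAt_source_mem_nhds (I := 𝓡 n) q)
    ((continuousAt_extChartAt (I := 𝓡 n) q).preimage_mem_nhds ht)
  refine ⟨interior (φ.source ∩ φ ⁻¹' t), interior_mem_nhds.2 hO,
    .of_continuous_injective_isOpenMap (hcont.comp continuous_subtype_val) ?_
      (hopen.comp isOpen_interior.isOpenMap_subtype_val)⟩
  rintro ⟨a, ha⟩ ⟨b, hb⟩ hab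
  have ha' := interior_subset ha
  have hb' := interior_subset hb
  have h2 : X a = X b := congrArg Subtype.val hab
  have h3 := hinj _ ha'.2 _ hb'.2
  simp only [Function.comp, φ.left_inv ha'.1, φ.left_inv hb'.1] at h3
  exact Subtype.ext (φ.injOn ha'.1 hb'.1 (h3 h2))

end HypersurfaceInHypersurface

/-! ### Topology of round cylinders. -/

section Cylinders

variable {E : Type*} [NormedAddCommGroup E] [InnerProductSpace ℝ E] [FiniteDimensional ℝ E]

/-- The round cylinder is the product of a sphere and a vector space. -/
def cylinderHomeomorph (W : Submodule ℝ E) {R : ℝ} (hR : 0 < R) :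
    Metric.sphere (0 : W) 1 × Wᗮ ≃ₜ {y : E | ‖W.starProjection y‖ = R} where
  toFun z := ⟨R • ((z.1 : W) : E) + (z.2 : E), by
    have h1 : ‖(z.1 : W)‖ = 1 := by simp
    have h2 : W.starProjection (z.2 : E) = 0 := by
      rw [Submodule.starProjection_apply_eq_zero_iff]
      exact z.2.2
    have h3 : W.starProjection ((z.1 : W) : E) = (z.1 : W) :=
      Submodule.starProjection_eq_self_iff.2 (z.1 : W).2
    rw [Set.mem_ofPred_eq, map_add, map_smul, h2, h3, add_zero, norm_smul, Submodule.norm_coe, h1,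
      mul_one, Real.norm_of_nonneg hR.le]⟩
  invFun y := (⟨R⁻¹ • W.orthogonalProjectionOnto y, by
    have h1 : ‖W.orthogonalProjectionOnto (y : E)‖ = R := y.2
    rw [mem_sphere_zero_iff_norm, norm_smul, h1, norm_inv, Real.norm_of_nonneg hR.le,
      inv_mul_cancel₀ hR.ne']⟩, Wᗮ.orthogonalProjectionOnto y)
  left_inv z := by
    have h1 : W.orthogonalProjectionOnto (z.2 : E) = 0 :=
      Submodule.orthogonalProjectionOnto_apply_of_mem_orthogonal z.2.2
    have h2 : Wᗮ.orthogonalProjectionOnto ((z.1 : W) : E) = 0 :=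
      Submodule.orthogonalProjectionOnto_orthogonal_apply_eq_zero (z.1 : W).2
    refine Prod.ext (Subtype.ext ?_) ?_
    · simp [h1, hR.ne']
    · simp [h2]
  right_inv y := by
    apply Subtype.ext
    simp only [Submodule.coe_smul, smul_smul, mul_inv_cancel₀ hR.ne', one_smul]
    exact W.starProjection_add_starProjection_orthogonal (y : E)
  continuous_toFun := by fun_prop
  continuous_invFun := by fun_prop

theorem preconnectedSpace_cylinder (W : Submodule ℝ E) {R : ℝ} (hR : 0 < R)
    (hW : 1 < Module.finrank ℝ W) : PreconnectedSpace {y : E | ‖W.starProjection y‖ = R} := by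
  have h1 : 1 < Module.rank ℝ W := by
    rw [← Module.finrank_eq_rank]
    exact_mod_cast hW
  have : PreconnectedSpace (Metric.sphere (0 : W) 1) :=
    Subtype.preconnectedSpace (isPreconnected_sphere h1 0 1)
  refine ⟨?_⟩
  rw [← (cylinderHomeomorph W hR).surjective.range_eq]
  exact isPreconnected_range (cylinderHomeomorph W hR).continuous

end Cylinders

/-! ### Identification of the image. -/

section Classification

variable {n : ℕ} {M : Type*} [TopologicalSpace M] [ChartedSpace (Euc n) M] [IsManifold (𝓡 n) ∞ M]
  {X N : M → Euc (n + 1)}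

-- The image is open because the map is a local homeomorphism, closed because it is proper, and
-- nonempty in a connected target.
omit [ChartedSpace (Euc n) M] [IsManifold (𝓡 n) ∞ M] in
theorem surjective_codRestrict [Nonempty M] (hproper : IsProperMap X) {C : Set (Euc (n + 1))}
    (hC : ∀ p, X p ∈ C) (h : IsLocalHomeomorph (Set.codRestrict X C hC)) [PreconnectedSpace C] :
    IsProperMap (Set.codRestrict X C hC) ∧ Function.Surjective (Set.codRestrict X C hC) := by
  have hp : IsProperMap (Set.codRestrict X C hC) :=
    isProperMap_of_comp_of_inj h.continuous continuous_subtype_val hproper Subtype.val_injective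
  refine ⟨hp, ?_⟩
  rw [← Set.range_eq_univ]
  exact IsClopen.eq_univ ⟨hp.isClosed_range, h.isOpenMap.isOpen_range⟩ (Set.range_nonempty _)

omit [TopologicalSpace M] [ChartedSpace (Euc n) M] [IsManifold (𝓡 n) ∞ M] in
theorem range_eq_of_surjective_codRestrict {C : Set (Euc (n + 1))} (hC : ∀ p, X p ∈ C)
    (h : Function.Surjective (Set.codRestrict X C hC)) : Set.range X = C := by
  refine Set.Subset.antisymm (Set.range_subset_iff.2 hC) fun c hc => ?_
  obtain ⟨p, hp⟩ := h ⟨c, hc⟩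
  exact ⟨p, congrArg Subtype.val hp⟩

/-- When `c = 0` all rays end at the origin, so the focal equation holds at `s = 0` whatever the
curvature. -/
theorem IsPrincipalFrame.curvature_eq_zero (hX : IsSmoothImmersion X)
    (hproper : IsProperMap X) (hN : IsUnitNormal X N) (hc : ∀ p, inner ℝ (X p) (N p) = (0 : ℝ))
    {p : M} {e : Module.Basis (Fin n) ℝ (Euc n)} {k : Fin n → ℝ} (hf : IsPrincipalFrame X N p e k)
    (i : Fin n) : k i = 0 :=
  hf.curvature_eq_zero_of_focus (c := 0) hX hproper hN (fun p => by rw [hc, neg_zero]) i le_rfl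
    (by ring)

theorem isHyperplane_of_support_eq_zero [T2Space M] [ConnectedSpace M] (hX : IsSmoothImmersion X)
    (hproper : IsProperMap X) (hN : IsUnitNormal X N) (hc : ∀ p, inner ℝ (X p) (N p) = (0 : ℝ)) :
    Function.Injective X ∧ IsHyperplane (Set.range X) := by
  obtain ⟨p₀⟩ : Nonempty M := inferInstance
  obtain ⟨e, k, hf⟩ := exists_isPrincipalFrame (hX.isGaussPair hN p₀)
  obtain ⟨W, hW, hNW, hXW⟩ := exists_subspace_of_support_eq hX hN (c := 0)
    (fun p => by rw [hc, neg_zero])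
    (fun p e k hf i => by rw [hf.curvature_eq_zero hX hproper hN hc i]; ring) hf
  have hW1 : Module.finrank ℝ W = 1 := by
    simp only [zero_mul, Finset.sum_const_zero, add_zero] at hW
    exact_mod_cast hW
  have hC : ∀ p, X p ∈ (Wᗮ : Set (Euc (n + 1))) := fun p => by
    rw [SetLike.mem_coe, ← Submodule.starProjection_apply_eq_zero_iff, hXW, zero_smul, neg_zero]
  have hN0 : ∀ p, N p ≠ 0 := fun p => norm_ne_zero_iff.1 ((hN.norm_eq_one p).trans_ne one_ne_zero)
  have hlocal := isLocalHomeomorph_codRestrict hX hN hC one_pos fun p t _ ht => by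
    have h1 : t • N p ∈ Wᗮ := by
      have := Wᗮ.sub_mem ht (hC p)
      rwa [add_sub_cancel_left] at this
    have h2 : t • N p = 0 := by
      have h3 := W.inner_right_of_mem_orthogonal (W.smul_mem t (hNW p)) h1
      rwa [inner_self_eq_zero] at h3
    exact (smul_eq_zero.1 h2).resolve_right (hN0 p)
  have : PreconnectedSpace (Wᗮ : Set (Euc (n + 1))) :=
    inferInstanceAs (PreconnectedSpace (Wᗮ : Submodule ℝ (Euc (n + 1))))
  obtain ⟨hp, hsurj⟩ := surjective_codRestrict hproper hC hlocal
  refine ⟨?_, N p₀, hN0 p₀, ?_⟩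
  · have h1 : Function.Injective (Set.codRestrict X _ hC) :=
      -- The hyperplane is simply connected, so both pieces of the cover may be taken to be the
      -- whole of it.
      IsCoveringMap.injective_of_isOpenEmbedding
        (IsLocalHomeomorph.isCoveringMap_of_isProperMap hlocal hp) hsurj
        (A := (Wᗮ : Submodule ℝ (Euc (n + 1)))) (B := (Wᗮ : Submodule ℝ (Euc (n + 1))))
        (i := id) (j := id) .id .id (by simp)
        (by simpa using isConnected_univ (α := (Wᗮ : Submodule ℝ (Euc (n + 1)))))
    rwa [Set.injective_codRestrict] at h1
  · rw [range_eq_of_surjective_codRestrict hC hsurj]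
    ext y
    rw [SetLike.mem_coe, Submodule.mem_orthogonal, Set.mem_ofPred_eq]
    refine ⟨fun h => h _ (hNW p₀), fun h w hw => ?_⟩
    obtain ⟨a, ha⟩ := exists_smul_eq_of_finrank_eq_one hW1 (x := ⟨N p₀, hNW p₀⟩)
      (by simpa [Subtype.ext_iff] using hN0 p₀) ⟨w, hw⟩
    have ha : a • N p₀ = w := congrArg Subtype.val ha
    rw [← ha, real_inner_smul_left, h, mul_zero]

theorem exists_cylinder_of_support_eq [T2Space M] [ConnectedSpace M] (hX : IsSmoothImmersion X)
    (hproper : IsProperMap X) (hN : IsUnitNormal X N) {r : ℕ} (hshr : IsSelfShrinker X N (r + 1))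
    (hpos : NewtonPosDef X N r) {c : ℝ} (hc : ∀ p, inner ℝ (X p) (N p) = -c) (hc0 : c ≠ 0) :
    ∃ m : ℕ, r + 1 ≤ m ∧ m ≤ n ∧ IsRoundCylinder m (delta m (r + 1)) (Set.range X) ∧
      (m ≠ 1 → Function.Injective X) := by
  obtain ⟨p₀⟩ : Nonempty M := inferInstance
  obtain ⟨e, k, hf⟩ := exists_isPrincipalFrame (hX.isGaussPair hN p₀)
  have hk : ∀ (p : M) e k, IsPrincipalFrame X N p e k → ∀ i, k i = 0 ∨ k i = c⁻¹ :=
    fun p e k hf => hf.curvature_eq_or hX hproper hN hshr hpos hc hc0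
  obtain ⟨W, hW, hNW, hXW⟩ := exists_subspace_of_support_eq hX hN hc
    (fun p e k hf i => by
      rcases hk p e k hf i with h | h
      · rw [h]; ring
      · rw [h]; field_simp) hf
  obtain ⟨hrm, hdelta⟩ := hf.abs_support_eq_delta hshr hc hc0 (hk p₀ e k hf)
  set m := (Finset.univ.filter (k · ≠ 0)).card with hm
  have hmn : m ≤ n := by simpa using Finset.card_filter_le Finset.univ (k · ≠ 0)
  have hsum : ∑ i, c * k i = m := by
    rw [hm, Finset.card_filter, Nat.cast_sum]
    refine Finset.sum_congr rfl fun i _ => ?_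
    rcases hk p₀ e k hf i with h | h
    · simp [h]
    · simp [h, hc0]
  have hWm : Module.finrank ℝ W = m + 1 := by
    rw [hsum, add_comm (1 : ℝ)] at hW
    exact_mod_cast hW
  have hc0' : 0 < |c| := abs_pos.2 hc0
  refine ⟨m, hrm, hmn, ?_⟩
  rw [← hdelta]
  have hC : ∀ p, X p ∈ {y : Euc (n + 1) | ‖W.starProjection y‖ = |c|} := fun p => by
    rw [Set.mem_ofPred_eq, hXW, norm_neg, norm_smul, hN.norm_eq_one, mul_one, Real.norm_eq_abs]
  -- The projection of `X + t N` to `W` is `(t - c) N`, which has norm `|c|` only for `t = 0` and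
  -- for the antipodal value `t = 2c`; the latter is excluded by `|t| < |c|`.
  have hlocal := isLocalHomeomorph_codRestrict hX hN hC hc0' fun p t ht h => by
    rw [Set.mem_ofPred_eq, map_add, map_smul, hXW,
      Submodule.starProjection_eq_self_iff.2 (hNW p), ← neg_smul, ← add_smul, norm_smul,
      hN.norm_eq_one, mul_one, Real.norm_eq_abs, abs_eq_abs] at h
    rcases h with h | h
    · rw [show t = 2 * c by linarith, abs_mul, abs_two] at ht
      linarith
    · linarith
  have := preconnectedSpace_cylinder W hc0' (by rw [hWm]; lia)
  obtain ⟨hp, hsurj⟩ := surjective_codRestrict hproper hC hlocal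
  refine ⟨⟨W, hWm, range_eq_of_surjective_codRestrict hC hsurj⟩, fun hm1 => ?_⟩
  -- Since `1 ≤ r + 1 ≤ m`, excluding `m = 1` leaves `m ≥ 2`, that is, `dim W > 2`.
  have h1 := IsCoveringMap.injective_of_sphere
    (IsLocalHomeomorph.isCoveringMap_of_isProperMap hlocal hp) hsurj (by rw [hWm]; lia)
    (cylinderHomeomorph W hc0')
  rwa [Set.injective_codRestrict] at h1

end Classification

end RMeanCurvature

end

/-! ### The main theorem. -/

open RMeanCurvature in
theorem theorem1p1 (n r : ℕ) (hr : 1 ≤ r) (hrn : r ≤ n)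
    {M : Type*} [TopologicalSpace M] [T2Space M] [ConnectedSpace M] [ChartedSpace (Euc n) M]
    [IsManifold (𝓡 n) ∞ M] (X N : M → Euc (n + 1))
    (hX : IsSmoothImmersion X) (hproper : IsProperMap X) (hN : IsUnitNormal X N)
    (hshrinker : IsSelfShrinker X N r)
    (hpsd : NewtonPosSemidef X N (r - 1)) (hbdd : NewtonBounded X N (r - 1))
    (hle : ∀ p, modifiedNormSq X N (r - 1) p ≤ r) :
    ((∀ p, modifiedNormSq X N (r - 1) p < r) →
      Function.Injective X ∧ IsHyperplane (Set.range X)) ∧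
    (NewtonPosDef X N (r - 1) →
      (Set.range X = Metric.sphere 0 (delta n r) ∧ (n ≠ 1 → Function.Injective X)) ∨
      (∃ m : ℕ, r ≤ m ∧ m ≤ n - 1 ∧ IsRoundCylinder m (delta m r) (Set.range X) ∧
        (m ≠ 1 → Function.Injective X)) ∨
      (r = 1 ∧ Function.Injective X ∧ IsHyperplane (Set.range X))) := by
  -- From here on `r` denotes the `r - 1` of the statement, the index of the Newton transformation.
  obtain ⟨r, rfl⟩ := Nat.exists_eq_add_of_le' hr
  simp only [Nat.add_sub_cancel, Nat.cast_add, Nat.cast_one] at *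
  refine ⟨fun hlt => ?_, fun hpos => ?_⟩
  · exact isHyperplane_of_support_eq_zero hX hproper hN
      (support_eq_zero_of_lt hX hproper hN hshrinker hpsd hbdd hlt)
  obtain ⟨a, ha⟩ := exists_support_eq hX hproper hN hshrinker hpsd hbdd hle hpos
  by_cases ha0 : a = 0
  · subst ha0
    obtain ⟨p⟩ : Nonempty M := inferInstance
    obtain ⟨e, k, hf⟩ := exists_isPrincipalFrame (hX.isGaussPair hN p)
    have hk : ∀ i ∈ Finset.univ.erase (⟨0, by lia⟩ : Fin n), k i = 0 ∨ k i = 0 := fun i _ =>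
      Or.inl (hf.curvature_eq_zero hX hproper hN ha i)
    -- All curvatures vanish, so `P_r` is zero unless `r = 0`; positive definiteness leaves only `r
    -- = 0`. The index `0` exists because `n ≥ r + 1`.
    have h1 := hf.es_pos (hpos p) ⟨0, by lia⟩
    rw [es_eq_choose k _ 0 hk] at h1
    have hr0 : r = 0 := by
      by_contra h
      rw [zero_pow h, mul_zero] at h1
      exact lt_irrefl _ h1
    exact Or.inr (Or.inr ⟨by rw [hr0], isHyperplane_of_support_eq_zero hX hproper hN ha⟩)
  · obtain ⟨m, hrm, hmn, hcyl, hinj⟩ := exists_cylinder_of_support_eq hX hproper hN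
      hshrinker hpos (c := -a) (fun p => by rw [ha, neg_neg]) (neg_ne_zero.2 ha0)
    -- For `m = n` the subspace `W` is the whole space and the cylinder is a sphere.
    rcases hmn.eq_or_lt with rfl | hlt
    · refine Or.inl ⟨?_, hinj⟩
      obtain ⟨W, hW, hrange⟩ := hcyl
      have hWtop : W = ⊤ := Submodule.eq_top_of_finrank_eq (by simpa using hW)
      rw [hrange]
      ext y
      have hy : W.starProjection y = y := Submodule.starProjection_eq_self_iff.2 (by simp [hWtop])
      simp [hy]
    · exact Or.inr (Or.inl ⟨m, hrm, by lia, hcyl, hinj⟩)
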